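/- **Setting.** Algorithms are programs with an explicit step count; "polynomial time" means worst-case running time polynomial in the bit size of the input, and probabilistic algorithms additionally receive polynomially many uniform coins. A function of the security parameter $\kappa$ is *negligible* if it is eventually smaller than every inverse polynomial. Fix a generator of bilinear groups: on security parameter $\kappa$ it selects groups $\mathbb G,\mathbb G_T$ of prime order $p>2^\kappa$ with a map $e:\mathbb G\times\mathbb G\to\mathbb G_T$ such that $e(g^a,h^b)=e(g,h)^{ab}$ and $e(g,h)\ne 1$ whenever $g,h\neq 1$; elements have unique encodings of polynomial size, and the group operations, the pairing and membership in $\mathbb G$ are computable in polynomial time. Let $N=N(\kappa)\ge 1$ be polynomially bounded. **Assumption.** $\ell$-DBDHE: every probabilistic polynomial-time algorithm has negligible advantage in distinguishing $T=e(g,h)^{\alpha^{\ell+1}}$ from a uniform $T\in\mathbb G_T$, given $g,g^{\alpha},\dots,g^{\alpha^\ell},g^{\alpha^{\ell+2}},\dots,g^{\alpha^{2\ell}},h,T$ for a random generator $g$, random $\alpha\in\mathbb Z_p^*$ and random $h\in\mathbb G$. **The A-IBBE scheme.** *Setup.* The master public key is $(g,g_1=g^\alpha,g_2,g_3,z,h_0=g^{a_0},\dots,h_N=g^{a_N})$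 for a random generator $g$, random $g_2,g_3,z\in\mathbb G$, $\alpha\in\mathbb Z_p^*$ and $a_i\in\mathbb Z_p$. *Key generation* for $\mathsf{ID}\in\mathbb Z_p$: the user sends $R=g_2^{t_0}g^{\theta}$ and proves knowledge of $(t_0,\theta)$ by Okamoto's three-move witness-indistinguishable protocol (first message $W$, uniform challenge $c\in\mathbb Z_p$, response $(u,v)$, check $g_2^ug^v=WR^c$). If the proof fails the authority (PKG) returns $\bot$; otherwise it picks $r,t_1\in\mathbb Z_p^*$ at random and returns $$\bigl((g_2^{t_1}Rg_3)^{\alpha}z^r,\ g^r,\ h_1^rh_0^{-\mathsf{ID}\,r},\dots,h_N^rh_{N-1}^{-\mathsf{ID}\,r},\ t_1\bigr).$$ A private key $(K_1,K_2,T_0,\dots,T_{N-1},t)$ is *valid* for $\mathsf{ID}$ if $e(K_1,g)=e(g_1,g_2)^{t}e(g_1,g_3)e(z,K_2)$ and $e(g,T_i)=e(K_2,h_{i+1}h_i^{-\mathsf{ID}})$ for $0\le i<N$. *Encryption* of $m\in\mathbb G_T$ for the receiver set $S$, where $|S|=n\le N$: with $\prod_{\mathsf{ID}\in S}(X-\mathsf{ID})=\sum_k\rho_kX^k$,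 put $H_S=z\prod_k h_k^{\rho_k}$, pick $s\in\mathbb Z_p^*$ at random and output $$(C_0,C_1,C_2,C_3)=\bigl(m\,e(g_1,g_3)^s,\ g^s,\ H_S^s,\ e(g_1,g_2)^s\bigr).$$ *Decryption* with a key for $\mathsf{ID}\in S$: with $\prod_{\mathsf{ID}'\in S\setminus\{\mathsf{ID}\}}(X-\mathsf{ID}')=\sum_j y_jX^j$ and $D=K_1\prod_jT_j^{y_j}$, output $C_0\,e(C_1,D)^{-1}e(C_2,K_2)\,C_3^{t}$. **Tracing.** Given a key for $\mathsf{ID}$, $S=\{\mathsf{ID}\}$, $\varepsilon$ and oracle access to a stateless probabilistic decryption device, repeat $\lceil16\kappa/\varepsilon\rceil$ times: compute $C_1=g^s$, $C_2=H_S^s$ with random $s\in\mathbb Z_p^*$, pick random $C_3,m\in\mathbb G_T$, choose $C_0$ such that decrypting $(C_0,C_1,C_2,C_3)$ with the given key yields $m$, and feed the device with this ciphertext and $S$. If the device never answers $m$, accuse the PKG; otherwise accuse the user. **Selective-ID black-box ComputeNewKey game.** The dishonest user announces a target identity $\mathsf{ID}^\star$ before seeing the master public key, then takes part, sequentially, in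 polynomially many executions of the key generation protocol with the honest PKG, where no identity is issued more than one key ($\mathsf{ID}^\star$ is allowed), and finally outputs a private key for $\mathsf{ID}^\star$ and a stateless probabilistic polynomial-time decryption device. The user wins if the key is valid for $\mathsf{ID}^\star$, the device is $\varepsilon$-useful (it opens a random encryption of a random message for $\{\mathsf{ID}^\star\}$ with probability at least $\varepsilon$), and tracing with this key and device accuses the PKG. **Theorem.** Let $\varepsilon=\varepsilon(\kappa)$ be bounded below by an inverse polynomial. If the $(N+1)$-DBDHE assumption holds, then every probabilistic polynomial-time dishonest user wins the selective-ID ComputeNewKey game for the A-IBBE scheme with negligible probability. -/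

import Mathlib

namespace AIBBE

/-! ### A machine model with a step count

Programs act on binary trees whose leaves carry natural numbers.  The running time charges every
primitive instruction the full bit size of what it reads and of what it writes, so the time of a run
bounds the size of its result, and the programs whose time is polynomial in the size of the input
compute exactly the polynomial-time functions.  Randomness is an explicit string of fair coins that
is part of the input. -/

/-- The data a program works on. -/
inductive Data where
  | num (n : ℕ) : Data
  | pair (a b : Data) : Data

namespace Data

/-- The bit size. -/
def size : Data → ℕ
  | num n => n.size + 1
  | pair a b => a.size + b.size + 1

/-- The number at a leaf (`0` for a pair). -/
def toNat : Data → ℕ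
  | num n => n
  | pair _ _ => 0

/-- The first component (`0` for a leaf). -/
def fst : Data → Data
  | num _ => num 0
  | pair a _ => a

/-- The second component (`0` for a leaf). -/
def snd : Data → Data
  | num _ => num 0
  | pair _ b => b

/-- Lists are nested pairs. -/
def ofList : List Data → Data
  | [] => num 0
  | a :: l => pair a (ofList l)

/-- The `k`-th entry of a list. -/
def nth : ℕ → Data → Data
  | 0, d => d.fst
  | k + 1, d => nth k d.snd

end Data

/-- Primitive instructions.  Arithmetic is that of the natural numbers; `size` is the length of the
binary expansion. -/
inductive Prim where
  | id : Prim
  | const (n : ℕ) : Prim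
  | fst : Prim
  | snd : Prim
  | isPair : Prim
  | size : Prim
  | add : Prim
  | sub : Prim
  | mul : Prim
  | div : Prim
  | mod : Prim

/-- The effect of a primitive instruction. -/
def Prim.run : Prim → Data → Data
  | .id, x => x
  | .const n, _ => .num n
  | .fst, x => x.fst
  | .snd, x => x.snd
  | .isPair, .num _ => .num 0
  | .isPair, .pair _ _ => .num 1
  | .size, x => .num x.toNat.size
  | .add, x => .num (x.fst.toNat + x.snd.toNat)
  | .sub, x => .num (x.fst.toNat - x.snd.toNat)
  | .mul, x => .num (x.fst.toNat * x.snd.toNat)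
  | .div, x => .num (x.fst.toNat / x.snd.toNat)
  | .mod, x => .num (x.fst.toNat % x.snd.toNat)

/-- Programs.  `comp g f` runs `f` and then `g`; `ite c f g` runs `g` if `c` returns the number `0`,
and `f` otherwise; `loop n f` runs `n` once and then iterates `f` as often as the number returned
by `n` says. -/
inductive Prog where
  | prim (o : Prim) : Prog
  | pair (f g : Prog) : Prog
  | comp (g f : Prog) : Prog
  | ite (c f g : Prog) : Prog
  | loop (n f : Prog) : Prog

namespace Prog

/-- The result of a program on an input, with the number of steps taken. -/
def exec : Prog → Data → Data × ℕ
  | prim o, x => (o.run x, x.size + (o.run x).size)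
  | pair f g, x => (.pair (f.exec x).1 (g.exec x).1, (f.exec x).2 + (g.exec x).2 + 1)
  | comp g f, x => ((g.exec (f.exec x).1).1, (f.exec x).2 + (g.exec (f.exec x).1).2)
  | ite c f g, x =>
      match (c.exec x).1 with
      | .num 0 => ((g.exec x).1, (c.exec x).2 + (g.exec x).2 + 1)
      | _ => ((f.exec x).1, (c.exec x).2 + (f.exec x).2 + 1)
  | loop n f, x =>
      (fun s : Data × ℕ => ((f.exec s.1).1, s.2 + (f.exec s.1).2 + 1))^[(n.exec x).1.toNat]
        (x, (n.exec x).2 + x.size)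

/-- The result. -/
def run (P : Prog) (x : Data) : Data := (P.exec x).1

/-- The running time. -/
def time (P : Prog) (x : Data) : ℕ := (P.exec x).2

/-- Worst-case polynomial running time, in the size of the input. -/
def PolyTime (P : Prog) : Prop :=
  ∃ q : Polynomial ℕ, ∀ x : Data, P.time x ≤ q.eval x.size

end Prog

/-! ### Asymptotics and probabilities -/

/-- Negligible functions of the security parameter: smaller than every inverse polynomial. -/
def Negligible (f : ℕ → ℝ) : Prop :=
  Asymptotics.SuperpolynomialDecay Filter.atTop (fun κ : ℕ => (κ : ℝ)) f

/-- Functions bounded by a polynomial. -/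
def PolyBounded (f : ℕ → ℕ) : Prop :=
  ∃ q : Polynomial ℕ, ∀ κ, f κ ≤ q.eval κ

/-- Functions bounded below by the inverse of a polynomial. -/
def Noticeable (f : ℕ → ℝ) : Prop :=
  ∃ q : Polynomial ℕ, ∀ κ, 1 ≤ ((q.eval κ : ℕ) : ℝ) * f κ

noncomputable section

/-- The probability that an experiment returns `true`. -/
def Pr (d : PMF Bool) : ℝ := (d true).toReal

/-- A uniformly random element. -/
def unif (α : Type) [Finite α] [Nonempty α] : PMF α :=
  haveI := Fintype.ofFinite α
  PMF.uniformOfFintype α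

/-- A uniformly random string of `n` coins, as a number below `2 ^ n`. -/
def coins (n : ℕ) : PMF Data := (unif (Fin (2 ^ n))).map fun c => Data.num c

/-! ### Bilinear groups -/

/-- Bilinear groups `(G, GT)` of prime order `p`, with elements represented by natural numbers (in a
unique way) and a description `desc` that algorithms take as input. -/
structure BilinearGroup where
  p : ℕ
  [prime : Fact p.Prime]
  G : Type
  GT : Type
  [groupG : CommGroup G]
  [groupGT : CommGroup GT]
  [fintypeG : Fintype G]
  [fintypeGT : Fintype GT]
  card_G : Fintype.card G = p
  card_GT : Fintype.card GT = p
  e : G → G → GT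
  bilinear : ∀ (g h : G) (a b : ℤ), e (g ^ a) (h ^ b) = e g h ^ (a * b)
  nondegenerate : ∀ g h : G, g ≠ 1 → h ≠ 1 → e g h ≠ 1
  encG : G → ℕ
  encG_injective : Function.Injective encG
  encGT : GT → ℕ
  encGT_injective : Function.Injective encGT
  desc : Data

attribute [instance] BilinearGroup.prime BilinearGroup.groupG BilinearGroup.groupGT
  BilinearGroup.fintypeG BilinearGroup.fintypeGT

namespace BilinearGroup

instance (B : BilinearGroup) : Nonempty {g : B.G // g ≠ 1} := by
  have h : 1 < Fintype.card B.G := by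
    rw [B.card_G]
    exact B.prime.out.one_lt
  obtain ⟨g, hg⟩ := Fintype.exists_ne_of_one_lt_card h 1
  exact ⟨⟨g, hg⟩⟩

/-- An element of `G` as data. -/
def dG (B : BilinearGroup) (x : B.G) : Data := .num (B.encG x)

/-- An element of `GT` as data. -/
def dGT (B : BilinearGroup) (x : B.GT) : Data := .num (B.encGT x)

/-- An element of `ℤ_p` as data. -/
def dZ (B : BilinearGroup) (x : ZMod B.p) : Data := .num x.val

/-- The element of `G` represented by a datum, if there is one. -/
def readG (B : BilinearGroup) (d : Data) : Option B.G :=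
  Function.partialInv B.encG d.toNat

/-- The element of `ℤ_p` represented by a datum; numbers are read modulo `p`. -/
def readZ (B : BilinearGroup) (d : Data) : ZMod B.p := (d.toNat : ZMod B.p)

/-- The common input of all algorithms: the security parameter in unary (as a number with
`κ + 1` binary digits), the order and the description of the groups. -/
def params (B : BilinearGroup) (κ : ℕ) : Data :=
  .pair (.num (2 ^ κ)) (.pair (.num B.p) B.desc)

end BilinearGroup

/-- A generator of bilinear groups: on security parameter `κ` it selects groups of prime order
greater than `2 ^ κ`.  The group operations, the pairing and membership in `G` are computable in
polynomial time, and descriptions and group elements have polynomial size. -/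
structure GroupGenerator where
  Idx : Type
  grp : Idx → BilinearGroup
  gen : ℕ → PMF Idx
  order_gt : ∀ κ, ∀ i ∈ (gen κ).support, 2 ^ κ < (grp i).p
  sizeBound : Polynomial ℕ
  desc_size : ∀ κ, ∀ i ∈ (gen κ).support, (grp i).desc.size ≤ sizeBound.eval κ
  encG_size : ∀ κ, ∀ i ∈ (gen κ).support, ∀ x, ((grp i).dG x).size ≤ sizeBound.eval κ
  encGT_size : ∀ κ, ∀ i ∈ (gen κ).support, ∀ x, ((grp i).dGT x).size ≤ sizeBound.eval κ
  mulG : Prog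
  mulG_polyTime : mulG.PolyTime
  mulG_run : ∀ i x y,
    mulG.run (.pair (grp i).desc (.pair ((grp i).dG x) ((grp i).dG y))) = (grp i).dG (x * y)
  mulGT : Prog
  mulGT_polyTime : mulGT.PolyTime
  mulGT_run : ∀ i x y,
    mulGT.run (.pair (grp i).desc (.pair ((grp i).dGT x) ((grp i).dGT y))) = (grp i).dGT (x * y)
  pairing : Prog
  pairing_polyTime : pairing.PolyTime
  pairing_run : ∀ i x y,
    pairing.run (.pair (grp i).desc (.pair ((grp i).dG x) ((grp i).dG y))) =
      (grp i).dGT ((grp i).e x y)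
  memG : Prog
  memG_polyTime : memG.PolyTime
  memG_run_mem : ∀ i x, memG.run (.pair (grp i).desc ((grp i).dG x)) = .num 1
  memG_run_notMem : ∀ i n, n ∉ Set.range (grp i).encG →
    memG.run (.pair (grp i).desc (.num n)) = .num 0

/-! ### The decision bilinear Diffie-Hellman exponent assumption -/

/-- A probabilistic algorithm: a program, and the number of coins it uses. -/
structure Distinguisher where
  prog : Prog
  coins : Polynomial ℕ

/-- The distinguishing experiment for `ℓ`-DBDHE in given groups.  The input contains
`g ^ (α ^ i)` for `i = 0, …, ℓ, ℓ + 2, …, 2ℓ`, a random `h`, and `T`, which is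
`e(g, h) ^ (α ^ (ℓ + 1))` if `real` is true and uniformly random in `GT` otherwise.  The experiment
returns whether the algorithm answers `1`. -/
def dbdheExp (B : BilinearGroup) (κ ℓ : ℕ) (D : Distinguisher) (real : Bool) : PMF Bool := do
  let g ← unif {g : B.G // g ≠ 1}
  let α ← unif (ZMod B.p)ˣ
  let h ← unif B.G
  let U ← unif B.GT
  let ω ← coins (D.coins.eval κ)
  let T := if real then B.e g.1 h ^ ((α : ZMod B.p) ^ (ℓ + 1)).val else U
  let powers := ((List.range (2 * ℓ + 1)).filter (fun i => i ≠ ℓ + 1)).map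
    fun i => B.dG (g.1 ^ ((α : ZMod B.p) ^ i).val)
  let out := D.prog.run (.pair (B.params κ) (.pair (.num ℓ)
    (.pair (.ofList powers) (.pair (B.dG h) (.pair (B.dGT T) ω)))))
  pure (out.toNat == 1)

/-- The advantage of an algorithm against `ℓ`-DBDHE. -/
def dbdheAdv (𝒢 : GroupGenerator) (ℓ : ℕ → ℕ) (D : Distinguisher) (κ : ℕ) : ℝ :=
  |Pr ((𝒢.gen κ).bind fun i => dbdheExp (𝒢.grp i) κ (ℓ κ) D true) -
    Pr ((𝒢.gen κ).bind fun i => dbdheExp (𝒢.grp i) κ (ℓ κ) D false)|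

/-- The `ℓ`-DBDHE assumption: every probabilistic polynomial-time algorithm has negligible
advantage. -/
def DBDHE (𝒢 : GroupGenerator) (ℓ : ℕ → ℕ) : Prop :=
  ∀ D : Distinguisher, D.prog.PolyTime → Negligible (dbdheAdv 𝒢 ℓ D)

/-! ### The accountable authority identity-based broadcast encryption scheme -/

/-- Master public keys, for at most `N` receivers per ciphertext. -/
structure PublicKey (B : BilinearGroup) (N : ℕ) where
  g : B.G
  g₁ : B.G
  g₂ : B.G
  g₃ : B.G
  z : B.G
  h : Fin (N + 1) → B.G

/-- Private keys `(K₁, K₂, T₀, …, T_{N-1}, t)`; the blinded keys that the authority sends have the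
same shape. -/
structure Key (B : BilinearGroup) (N : ℕ) where
  K₁ : B.G
  K₂ : B.G
  T : Fin N → B.G
  t : ZMod B.p

/-- Ciphertexts. -/
structure Ciphertext (B : BilinearGroup) where
  C₀ : B.GT
  C₁ : B.G
  C₂ : B.G
  C₃ : B.GT

section Scheme

variable {B : BilinearGroup} {N : ℕ}

/-- A public key as data. -/
def PublicKey.toData (pk : PublicKey B N) : Data :=
  .pair (B.dG pk.g) (.pair (B.dG pk.g₁) (.pair (B.dG pk.g₂) (.pair (B.dG pk.g₃)
    (.pair (B.dG pk.z) (.ofList (List.ofFn fun i => B.dG (pk.h i)))))))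

/-- A key as data. -/
def Key.toData (K : Key B N) : Data :=
  .pair (B.dG K.K₁) (.pair (B.dG K.K₂)
    (.pair (.ofList (List.ofFn fun i => B.dG (K.T i))) (B.dZ K.t)))

/-- The key represented by a datum, if its components represent group elements. -/
def Key.read (B : BilinearGroup) (N : ℕ) (d : Data) : Option (Key B N) := do
  let K₁ ← B.readG d.fst
  let K₂ ← B.readG d.snd.fst
  let T ← Function.partialInv (fun (T : Fin N → B.G) i => B.encG (T i))
    (fun i => (Data.nth i d.snd.snd.fst).toNat)
  pure ⟨K₁, K₂, T, B.readZ d.snd.snd.snd⟩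

/-- A ciphertext as data. -/
def Ciphertext.toData (C : Ciphertext B) : Data :=
  .pair (B.dGT C.C₀) (.pair (B.dG C.C₁) (.pair (B.dG C.C₂) (B.dGT C.C₃)))

/-- Setup, returning the master public key and the part `α` of the master secret key. -/
def setup (B : BilinearGroup) (N : ℕ) : PMF (PublicKey B N × (ZMod B.p)ˣ) := do
  let g ← unif {g : B.G // g ≠ 1}
  let z ← unif B.G
  let a ← unif (Fin (N + 1) → ZMod B.p)
  let α ← unif (ZMod B.p)ˣ
  let g₂ ← unif B.G
  let g₃ ← unif B.G
  pure (⟨g.1, g.1 ^ (α : ZMod B.p).val, g₂, g₃, z, fun i => g.1 ^ (a i).val⟩, α)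

/-- The blinded key that the authority returns for the identity `ID` and the commitment `R`. -/
def issueKey (pk : PublicKey B N) (α : (ZMod B.p)ˣ) (ID : ZMod B.p) (R : B.G) :
    PMF (Key B N) := do
  let r ← unif (ZMod B.p)ˣ
  let t₁ ← unif (ZMod B.p)ˣ
  pure
    { K₁ := (pk.g₂ ^ (t₁ : ZMod B.p).val * R * pk.g₃) ^ (α : ZMod B.p).val *
        pk.z ^ (r : ZMod B.p).val
      K₂ := pk.g ^ (r : ZMod B.p).val
      T := fun i => pk.h i.succ ^ (r : ZMod B.p).val * pk.h i.castSucc ^ (-ID * r).val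
      t := t₁ }

/-- The validity relations for a private key of the identity `ID`. -/
def Key.Valid (pk : PublicKey B N) (ID : ZMod B.p) (K : Key B N) : Prop :=
  B.e K.K₁ pk.g = B.e pk.g₁ pk.g₂ ^ K.t.val * B.e pk.g₁ pk.g₃ * B.e pk.z K.K₂ ∧
    ∀ i : Fin N, B.e pk.g (K.T i) = B.e K.K₂ (pk.h i.succ * pk.h i.castSucc ^ (-ID).val)

/-- The polynomial whose roots are the identities in `S`. -/
def idPoly (S : Finset (ZMod B.p)) : Polynomial (ZMod B.p) :=
  ∏ ID ∈ S, (Polynomial.X - Polynomial.C ID)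

/-- The element `z · h₀ ^ ρ₀ ⋯ h_n ^ ρ_n`, where the `ρ_k` are the coefficients of the polynomial
of the receiver set. -/
def receiverElt (pk : PublicKey B N) (S : Finset (ZMod B.p)) : B.G :=
  pk.z * ∏ k : Fin (N + 1), pk.h k ^ ((idPoly S).coeff k).val

/-- Encryption of `m` for the receiver set `S` (of at most `N` identities). -/
def encrypt (pk : PublicKey B N) (S : Finset (ZMod B.p)) (m : B.GT) : PMF (Ciphertext B) := do
  let s ← unif (ZMod B.p)ˣ
  pure
    { C₀ := m * B.e pk.g₁ pk.g₃ ^ (s : ZMod B.p).val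
      C₁ := pk.g ^ (s : ZMod B.p).val
      C₂ := receiverElt pk S ^ (s : ZMod B.p).val
      C₃ := B.e pk.g₁ pk.g₂ ^ (s : ZMod B.p).val }

/-- The element `D_ID` of the decryption key for the receiver set `S`. -/
def Key.delegate (K : Key B N) (ID : ZMod B.p) (S : Finset (ZMod B.p)) : B.G :=
  K.K₁ * ∏ j : Fin N, K.T j ^ ((idPoly (S.erase ID)).coeff j).val

/-- Decryption of a ciphertext for `S` with a private key of the identity `ID ∈ S`. -/
def decrypt (K : Key B N) (ID : ZMod B.p) (S : Finset (ZMod B.p)) (C : Ciphertext B) : B.GT :=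
  C.C₀ * (B.e C.C₁ (K.delegate ID S))⁻¹ * B.e C.C₂ K.K₂ * C.C₃ ^ K.t.val

/-! ### Tracing -/

/-- A stateless decryption device: it maps ciphertexts to the (random) answers it gives. -/
abbrev Device (B : BilinearGroup) : Type := Ciphertext B → PMF Data

/-- Does the device correctly open an honest encryption of a random message for `S`? -/
def openExp (pk : PublicKey B N) (S : Finset (ZMod B.p)) (D : Device B) : PMF Bool := do
  let m ← unif B.GT
  let C ← encrypt pk S m
  let out ← D C
  pure (out.toNat == B.encGT m)

/-- A device is `ε`-useful if it opens honest ciphertexts with probability at least `ε`. -/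
def Useful (pk : PublicKey B N) (S : Finset (ZMod B.p)) (D : Device B) (ε : ℝ) : Prop :=
  ε ≤ Pr (openExp pk S D)

/-- One iteration of the tracing algorithm: `C₁` and `C₂` are computed as in encryption, `C₃` is
random, and `C₀` is such that decryption with the user's key gives the random message `m`. The
iteration succeeds if the device returns `m`. -/
def probe (pk : PublicKey B N) (K : Key B N) (ID : ZMod B.p) (S : Finset (ZMod B.p))
    (D : Device B) : PMF Bool := do
  let s ← unif (ZMod B.p)ˣ
  let C₃ ← unif B.GT
  let m ← unif B.GT
  let C₁ := pk.g ^ (s : ZMod B.p).val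
  let C₂ := receiverElt pk S ^ (s : ZMod B.p).val
  let C₀ := m * (decrypt K ID S ⟨1, C₁, C₂, C₃⟩)⁻¹
  let out ← D ⟨C₀, C₁, C₂, C₃⟩
  pure (out.toNat == B.encGT m)

/-- The number of successes in `L` independent repetitions of an experiment. -/
def counter (b : PMF Bool) : ℕ → PMF ℕ
  | 0 => pure 0
  | L + 1 => do
      let ctr ← counter b L
      let x ← b
      pure (if x then ctr + 1 else ctr)

/-- The party that tracing incriminates. -/
inductive Verdict where
  | pkg : Verdict
  | user : Verdict

/-- The tracing algorithm: repeat the iteration `L = 16 κ / ε` times and incriminate the authority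
if and only if no iteration succeeded. -/
def trace (κ : ℕ) (ε : ℝ) (pk : PublicKey B N) (K : Key B N) (ID : ZMod B.p)
    (S : Finset (ZMod B.p)) (D : Device B) : PMF Verdict := do
  let ctr ← counter (probe pk K ID S D) ⌈16 * (κ : ℝ) / ε⌉₊
  pure (if ctr = 0 then .pkg else .user)

end Scheme

/-! ### The selective-ID ComputeNewKey game -/

/-- A dishonest user, given by its next-message programs: `choose` returns the target identity;
`commit` starts an execution of the key generation protocol by returning an identity, a commitment
and the first message of the proof of knowledge; `respond` answers the challenge; `output` returns
a private key for the target identity; `device` is the decryption device.  The programs are run on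
everything that the user has seen so far, including the user's coins; the device uses fresh coins
for every ciphertext. -/
structure DishonestUser where
  choose : Prog
  commit : Prog
  respond : Prog
  output : Prog
  device : Prog
  coins : Polynomial ℕ
  deviceCoins : Polynomial ℕ
  queries : Polynomial ℕ

/-- Probabilistic polynomial time. -/
def DishonestUser.IsPPT (A : DishonestUser) : Prop :=
  A.choose.PolyTime ∧ A.commit.PolyTime ∧ A.respond.PolyTime ∧ A.output.PolyTime ∧
    A.device.PolyTime

section Game

variable {B : BilinearGroup} {N : ℕ}

/-- What the user has seen: `init` is the input before the master public key, and `answers` lists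
what the authority sent in the key generation protocols so far, the latest first. -/
def view (init : Data) (pk : PublicKey B N) (answers : List Data) : Data :=
  .pair init (.pair pk.toData (.ofList answers))

open Classical in
/-- One execution of the key generation protocol.  The user sends an identity `ID`, a commitment
`R` and the first message `W` of Okamoto's proof of knowledge of `(t₀, θ)` with
`R = g₂ ^ t₀ * g ^ θ`.  The authority sends a random challenge `c`, obtains the response `(u, v)`
and checks `g₂ ^ u * g ^ v = W * R ^ c`.  If the proof is invalid, a message is not a group
element, or `ID` was already given a key, the authority returns `⊥` (the number `0`); otherwise it
returns a blinded key.  The state consists of the authority's answers so far and of the identities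
that were given keys. -/
def session (A : DishonestUser) (init : Data) (pk : PublicKey B N) (α : (ZMod B.p)ˣ)
    (st : List Data × List (ZMod B.p)) : PMF (List Data × List (ZMod B.p)) := do
  let first := A.commit.run (view init pk st.1)
  let ID := B.readZ first.fst
  let c ← unif (ZMod B.p)
  let response := A.respond.run (.pair (view init pk st.1) (B.dZ c))
  let u := B.readZ response.fst
  let v := B.readZ response.snd
  match B.readG first.snd.fst, B.readG first.snd.snd with
  | some R, some W =>
      if ID ∉ st.2 ∧ pk.g₂ ^ u.val * pk.g ^ v.val = W * R ^ c.val then do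
        let K ← issueKey pk α ID R
        pure (.pair (B.dZ c) K.toData :: st.1, ID :: st.2)
      else pure (.pair (B.dZ c) (.num 0) :: st.1, st.2)
  | _, _ => pure (.pair (B.dZ c) (.num 0) :: st.1, st.2)

/-- A number of executions of the key generation protocol, one after the other. -/
def sessions (A : DishonestUser) (init : Data) (pk : PublicKey B N) (α : (ZMod B.p)ˣ) :
    ℕ → PMF (List Data × List (ZMod B.p))
  | 0 => pure ([], [])
  | q + 1 => (sessions A init pk α q).bind (session A init pk α)

/-- The device of a user who has seen `v`; it is fed with a ciphertext for the one-element receiver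
set `{ID}`, and with this receiver set. -/
def DishonestUser.toDevice (A : DishonestUser) (κ : ℕ) (v : Data) (ID : ZMod B.p) : Device B :=
  fun C => (AIBBE.coins (A.deviceCoins.eval κ)).map fun ω =>
    A.device.run (.pair v (.pair C.toData (.pair (.ofList [B.dZ ID]) ω)))

open Classical in
/-- The black-box selective-ID ComputeNewKey game in given groups.  The user announces the target
identity before seeing the master public key, executes key generation protocols, and outputs a
private key for the target identity together with a device.  The result is `true` if the key is
valid, the device is `ε`-useful for ciphertexts encrypted for the target identity, and tracing
incriminates the authority. -/
def newKeyGame (B : BilinearGroup) (κ N : ℕ) (ε : ℝ) (A : DishonestUser) : PMF Bool := do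
  let ρ ← coins (A.coins.eval κ)
  let init := Data.pair (B.params κ) (.pair (.num N) ρ)
  let ID := B.readZ (A.choose.run init)
  let (pk, α) ← setup B N
  let st ← sessions A init pk α (A.queries.eval κ)
  let v := view init pk st.1
  let D : Device B := A.toDevice κ v ID
  match Key.read B N (A.output.run v) with
  | none => pure false
  | some K =>
      if K.Valid pk ID ∧ Useful pk {ID} D ε then do
        match ← trace κ ε pk K ID {ID} D with
        | .pkg => pure true
        | .user => pure false
      else pure false

end Game

/-- The advantage of a dishonest user in the ComputeNewKey game. -/
def newKeyAdv (𝒢 : GroupGenerator) (N : ℕ → ℕ) (ε : ℕ → ℝ) (A : DishonestUser) (κ : ℕ) : ℝ :=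
  Pr ((𝒢.gen κ).bind fun i => newKeyGame (𝒢.grp i) κ (N κ) (ε κ) A)

end

end AIBBE

namespace AIBBE

open Polynomial

/-! ### A calculus of polynomial-time functions -/

/-! A DBDHE challenge is planted in the whole game. Write elements of `G` by their exponents to the
base `g`. The reduction uses g₁ = α, g₂ = α^(N+1) + γ, g₃ = θ − t*·g₂, hᵢ = bᵢ + α^(N+1−i) and z = δ
+ ID*·h₀ − h₁, with γ, θ, t*, δ, bᵢ of its own choice; since the game is selective, ID* is known
before z has to be fixed. The masks make the public key distributed as in setup and independent of
t* (`endAvg_eq`). The one power of α that is missing from the challenge is α^(N+2).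

Keys. A blinded key for ID and R = g₂^t₀ g^θ' contains α^(N+2) with coefficient dt = t₀ + t₁ − t*.
For ID = ID* it disappears with t₁ = t* − t₀, which is uniform as long as t* is hidden. For any
other ID the randomness r is shifted by a multiple of Q(ID) = ∑ α^(j+1) ID^j, j ≤ N; a telescoping
identity (`Ctx.Q_telescope`) makes z^r cancel the forbidden power without creating it elsewhere
(`Ctx.kk1_x`, `Ctx.kkT_x`). Translating a uniform r is invisible. The key depends on R only, so any
extracted representation (t₀, θ') serves.

Extraction. The user's messages are a function of its view, so rewinding is evaluation at the
challenges c+1, …, c+K, and two correct responses yield a representation (`extract`). The correct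
challenges that are followed by K incorrect ones make up at most the fraction 1/(K+1) of all
challenges (`avg_gap_le`). Together with the preceding paragraph this gives `realVal_le_avg_simVal`.

Tests. The receiver element of {ID*} is g^δ. Hence h, h^δ and T·e(g₁,h)^γ are the components C₁, C₂,
C₃ of an honest ciphertext if T is real, and of a tracing ciphertext if T is uniform. The component
C₀ is always computed from the user's own key; for a valid key and an honest C₃ it is the honest one
(`decrypt_valid`). For a fixed final view let r and x be the probabilities that the device opens
honest and tracing ciphertexts. A useful device has r ≥ ε, and the authority is accused with
probability (1 − x)^L. This is at most e^(−8κ) if x > ε/2, and otherwise (r − x)² ≥ ε²/4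
(`one_sub_pow_le`). The reduction can neither decide whether the device is useful nor see the sign
of r − x. It therefore makes an honest test, a tracing test and a test on the challenge, and answers
1 if the first two disagree and the third agrees with the first. If the third succeeds with
probability c, this has probability r(1−x)c + (1−r)x(1−c), and the values at c = r and c = x differ
by exactly (r − x)² (`avg_verd`, `outAvg_sub`). So the advantage is, up to the error of sampling, an
average of squares.

Losses. All of them are exponentially small except failed extraction, which costs an inverse
polynomial. A separate reduction is therefore used for every power of κ in the definition of
negligibility, with K chosen accordingly.

Much of the length goes into writing the reduction as a program that is polynomial-time on all
inputs (`Sim.polyNat_out`) and into identifying its answer on challenges (`Ctx.out_x`). -/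

theorem eval_le_eval (q : ℕ[X]) {a b : ℕ} (h : a ≤ b) : q.eval a ≤ q.eval b := by
  rw [eval_eq_sum_range, eval_eq_sum_range]
  gcongr

theorem Data.fst_size (x : Data) : x.fst.size ≤ x.size := by
  cases x <;> simp [Data.fst, Data.size]; omega

theorem Data.snd_size (x : Data) : x.snd.size ≤ x.size := by
  cases x <;> simp [Data.snd, Data.size]; omega

theorem Data.toNat_size (x : Data) : x.toNat.size + 1 ≤ x.size := by
  cases x <;> simp [Data.toNat, Data.size]

@[simp] theorem Data.fst_pair (a b : Data) : (Data.pair a b).fst = a := rfl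
@[simp] theorem Data.snd_pair (a b : Data) : (Data.pair a b).snd = b := rfl
@[simp] theorem Data.toNat_num (n : ℕ) : (Data.num n).toNat = n := rfl

theorem natSize_add (a b : ℕ) : (a + b).size ≤ a.size + b.size := by
  rcases Nat.eq_zero_or_pos a with rfl | ha
  · simp
  rcases Nat.eq_zero_or_pos b with rfl | hb
  · simp
  rw [Nat.size_le]
  have h1 := Nat.lt_size_self a
  have h2 := Nat.lt_size_self b
  have h3 : 1 ≤ a.size := Nat.size_pos.2 ha
  have h4 : 1 ≤ b.size := Nat.size_pos.2 hb
  rw [pow_add]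
  have h5 : 2 ≤ 2 ^ a.size := by simpa using Nat.pow_le_pow_right (n := 2) (by norm_num) h3
  have h6 : 2 ≤ 2 ^ b.size := by simpa using Nat.pow_le_pow_right (n := 2) (by norm_num) h4
  nlinarith

theorem natSize_mul (a b : ℕ) : (a * b).size ≤ a.size + b.size := by
  rw [Nat.size_le, pow_add]
  exact Nat.mul_lt_mul'' (Nat.lt_size_self a) (Nat.lt_size_self b)

theorem natSize_le_self (a : ℕ) : a.size ≤ a := by
  rw [Nat.size_le]
  exact Nat.lt_two_pow_self

/-- Functions of a datum bounded by a polynomial in its size. -/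
def PolyBd (f : Data → ℕ) : Prop := ∃ q : ℕ[X], ∀ x, f x ≤ q.eval x.size

namespace PolyBd

variable {f g : Data → ℕ}

theorem const (n : ℕ) : PolyBd fun _ => n := ⟨C n, fun x => by simp⟩

theorem size : PolyBd Data.size := ⟨X, fun x => by simp⟩

theorem mono (hg : PolyBd g) (h : ∀ x, f x ≤ g x) : PolyBd f :=
  let ⟨q, hq⟩ := hg
  ⟨q, fun x => (h x).trans (hq x)⟩

theorem add (hf : PolyBd f) (hg : PolyBd g) : PolyBd fun x => f x + g x :=
  let ⟨q, hq⟩ := hf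
  let ⟨r, hr⟩ := hg
  ⟨q + r, fun x => by simpa using Nat.add_le_add (hq x) (hr x)⟩

theorem mul (hf : PolyBd f) (hg : PolyBd g) : PolyBd fun x => f x * g x :=
  let ⟨q, hq⟩ := hf
  let ⟨r, hr⟩ := hg
  ⟨q * r, fun x => by simpa using Nat.mul_le_mul (hq x) (hr x)⟩

theorem comp (hg : PolyBd g) {u : Data → Data} (hu : PolyBd fun x => (u x).size) :
    PolyBd fun x => g (u x) :=
  let ⟨q, hq⟩ := hg
  let ⟨r, hr⟩ := hu
  ⟨q.comp r, fun x => by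
    rw [eval_comp]
    exact (hq _).trans (eval_le_eval q (hr x))⟩

theorem eval (q : ℕ[X]) (hf : PolyBd f) : PolyBd fun x => q.eval (f x) :=
  let ⟨r, hr⟩ := hf
  ⟨q.comp r, fun x => by
    rw [eval_comp]
    exact eval_le_eval q (hr x)⟩

end PolyBd

/-- Functions computed by a program in polynomial time. -/
@[fun_prop] def PolyFun (f : Data → Data) : Prop := ∃ P : Prog, P.PolyTime ∧ ∀ x, P.run x = f x

/-- Functions with values in the natural numbers computed by a program in polynomial time. -/
@[fun_prop] def PolyNat (f : Data → ℕ) : Prop := PolyFun fun x => .num (f x)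

/-- Every instruction is charged for what it writes, and a loop is charged the size of its input
before the first pass, so that even a loop with no pass obeys the bound. This is what closes
polynomial-time functions under composition. -/
theorem Prog.size_run_le (P : Prog) (x : Data) : (P.run x).size ≤ P.time x := by
  induction P generalizing x with
  | prim o => simp [Prog.run, Prog.time, Prog.exec]
  | pair f g hf hg =>
    have h1 := hf x
    have h2 := hg x
    simp only [Prog.run, Prog.time, Prog.exec, Data.size] at *
    omega
  | comp g f hg hf =>
    have h1 := hg (f.exec x).1
    simp only [Prog.run, Prog.time, Prog.exec] at *
    omega
  | ite c f g hc hf hg =>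
    have h1 := hf x
    have h2 := hg x
    simp only [Prog.run, Prog.time, Prog.exec] at *
    split <;> simp only <;> omega
  | loop n f hn hf =>
    simp only [Prog.run, Prog.time, Prog.exec] at *
    generalize (n.exec x).1.toNat = k
    induction k with
    | zero => simp
    | succ k ih =>
      rw [Function.iterate_succ_apply']
      have := hf ((fun s : Data × ℕ => ((f.exec s.1).1, s.2 + (f.exec s.1).2 + 1))^[k]
        (x, (n.exec x).2 + x.size)).1
      simp only
      omega

/-- Separates result and cost of a loop: the time is a sum over the visited states, so a uniform
bound on their sizes bounds it. -/
theorem Prog.exec_iterate (f : Prog) (x : Data) (t k : ℕ) :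
    (fun s : Data × ℕ => ((f.exec s.1).1, s.2 + (f.exec s.1).2 + 1))^[k] (x, t) =
      (f.run^[k] x, t + ∑ i ∈ Finset.range k, (f.time (f.run^[i] x) + 1)) := by
  induction k with
  | zero => simp
  | succ k ih =>
    rw [Function.iterate_succ_apply', ih, Function.iterate_succ_apply', Finset.sum_range_succ]
    simp only [Prog.run, Prog.time, Prod.mk.injEq, true_and]
    omega

theorem Prog.PolyTime.polyFun {P : Prog} (h : P.PolyTime) : PolyFun P.run := ⟨P, h, fun _ => rfl⟩

namespace PolyFun

variable {f g : Data → Data}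

theorem size_bd (hf : PolyFun f) : PolyBd fun x => (f x).size := by
  obtain ⟨P, ⟨q, hq⟩, hP⟩ := hf
  exact ⟨q, fun x => by
    have := (P.size_run_le x).trans (hq x)
    rwa [hP] at this⟩

/-- An instruction costs the size of its input plus that of its output, so only the output needs a
bound. -/
theorem of_prim (o : Prim) (h : PolyBd fun x => (o.run x).size) : PolyFun o.run := by
  refine ⟨.prim o, ?_, fun x => rfl⟩
  exact PolyBd.size.add h

@[fun_prop] theorem id : PolyFun fun x => x := of_prim .id PolyBd.size

-- The second program is polynomial in the size of the intermediate result, which is at most the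
-- running time of the first.
@[fun_prop] theorem comp (hg : PolyFun g) (hf : PolyFun f) : PolyFun fun x => g (f x) := by
  have hb := hf.size_bd
  obtain ⟨P, hP, hPf⟩ := hf
  obtain ⟨Q, hQ, hQg⟩ := hg
  refine ⟨.comp Q P, ?_, fun x => by simp only [← hPf, ← hQg]; rfl⟩
  refine PolyBd.mono (PolyBd.add hP (PolyBd.comp hQ hb)) fun x => ?_
  rw [← hPf]
  exact le_rfl

@[fun_prop] theorem run {P : Prog} (hP : P.PolyTime) (hf : PolyFun f) :
    PolyFun fun x => P.run (f x) := hP.polyFun.comp hf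

@[fun_prop] theorem pair (hf : PolyFun f) (hg : PolyFun g) : PolyFun fun x => .pair (f x) (g x) := by
  obtain ⟨P, hP, hPf⟩ := hf
  obtain ⟨Q, hQ, hQg⟩ := hg
  exact ⟨.pair P Q, PolyBd.add (PolyBd.add hP hQ) (PolyBd.const 1),
    fun x => by simp only [← hPf, ← hQg]; rfl⟩

@[fun_prop] theorem fst (hf : PolyFun f) : PolyFun fun x => (f x).fst :=
  (of_prim .fst (PolyBd.size.mono Data.fst_size)).comp hf

@[fun_prop] theorem snd (hf : PolyFun f) : PolyFun fun x => (f x).snd :=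
  (of_prim .snd (PolyBd.size.mono Data.snd_size)).comp hf

@[fun_prop] theorem num {n : Data → ℕ} (hn : PolyNat n) : PolyFun fun x => .num (n x) := hn

@[fun_prop] theorem const (d : Data) : PolyFun fun _ => d := by
  induction d with
  | num n => exact of_prim (.const n) (PolyBd.const (Data.num n).size)
  | pair a b ha hb => exact ha.pair hb

theorem ite_zero {n : Data → ℕ} (hn : PolyNat n) (hf : PolyFun f) (hg : PolyFun g) :
    PolyFun fun x => if n x = 0 then g x else f x := by
  obtain ⟨R, hR, hRn⟩ := hn
  obtain ⟨P, hP, hPf⟩ := hf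
  obtain ⟨Q, hQ, hQg⟩ := hg
  refine ⟨.ite R P Q, ?_, fun x => ?_⟩
  · refine PolyBd.mono (PolyBd.add (PolyBd.add hR (PolyBd.add hP hQ)) (PolyBd.const 1))
      fun x => ?_
    simp only [Prog.time, Prog.exec]
    split <;> simp only <;> omega
  · have h := hRn x
    simp only [Prog.run] at h hPf hQg
    simp only [Prog.run, Prog.exec, h]
    rcases n x with _ | k
    · simp [hQg]
    · simp [hPf]

end PolyFun

namespace PolyNat

variable {f g : Data → ℕ}

@[fun_prop] theorem comp (hg : PolyNat g) {u : Data → Data} (hu : PolyFun u) : PolyNat fun x => g (u x) :=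
  PolyFun.comp hg hu

@[fun_prop] theorem const (n : ℕ) : PolyNat fun _ => n := PolyFun.const (.num n)

theorem size_bd (hf : PolyNat f) : PolyBd fun x => (f x).size :=
  PolyBd.mono (PolyFun.size_bd hf) fun x => by simp [Data.size]

@[fun_prop] theorem add (hf : PolyNat f) (hg : PolyNat g) : PolyNat fun x => f x + g x := by
  refine (PolyFun.of_prim .add ?_).comp (PolyFun.pair hf hg)
  refine PolyBd.mono (PolyBd.add PolyBd.size PolyBd.size) fun x => ?_
  have h1 := x.fst.toNat_size
  have h2 := x.snd.toNat_size
  have h3 := x.fst_size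
  have h4 := x.snd_size
  have h5 := natSize_add x.fst.toNat x.snd.toNat
  simp only [Prim.run, Data.size]
  omega

@[fun_prop] theorem sub (hf : PolyNat f) (hg : PolyNat g) : PolyNat fun x => f x - g x := by
  refine (PolyFun.of_prim .sub ?_).comp (PolyFun.pair hf hg)
  refine PolyBd.mono PolyBd.size fun x => ?_
  have h1 := x.fst.toNat_size
  have h3 := x.fst_size
  have h5 := Nat.size_le_size (Nat.sub_le x.fst.toNat x.snd.toNat)
  simp only [Prim.run, Data.size]
  omega

@[fun_prop] theorem mul (hf : PolyNat f) (hg : PolyNat g) : PolyNat fun x => f x * g x := by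
  refine (PolyFun.of_prim .mul ?_).comp (PolyFun.pair hf hg)
  refine PolyBd.mono (PolyBd.add PolyBd.size PolyBd.size) fun x => ?_
  have h1 := x.fst.toNat_size
  have h2 := x.snd.toNat_size
  have h3 := x.fst_size
  have h4 := x.snd_size
  have h5 := natSize_mul x.fst.toNat x.snd.toNat
  simp only [Prim.run, Data.size]
  omega

@[fun_prop] theorem div (hf : PolyNat f) (hg : PolyNat g) : PolyNat fun x => f x / g x := by
  refine (PolyFun.of_prim .div ?_).comp (PolyFun.pair hf hg)
  refine PolyBd.mono PolyBd.size fun x => ?_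
  have h1 := x.fst.toNat_size
  have h3 := x.fst_size
  have h5 := Nat.size_le_size (Nat.div_le_self x.fst.toNat x.snd.toNat)
  simp only [Prim.run, Data.size]
  omega

@[fun_prop] theorem mod (hf : PolyNat f) (hg : PolyNat g) : PolyNat fun x => f x % g x := by
  refine (PolyFun.of_prim .mod ?_).comp (PolyFun.pair hf hg)
  refine PolyBd.mono PolyBd.size fun x => ?_
  have h1 := x.fst.toNat_size
  have h3 := x.fst_size
  have h5 := Nat.size_le_size (Nat.mod_le x.fst.toNat x.snd.toNat)
  simp only [Prim.run, Data.size]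
  omega

@[fun_prop] theorem toNat {u : Data → Data} (hu : PolyFun u) : PolyNat fun x => (u x).toNat := by
  -- No single instruction extracts the number at a leaf with default `0`; adding `0` has this
  -- effect.
  have h : PolyNat fun x => (Data.pair x (.num 0)).fst.toNat + (Data.pair x (.num 0)).snd.toNat :=
    (PolyFun.of_prim .add (by
      refine PolyBd.mono (PolyBd.add PolyBd.size PolyBd.size) fun x => ?_
      have h1 := x.fst.toNat_size
      have h2 := x.snd.toNat_size
      have h3 := x.fst_size
      have h4 := x.snd_size
      have h5 := natSize_add x.fst.toNat x.snd.toNat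
      simp only [Prim.run, Data.size]
      omega)).comp (PolyFun.pair PolyFun.id (PolyFun.const (.num 0)))
  simpa using h.comp hu

@[fun_prop] theorem natSize (hf : PolyNat f) : PolyNat fun x => (f x).size := by
  refine (PolyFun.of_prim .size ?_).comp hf
  refine PolyBd.mono (PolyBd.add PolyBd.size PolyBd.size) fun x => ?_
  have h1 := x.toNat_size
  have h2 := natSize_le_self x.toNat.size
  simp only [Prim.run, Data.size]
  omega

@[fun_prop] theorem eval (q : ℕ[X]) (hf : PolyNat f) : PolyNat fun x => q.eval (f x) := by
  induction q using Polynomial.induction_on' with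
  | add a b ha hb => simpa using ha.add hb
  | monomial n a =>
    simp only [eval_monomial]
    refine (const a).mul ?_
    induction n with
    | zero => simpa using const 1
    | succ n ih => simpa [pow_succ] using ih.mul hf

end PolyNat

/-- A choice according to an equality of numbers. -/
def sel {α : Type} (a b : ℕ) (x y : α) : α := if a = b then x else y

theorem sel_pos {α : Type} {a b : ℕ} {x y : α} (h : a = b) : sel a b x y = x := if_pos h

theorem sel_neg {α : Type} {a b : ℕ} {x y : α} (h : a ≠ b) : sel a b x y = y := if_neg h

@[fun_prop] theorem PolyFun.sel {a b : Data → ℕ} {f g : Data → Data} (ha : PolyNat a)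
    (hb : PolyNat b) (hf : PolyFun f) (hg : PolyFun g) :
    PolyFun fun x => sel (a x) (b x) (f x) (g x) := by
  -- With truncated subtraction this sum vanishes exactly when the two numbers agree.
  have h : PolyNat fun x => (a x - b x) + (b x - a x) := by fun_prop
  convert PolyFun.ite_zero h hg hf using 2 with x
  unfold AIBBE.sel
  simp only [show (a x - b x) + (b x - a x) = 0 ↔ a x = b x by omega]

@[fun_prop] theorem PolyNat.sel {a b f g : Data → ℕ} (ha : PolyNat a) (hb : PolyNat b)
    (hf : PolyNat f) (hg : PolyNat g) : PolyNat fun x => sel (a x) (b x) (f x) (g x) := by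
  have h := PolyFun.sel ha hb hf hg
  unfold PolyNat
  convert h using 2 with x
  unfold AIBBE.sel
  by_cases h : a x = b x <;> simp [h]

@[fun_prop] theorem PolyNat.min {f g : Data → ℕ} (hf : PolyNat f) (hg : PolyNat g) :
    PolyNat fun x => min (f x) (g x) := by
  have h : PolyNat fun x => f x - (f x - g x) := by fun_prop
  convert h using 2 with x
  omega

/-! ### Bounded loops, sums, powers and tables -/

/-- Iteration with a counter. -/
def iter {α : Type} (step : ℕ → α → α) (a : α) : ℕ → α
  | 0 => a
  | k + 1 => step k (iter step a k)

/-- Iterating a polynomial-time step need not take polynomial time, since sizes may multiply at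
every pass. The hypotheses therefore bound both the number of passes and the size of every
intermediate value in terms of the original input; the cost is the number of passes times the cost
on a state of bounded size. -/
theorem PolyFun.iter {init : Data → Data} {step : Data → ℕ → Data → Data} {n : Data → ℕ}
    (hs : PolyFun fun e => step e.fst e.snd.fst.toNat e.snd.snd)
    (hi : PolyFun init) (hn : PolyNat n) (hnb : PolyBd n)
    (hb : ∃ q : ℕ[X], ∀ x i, i ≤ n x → (iter (step x) (init x) i).size ≤ q.eval x.size) :
    PolyFun fun x => iter (step x) (init x) (n x) := by
  -- The body of a loop sees nothing but its state, so the state carries the original input and the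
  -- counter along.
  let F : Data → Data := fun e => .pair e.fst (.pair (.num (e.snd.fst.toNat + 1))
    (step e.fst e.snd.fst.toNat e.snd.snd))
  let S : Data → Data := fun x => .pair x (.pair (.num 0) (init x))
  have hF : PolyFun F := by
    refine .pair (by fun_prop) (.pair (by fun_prop) hs)
  have hS : PolyFun S := by fun_prop
  have hFS (x : Data) (i : ℕ) :
      F^[i] (S x) = .pair x (.pair (.num i) (AIBBE.iter (step x) (init x) i)) := by
    induction i with
    | zero => rfl
    | succ i ih => rw [Function.iterate_succ_apply', ih]; rfl
  obtain ⟨q, hq⟩ := hb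
  have hnb' := hnb
  obtain ⟨r, hr⟩ := hnb
  -- the loop runs on states of the form `pair x (init x)`
  obtain ⟨P, hP, hPF⟩ := hF
  obtain ⟨R, hR, hRn⟩ := hn.comp (PolyFun.fst .id)
  obtain ⟨Q, hQ, hQS⟩ := hS
  have hPF' : P.run = F := funext hPF
  have hRn' (x : Data) : (R.exec x).1.toNat = n x.fst := by
    have := hRn x
    simp only [Prog.run] at this
    rw [this]
    rfl
  have hloop (x : Data) : (Prog.loop R P).run (S x) =
      .pair x (.pair (.num (n x)) (AIBBE.iter (step x) (init x) (n x))) := by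
    simp only [Prog.run, Prog.exec]
    rw [Prog.exec_iterate, hRn', hPF']
    exact hFS x _
  have hSb : PolyBd fun x => (S x).size := PolyFun.size_bd ⟨Q, hQ, hQS⟩
  refine ⟨.comp (.comp (.prim .snd) (.prim .snd)) (.comp (.loop R P) Q), ?_, fun x => ?_⟩
  · obtain ⟨qP, hP⟩ := hP
    let M : Data → ℕ := fun x => x.size + (n x + 1 + q.eval x.size + 1) + 1
    have hM : PolyBd M := by
      refine .add (.add .size (.add (.add (.add hnb' (.const 1)) (.eval q .size)) (.const 1)))
        (.const 1)
    have hst (x : Data) (i : ℕ) (hi : i ≤ n x) : (F^[i] (S x)).size ≤ M x := by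
      have h1 := hq x i hi
      have h2 := natSize_le_self i
      simp only [hFS, Data.size, M]
      omega
    have hT : PolyBd fun x => (Prog.loop R P).time (S x) := by
      have h1 : PolyBd fun x => n x * (qP.eval (M x) + 1) :=
        hnb'.mul (PolyBd.add (PolyBd.eval _ hM) (PolyBd.const 1))
      refine PolyBd.mono (PolyBd.add (PolyBd.add (PolyBd.comp hR hSb) hSb) h1) fun x => ?_
      simp only [Prog.time, Prog.exec]
      rw [Prog.exec_iterate, hRn', hPF']
      simp only
      refine Nat.add_le_add_left ?_ _
      · refine (Finset.sum_le_card_nsmul _ _ (qP.eval (M x) + 1) fun i hi => ?_).trans ?_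
        · gcongr
          exact (hP _).trans (eval_le_eval _ (hst x i (Finset.mem_range.1 hi).le))
        · simp [S]
    have hU : PolyBd fun x => 4 * M x := (PolyBd.const 4).mul hM
    refine PolyBd.mono (PolyBd.add (PolyBd.add hQ hT) hU) fun x => ?_
    have e1 : (Q.exec x).1 = S x := hQS x
    have e2 : ((Prog.loop R P).exec (S x)).1 = F^[n x] (S x) := by
      rw [hFS]
      exact hloop x
    have h3 := hst x _ le_rfl
    have h4 := (F^[n x] (S x)).snd_size
    have h5 := (F^[n x] (S x)).snd.snd_size
    have e4 : ∀ y, ((Prog.prim .snd).exec y) = (y.snd, y.size + y.snd.size) := fun y => rfl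
    have e3 : ∀ g f y, (Prog.comp g f).exec y =
      ((g.exec (f.exec y).1).1, (f.exec y).2 + (g.exec (f.exec y).1).2) := fun _ _ _ => rfl
    simp only [Prog.time, e3, e1, e2, e4]
    omega
  · have e3 : ∀ g f y, (Prog.comp g f).run y = g.run (f.run y) := fun _ _ _ => rfl
    simp only [e3, hQS, hloop]
    rfl

/-- Iteration on numbers that stay below a computable bound. -/
theorem PolyNat.iter {init M : Data → ℕ} {step : Data → ℕ → ℕ → ℕ} {n : Data → ℕ}
    (hs : PolyNat fun e => step e.fst e.snd.fst.toNat e.snd.snd.toNat)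
    (hi : PolyNat init) (hn : PolyNat n) (hnb : PolyBd n) (hM : PolyBd fun x => (M x).size)
    (hb : ∀ x i, i ≤ n x → iter (step x) (init x) i ≤ M x) :
    PolyNat fun x => iter (step x) (init x) (n x) := by
  have key (x : Data) (i : ℕ) : AIBBE.iter (fun i a => Data.num (step x i a.toNat))
      (Data.num (init x)) i = .num (AIBBE.iter (step x) (init x) i) := by
    induction i with
    | zero => rfl
    | succ i ih => simp only [AIBBE.iter, ih]; rfl
  obtain ⟨q, hq⟩ := hM
  unfold PolyNat
  have := PolyFun.iter (step := fun x i a => Data.num (step x i a.toNat)) hs hi hn hnb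
    ⟨q + 1, fun x i h => by
      rw [key]
      simp only [Data.size, eval_add, eval_one]
      exact Nat.add_le_add_right ((Nat.size_le_size (hb x i h)).trans (hq x)) 1⟩
  simpa only [key] using this

theorem iter_sum (f : ℕ → ℕ) (n : ℕ) : iter (fun i a => a + f i) 0 n = ∑ i ∈ Finset.range n, f i := by
  induction n with
  | zero => rfl
  | succ n ih => rw [iter, ih, Finset.sum_range_succ]

theorem PolyNat.sum {f : Data → ℕ → ℕ} {n : Data → ℕ}
    (hf : PolyNat fun e => f e.fst e.snd.toNat) (hn : PolyNat n) (hnb : PolyBd n) :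
    PolyNat fun x => ∑ i ∈ Finset.range (n x), f x i := by
  obtain ⟨q, hq⟩ := hf.size_bd
  have hb (x : Data) (i : ℕ) : (f x i).size ≤ q.eval (x.size + (i + 1) + 1) := by
    have := hq (.pair x (.num i))
    refine this.trans (eval_le_eval _ ?_)
    have := natSize_le_self i
    simp only [Data.size]
    omega
  have hsz (x : Data) (i : ℕ) :
      (∑ j ∈ Finset.range i, f x j).size ≤ i * q.eval (x.size + (i + 1) + 1) := by
    have h1 (k : ℕ) : (∑ j ∈ Finset.range k, f x j).size ≤ ∑ j ∈ Finset.range k, (f x j).size := by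
      induction k with
      | zero => simp
      | succ k ih =>
        rw [Finset.sum_range_succ, Finset.sum_range_succ]
        exact (natSize_add _ _).trans (by omega)
    refine (h1 i).trans ((Finset.sum_le_card_nsmul _ _ _ fun j hj => (hb x j).trans
      (eval_le_eval q ?_)).trans (by simp; rfl))
    have := Finset.mem_range.1 hj
    omega
  obtain ⟨r, hr⟩ := hnb.mul (PolyBd.eval q (((PolyBd.size).add (hnb.add (.const 1))).add (.const 1)))
  have := PolyNat.iter (init := fun _ => 0) (M := fun x => ∑ j ∈ Finset.range (n x), f x j)
    (step := fun x i a => a + f x i) (n := n)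
    (by
      refine .add (by fun_prop) ?_
      exact hf.comp (u := fun e => .pair e.fst e.snd.fst) (by fun_prop))
    (by fun_prop) hn hnb ⟨r, fun x => (hsz x _).trans (hr x)⟩
    (fun x i hi => by
      rw [iter_sum]
      exact Finset.sum_le_sum_of_subset (by simpa using hi))
  simpa only [iter_sum] using this

theorem iter_mul (c k : ℕ) : iter (fun _ a => a * c) 1 k = c ^ k := by
  induction k with
  | zero => rfl
  | succ n ih => rw [iter, ih, pow_succ]

theorem natSize_pow (c k : ℕ) : (c ^ k).size ≤ k * c.size + 1 := by
  induction k with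
  | zero => simp
  | succ n ih =>
    rw [pow_succ, Nat.succ_mul]
    exact (natSize_mul _ _).trans (by omega)

/-- The exponent has to be polynomially bounded as a number, not only in length, because the length
of the result grows in proportion to it. -/
theorem PolyNat.pow {c n : Data → ℕ} (hc : PolyNat c) (hn : PolyNat n) (hnb : PolyBd n) :
    PolyNat fun x => c x ^ n x := by
  -- The base `c x + 1` keeps the bound monotone in the exponent also when `c x = 0`.
  have := PolyNat.iter (init := fun _ => 1) (M := fun x => (c x + 1) ^ n x)
    (step := fun x _ a => a * c x) (n := n)
    (by
      refine .mul (by fun_prop) ?_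
      exact hc.comp (by fun_prop))
    (by fun_prop) hn hnb
    (((hnb.mul (hc.size_bd.add (.const 1))).add (.const 1)).mono fun x =>
      (natSize_pow _ _).trans (by
        gcongr
        exact (natSize_add _ _).trans (by simp)))
    (fun x i hi => by
      rw [iter_mul]
      exact (Nat.pow_le_pow_left (Nat.le_succ _) _).trans (Nat.pow_le_pow_right (by omega) hi))
  simpa only [iter_mul] using this

theorem iter_snd (d : Data) (k : ℕ) : (iter (fun _ a => a.snd) d k).fst = d.nth k := by
  have h (k : ℕ) : iter (fun _ a => a.snd) d k = Data.snd^[k] d := by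
    induction k with
    | zero => rfl
    | succ n ih => rw [iter, ih, Function.iterate_succ_apply']
  rw [h]
  induction k generalizing d with
  | zero => rfl
  | succ n ih =>
    rw [Function.iterate_succ_apply, ih d.snd]
    · rfl
    · intro k
      induction k with
      | zero => rfl
      | succ n ih => rw [iter, ih, Function.iterate_succ_apply']

theorem PolyFun.nth {n : Data → ℕ} {d : Data → Data} (hn : PolyNat n) (hnb : PolyBd n)
    (hd : PolyFun d) : PolyFun fun x => (d x).nth (n x) := by
  obtain ⟨q, hq⟩ := hd.size_bd
  have := PolyFun.iter (init := d) (step := fun _ _ a => a.snd) (by fun_prop) hd hn hnb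
    ⟨q, fun x i _ => by
      refine le_trans ?_ (hq x)
      induction i with
      | zero => exact le_rfl
      | succ i ih => exact (Data.snd_size _).trans (ih (by omega))⟩
  simpa only [iter_snd] using this.fst

/-- The list of the values of a function, as data. -/
def tab (f : ℕ → Data) (n : ℕ) : Data := .ofList ((List.range n).map f)

theorem tab_succ (f : ℕ → Data) (n : ℕ) : tab f (n + 1) = .pair (f 0) (tab (fun i => f (i + 1)) n) := by
  simp [tab, List.range_succ_eq_map, Data.ofList, Function.comp_def]

/-- Entries are added in front, so a table is built from its last entry backwards; after `k` passes
it holds the last `k` values. -/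
theorem iter_cons (f : ℕ → Data) (n k : ℕ) (hk : k ≤ n) :
    iter (fun i a => .pair (f (n - 1 - i)) a) (.num 0) k = tab (fun i => f (n - k + i)) k := by
  induction k with
  | zero => rfl
  | succ k ih =>
    rw [iter, ih (by omega), tab_succ, show n - (k + 1) + 0 = n - 1 - k by omega]
    simp only [show ∀ i, n - (k + 1) + (i + 1) = n - k + i by omega]

theorem tab_size_le (f : ℕ → Data) (n M : ℕ) (h : ∀ i < n, (f i).size ≤ M) :
    (tab f n).size ≤ n * (M + 1) + 1 := by
  induction n generalizing f with
  | zero => simp [tab, Data.ofList, Data.size]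
  | succ n ih =>
    rw [tab_succ]
    have h1 := ih (fun i => f (i + 1)) fun i hi => h _ (by omega)
    have h2 := h 0 (by omega)
    simp only [Data.size]
    rw [Nat.succ_mul]
    omega

theorem PolyFun.tab {f : Data → ℕ → Data} {n : Data → ℕ}
    (hf : PolyFun fun e => f e.fst e.snd.toNat) (hn : PolyNat n) (hnb : PolyBd n) :
    PolyFun fun x => tab (f x) (n x) := by
  obtain ⟨q, hq⟩ := hf.size_bd
  have hb (x : Data) (i : ℕ) : (f x i).size ≤ q.eval (x.size + (i + 1) + 1) := by
    have := hq (.pair x (.num i))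
    refine this.trans (eval_le_eval _ ?_)
    have := natSize_le_self i
    simp only [Data.size]
    omega
  obtain ⟨r, hr⟩ := (hnb.mul ((PolyBd.eval q
    (((PolyBd.size).add (hnb.add (.const 1))).add (.const 1))).add (.const 1))).add (.const 1)
  have := PolyFun.iter (init := fun _ => .num 0)
    (step := fun x i a => .pair (f x (n x - 1 - i)) a) (n := n)
    (by
      refine .pair ?_ (by fun_prop)
      have h1 : PolyNat fun e : Data => n e.fst - 1 - e.snd.fst.toNat := by
        refine .sub (.sub (hn.comp (by fun_prop)) (by fun_prop)) (by fun_prop)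
      exact hf.comp (f := fun e => .pair e.fst (.num (n e.fst - 1 - e.snd.fst.toNat))) (by fun_prop))
    (by fun_prop) hn hnb
    ⟨r, fun x i hi => by
      rw [iter_cons _ _ _ hi]
      refine (tab_size_le _ _ (q.eval (x.size + (n x + 1) + 1)) fun j hj =>
        (hb x _).trans (eval_le_eval q (by omega))).trans (le_trans ?_ (hr x))
      exact Nat.add_le_add_right (Nat.mul_le_mul_right _ hi) _⟩
  have e (x : Data) : AIBBE.iter (fun i a => Data.pair (f x (n x - 1 - i)) a) (.num 0) (n x) =
      AIBBE.tab (f x) (n x) := by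
    rw [iter_cons _ _ _ le_rfl]
    simp
  simpa only [e] using this

/-! ### Square and multiply -/

/-- One step of square and multiply on a state `(accumulator, base, exponent)`. -/
def powStep (op : ℕ → ℕ → ℕ) (s : Data) : Data :=
  .pair (.num (sel (s.snd.snd.toNat % 2) 1 (op s.fst.toNat s.snd.fst.toNat) s.fst.toNat))
    (.pair (.num (op s.snd.fst.toNat s.snd.fst.toNat)) (.num (s.snd.snd.toNat / 2)))

/-- Square and multiply; for a multiplication this is `a ^ (n + 1)`. -/
def powLoop (op : ℕ → ℕ → ℕ) (a n : ℕ) : ℕ :=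
  (iter (fun _ s => powStep op s) (.pair (.num a) (.pair (.num a) (.num n))) n.size).fst.toNat

/-- A bound on all values of `op`, also at arguments that encode nothing, keeps accumulator and base
short; the number of passes is the bit length of the exponent. -/
theorem PolyNat.powLoop {op : Data → ℕ → ℕ → ℕ} {M a n : Data → ℕ}
    (hop : PolyNat fun e => op e.fst e.snd.fst.toNat e.snd.snd.toNat)
    (hM : PolyBd fun x => (M x).size) (hb : ∀ x a b, op x a b ≤ M x) (ha : PolyNat a)
    (hn : PolyNat n) : PolyNat fun x => powLoop (op x) (a x) (n x) := by
  obtain ⟨q, hq⟩ : PolyBd fun x => 2 * ((M x).size + (a x).size) + (n x).size + 5 :=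
    .add (.add (.mul (.const 2) (hM.add ha.size_bd)) hn.size_bd) (.const 5)
  have h1 : PolyNat fun e => op e.fst e.snd.snd.fst.toNat e.snd.snd.snd.fst.toNat :=
    hop.comp (u := fun e => .pair e.fst (.pair e.snd.snd.fst e.snd.snd.snd.fst)) (by fun_prop)
  have h2 : PolyNat fun e => op e.fst e.snd.snd.snd.fst.toNat e.snd.snd.snd.fst.toNat :=
    hop.comp (u := fun e => .pair e.fst (.pair e.snd.snd.snd.fst e.snd.snd.snd.fst)) (by fun_prop)
  have := PolyFun.iter (init := fun x => .pair (.num (a x)) (.pair (.num (a x)) (.num (n x))))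
    (step := fun x _ s => powStep (op x) s) (n := fun x => (n x).size)
    (.pair (.num (.sel (by fun_prop) (by fun_prop) h1 (by fun_prop)))
      (.pair (.num h2) (by fun_prop))) (by fun_prop) (by fun_prop) hn.size_bd
    ⟨q, fun x i _ => by
      refine le_trans ?_ (hq x)
      have key : ∃ c d m : ℕ, AIBBE.iter (fun _ s => powStep (op x) s)
          (.pair (.num (a x)) (.pair (.num (a x)) (.num (n x)))) i =
          .pair (.num c) (.pair (.num d) (.num m)) ∧ c.size ≤ (M x).size + (a x).size ∧
          d.size ≤ (M x).size + (a x).size ∧ m.size ≤ (n x).size := by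
        induction i with
        | zero => exact ⟨_, _, _, rfl, by omega, by omega, le_rfl⟩
        | succ i ih =>
          obtain ⟨c, d, m, h, h3, h4, h5⟩ := ih (by omega)
          refine ⟨_, _, _, by rw [AIBBE.iter, h]; rfl, ?_, ?_, ?_⟩
          · have := Nat.size_le_size (hb x c d)
            simp only [Data.snd_pair, Data.fst_pair, Data.toNat_num]
            by_cases hm : m % 2 = 1
            · rw [sel_pos hm]; omega
            · rw [sel_neg hm]; omega
          · have := Nat.size_le_size (hb x d d)
            simp only [Data.snd_pair, Data.fst_pair, Data.toNat_num]
            omega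
          · exact (Nat.size_le_size (Nat.div_le_self _ _)).trans h5
      obtain ⟨c, d, m, h, h3, h4, h5⟩ := key
      rw [h]
      simp only [Data.size]
      omega⟩
  exact PolyNat.toNat this.fst

/-- Invariant after `k` passes: the accumulator encodes `x ^ (1 + n % 2 ^ k)`, the base encodes `x ^
2 ^ k`, and `n / 2 ^ k` is left over. The accumulator starts at `a`, which avoids knowing an
encoding of the neutral element and is the reason for the exponent `n + 1`. -/
theorem powLoop_eq {α : Type} [Monoid α] {op : ℕ → ℕ → ℕ} (enc : ℕ → α → Prop)
    (hop : ∀ a b x y, enc a x → enc b y → enc (op a b) (x * y)) {a : ℕ} {x : α} (ha : enc a x)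
    (n : ℕ) : enc (powLoop op a n) (x ^ (n + 1)) := by
  have h2 (k : ℕ) : ∃ c d, iter (fun _ s => powStep op s)
      (.pair (.num a) (.pair (.num a) (.num n))) k =
        .pair (.num c) (.pair (.num d) (.num (n / 2 ^ k))) ∧
        enc c (x ^ (1 + n % 2 ^ k)) ∧ enc d (x ^ 2 ^ k) := by
    induction k with
    | zero => exact ⟨a, a, by simp [iter], by simpa [Nat.mod_one] using ha, by simpa using ha⟩
    | succ k ih =>
      obtain ⟨c, d, h, hc, hd⟩ := ih
      have e1 : n % 2 ^ (k + 1) = n % 2 ^ k + 2 ^ k * (n / 2 ^ k % 2) := Nat.mod_pow_succ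
      rw [iter, h]
      refine ⟨sel (n / 2 ^ k % 2) 1 (op c d) c, op d d, ?_, ?_, ?_⟩
      · simp only [powStep, Data.snd_pair, Data.toNat_num, Data.fst_pair, Nat.div_div_eq_div_mul, ← pow_succ]
      · rw [e1]
        simp only [sel]
        split_ifs with h3
        · rw [h3, mul_one, ← add_assoc, pow_add]
          exact hop _ _ _ _ hc hd
        · rw [show n / 2 ^ k % 2 = 0 by omega]
          simpa using hc
      · rw [pow_succ, mul_two, pow_add]
        exact hop _ _ _ _ hd hd
  obtain ⟨c, d, h, hc, -⟩ := h2 n.size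
  rw [powLoop, h, add_comm]
  rwa [Nat.mod_eq_of_lt (Nat.lt_size_self n)] at hc

/-! ### The reduction as a program -/

/-- The data from which the reduction is built: the groups, the dishonest user, a polynomial bound
on the maximal number of receivers, and the number of times that a proof of knowledge is rewound. -/
structure Sim where
  𝒢 : GroupGenerator
  A : DishonestUser
  ppt : A.IsPPT
  Nq : ℕ[X]
  Kq : ℕ[X]

namespace Sim

variable (S : Sim)

/-- The security parameter. -/
def kap (x : Data) : ℕ := x.fst.fst.toNat.size - 1

/-- The group order. -/
def ord (x : Data) : ℕ := x.fst.snd.fst.toNat - 1 + 1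

/-- The description of the groups. -/
def desc (x : Data) : Data := x.fst.snd.snd

/-- The maximal number of receivers. -/
def nn (x : Data) : ℕ := min (x.snd.fst.toNat - 1) (S.Nq.eval (kap x))

/-- A strict bound for the representations of group elements. -/
def bd (x : Data) : ℕ := 2 ^ S.𝒢.sizeBound.eval (kap x)

/-- The group element with index `j` in the challenge. -/
def yy (x : Data) (j : ℕ) : ℕ :=
  (x.snd.snd.fst.nth (min (sel (j - (S.nn x + 2)) 0 j (j - 1)) (2 * S.nn x + 2))).toNat

/-- The element `h` of the challenge. -/
def chH (x : Data) : ℕ := x.snd.snd.snd.fst.toNat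

/-- The element `T` of the challenge. -/
def chT (x : Data) : ℕ := x.snd.snd.snd.snd.fst.toNat

/-- The coins. -/
def om (x : Data) : ℕ := x.snd.snd.snd.snd.snd.toNat

theorem kap_bd : PolyBd kap := PolyBd.size.mono fun x => by
  have h1 := x.fst.fst.toNat_size
  have h2 := x.fst_size
  have h3 := x.fst.fst_size
  unfold kap
  omega

/-- The running time must be polynomial on every input, also on those that are not challenges, so
the number read from the input is capped. On challenges the cap is inactive (`Ctx.nn_x`). The
reductions modulo `bd` and the minima in indices and exponents serve the same purpose. -/
theorem nn_bd : PolyBd S.nn := (PolyBd.eval S.Nq kap_bd).mono fun _ => min_le_right _ _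

theorem bd_bd : PolyBd fun x => (S.bd x).size :=
  (((PolyBd.eval S.𝒢.sizeBound kap_bd).mul (.const (2 : ℕ).size)).add (.const 1)).mono fun _ =>
    natSize_pow _ _

theorem ord_bd : PolyBd fun x => (ord x).size := by
  have : PolyNat ord := by unfold ord; fun_prop
  exact this.size_bd

@[fun_prop] theorem polyNat_kap {x : Data → Data} (hx : PolyFun x) :
    PolyNat fun e => kap (x e) := by unfold kap; fun_prop

@[fun_prop] theorem polyNat_ord {x : Data → Data} (hx : PolyFun x) :
    PolyNat fun e => ord (x e) := by unfold ord; fun_prop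

@[fun_prop] theorem polyFun_desc {x : Data → Data} (hx : PolyFun x) :
    PolyFun fun e => desc (x e) := by unfold desc; fun_prop

@[fun_prop] theorem polyNat_nn {x : Data → Data} (hx : PolyFun x) :
    PolyNat fun e => S.nn (x e) := by unfold nn; fun_prop

@[fun_prop] theorem polyNat_bd {x : Data → Data} (hx : PolyFun x) :
    PolyNat fun e => S.bd (x e) := by
  unfold bd
  exact .pow (by fun_prop) (by fun_prop) ((PolyBd.eval _ kap_bd).comp hx.size_bd)

@[fun_prop] theorem polyNat_yy {x : Data → Data} {j : Data → ℕ} (hx : PolyFun x)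
    (hj : PolyNat j) : PolyNat fun e => S.yy (x e) (j e) := by
  unfold yy
  refine .toNat (.nth (by fun_prop) ?_ (by fun_prop))
  exact (((PolyBd.const 2).mul (S.nn_bd.comp hx.size_bd)).add (.const 2)).mono
    fun _ => min_le_right _ _

@[fun_prop] theorem polyNat_chH {x : Data → Data} (hx : PolyFun x) :
    PolyNat fun e => chH (x e) := by unfold chH; fun_prop

@[fun_prop] theorem polyNat_chT {x : Data → Data} (hx : PolyFun x) :
    PolyNat fun e => chT (x e) := by unfold chT; fun_prop

@[fun_prop] theorem polyNat_om {x : Data → Data} (hx : PolyFun x) :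
    PolyNat fun e => om (x e) := by unfold om; fun_prop

/-! #### Group operations -/

/-- Multiplication in `G`. -/
def gm (x : Data) (a b : ℕ) : ℕ :=
  (S.𝒢.mulG.run (.pair (desc x) (.pair (.num a) (.num b)))).toNat % S.bd x

/-- Multiplication in `GT`. -/
def tm (x : Data) (a b : ℕ) : ℕ :=
  (S.𝒢.mulGT.run (.pair (desc x) (.pair (.num a) (.num b)))).toNat % S.bd x

/-- The pairing. -/
def pr (x : Data) (a b : ℕ) : ℕ :=
  (S.𝒢.pairing.run (.pair (desc x) (.pair (.num a) (.num b)))).toNat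

/-- Membership in `G`. -/
def mem (x : Data) (a : ℕ) : ℕ := (S.𝒢.memG.run (.pair (desc x) (.num a))).toNat

/-- Powers in `G`. -/
def gpow (x : Data) (a n : ℕ) : ℕ := powLoop (S.gm x) a (n + (ord x - 1)) % S.bd x

/-- Powers in `GT`. -/
def tpow (x : Data) (a n : ℕ) : ℕ := powLoop (S.tm x) a (n + (ord x - 1)) % S.bd x

/-- Inverses modulo the group order. -/
def inv (x : Data) (a : ℕ) : ℕ := powLoop (fun a b => a * b % ord x) a (2 * ord x - 4)

/-- Negatives modulo the group order. -/
def neg (x : Data) (a : ℕ) : ℕ := (ord x - 1) * a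

theorem bd_pos (x : Data) : 0 < S.bd x := by unfold bd; positivity

section

variable {x : Data → Data} {a b n : Data → ℕ}

@[fun_prop] theorem polyNat_gm (hx : PolyFun x) (ha : PolyNat a) (hb : PolyNat b) :
    PolyNat fun e => S.gm (x e) (a e) (b e) := by
  unfold gm
  exact .mod (.toNat (.run S.𝒢.mulG_polyTime (by fun_prop))) (by fun_prop)

@[fun_prop] theorem polyNat_tm (hx : PolyFun x) (ha : PolyNat a) (hb : PolyNat b) :
    PolyNat fun e => S.tm (x e) (a e) (b e) := by
  unfold tm
  exact .mod (.toNat (.run S.𝒢.mulGT_polyTime (by fun_prop))) (by fun_prop)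

@[fun_prop] theorem polyNat_pr (hx : PolyFun x) (ha : PolyNat a) (hb : PolyNat b) :
    PolyNat fun e => S.pr (x e) (a e) (b e) := by
  unfold pr
  exact .toNat (.run S.𝒢.pairing_polyTime (by fun_prop))

@[fun_prop] theorem polyNat_mem (hx : PolyFun x) (ha : PolyNat a) :
    PolyNat fun e => S.mem (x e) (a e) := by
  unfold mem
  exact .toNat (.run S.𝒢.memG_polyTime (by fun_prop))

@[fun_prop] theorem polyNat_gpow (hx : PolyFun x) (ha : PolyNat a) (hn : PolyNat n) :
    PolyNat fun e => S.gpow (x e) (a e) (n e) := by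
  unfold gpow
  refine .mod (.powLoop (op := fun e => S.gm (x e)) (by fun_prop) (S.bd_bd.comp hx.size_bd)
    (fun e a b => ?_) ha (by fun_prop)) (by fun_prop)
  exact (Nat.mod_lt _ (S.bd_pos _)).le

@[fun_prop] theorem polyNat_tpow (hx : PolyFun x) (ha : PolyNat a) (hn : PolyNat n) :
    PolyNat fun e => S.tpow (x e) (a e) (n e) := by
  unfold tpow
  refine .mod (.powLoop (op := fun e => S.tm (x e)) (by fun_prop) (S.bd_bd.comp hx.size_bd)
    (fun e a b => ?_) ha (by fun_prop)) (by fun_prop)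
  exact (Nat.mod_lt _ (S.bd_pos _)).le

@[fun_prop] theorem polyNat_inv (hx : PolyFun x) (ha : PolyNat a) :
    PolyNat fun e => inv (x e) (a e) := by
  unfold inv
  refine .powLoop (op := fun e a b => a * b % ord (x e)) (by fun_prop) (ord_bd.comp hx.size_bd)
    (fun e a b => ?_) ha (by fun_prop)
  exact (Nat.mod_lt _ (Nat.succ_pos _)).le

@[fun_prop] theorem polyNat_neg (hx : PolyFun x) (ha : PolyNat a) :
    PolyNat fun e => neg (x e) (a e) := by unfold neg; fun_prop

end

/-! #### Randomness -/

/-- The number of coins of the user. -/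
def userCoins (x : Data) : ℕ := 2 ^ S.A.coins.eval (kap x)

/-- The number of coin strings of the device. -/
def devCoins (x : Data) : ℕ := 2 ^ S.A.deviceCoins.eval (kap x)

/-- The coins of the user. -/
def rho (x : Data) : ℕ := om x % S.userCoins x

/-- The coins of the device in its runs `0`, `1`, `2`. -/
def dev (x : Data) (k : ℕ) : ℕ := om x / S.userCoins x / S.devCoins x ^ min k 3 % S.devCoins x

/-- The coins that remain for sampling modulo the group order. -/
def tape (x : Data) : ℕ := om x / S.userCoins x / S.devCoins x ^ 3

/-- Exponents that the reduction chooses. -/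
def dig (x : Data) (k : ℕ) : ℕ := S.tape x / ord x ^ min k 10 % ord x

/-- The known parts of the exponents of the elements `h_i`. -/
def bb (x : Data) (i : ℕ) : ℕ := S.tape x / ord x ^ 10 / ord x ^ min i (S.nn x) % ord x

/-- The coins of the key generation protocols. -/
def tape' (x : Data) : ℕ := S.tape x / ord x ^ 10 / ord x ^ (S.nn x + 1)

/-- The part of the exponent of `g₂` that is known. -/
def gam (x : Data) : ℕ := S.dig x 6

/-- The known part of the exponent of `g₃`. -/
def tht (x : Data) : ℕ := S.dig x 7

/-- The last component of the key for the target identity. -/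
def tst (x : Data) : ℕ := S.dig x 8

/-- The known part of the exponent of `z`. -/
def del (x : Data) : ℕ := S.dig x 9

section

variable {x : Data → Data} {k : Data → ℕ}

@[fun_prop] theorem polyNat_userCoins (hx : PolyFun x) :
    PolyNat fun e => S.userCoins (x e) := by
  unfold userCoins
  exact .pow (by fun_prop) (by fun_prop) ((PolyBd.eval _ kap_bd).comp hx.size_bd)

@[fun_prop] theorem polyNat_devCoins (hx : PolyFun x) :
    PolyNat fun e => S.devCoins (x e) := by
  unfold devCoins
  exact .pow (by fun_prop) (by fun_prop) ((PolyBd.eval _ kap_bd).comp hx.size_bd)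

@[fun_prop] theorem polyNat_rho (hx : PolyFun x) : PolyNat fun e => S.rho (x e) := by
  unfold rho; fun_prop

@[fun_prop] theorem polyNat_dev (hx : PolyFun x) (hk : PolyNat k) :
    PolyNat fun e => S.dev (x e) (k e) := by
  unfold dev
  exact .mod (.div (by fun_prop) (.pow (by fun_prop) (by fun_prop)
    ((PolyBd.const 3).mono fun _ => min_le_right _ _))) (by fun_prop)

@[fun_prop] theorem polyNat_tape (hx : PolyFun x) : PolyNat fun e => S.tape (x e) := by
  unfold tape
  exact .div (by fun_prop) (.pow (by fun_prop) (by fun_prop) (.const 3))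

@[fun_prop] theorem polyNat_dig (hx : PolyFun x) (hk : PolyNat k) :
    PolyNat fun e => S.dig (x e) (k e) := by
  unfold dig
  exact .mod (.div (by fun_prop) (.pow (by fun_prop) (by fun_prop)
    ((PolyBd.const 10).mono fun _ => min_le_right _ _))) (by fun_prop)

@[fun_prop] theorem polyNat_bb (hx : PolyFun x) (hk : PolyNat k) :
    PolyNat fun e => S.bb (x e) (k e) := by
  unfold bb
  exact .mod (.div (.div (by fun_prop) (.pow (by fun_prop) (by fun_prop) (.const 10)))
    (.pow (by fun_prop) (by fun_prop) ((S.nn_bd.comp hx.size_bd).mono fun _ => min_le_right _ _)))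
    (by fun_prop)

@[fun_prop] theorem polyNat_tape' (hx : PolyFun x) : PolyNat fun e => S.tape' (x e) := by
  unfold tape'
  exact .div (.div (by fun_prop) (.pow (by fun_prop) (by fun_prop) (.const 10)))
    (.pow (by fun_prop) (by fun_prop) ((S.nn_bd.comp hx.size_bd).add (.const 1)))

@[fun_prop] theorem polyNat_gam (hx : PolyFun x) : PolyNat fun e => S.gam (x e) := by
  unfold gam; fun_prop

@[fun_prop] theorem polyNat_tht (hx : PolyFun x) : PolyNat fun e => S.tht (x e) := by
  unfold tht; fun_prop

@[fun_prop] theorem polyNat_tst (hx : PolyFun x) : PolyNat fun e => S.tst (x e) := by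
  unfold tst; fun_prop

@[fun_prop] theorem polyNat_del (hx : PolyFun x) : PolyNat fun e => S.del (x e) := by
  unfold del; fun_prop

end

/-! #### The public key -/

/-- The generator. -/
def g0 (x : Data) : ℕ := S.yy x 0

/-- The element `g₁`. -/
def g1 (x : Data) : ℕ := S.yy x 1

/-- The element `g₂`. -/
def g2 (x : Data) : ℕ := S.gm x (S.yy x (S.nn x + 1)) (S.gpow x (S.g0 x) (S.gam x))

/-- The element `g₃`. -/
def g3 (x : Data) : ℕ :=
  S.gm x (S.gpow x (S.g2 x) (neg x (S.tst x))) (S.gpow x (S.g0 x) (S.tht x))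

/-- The elements `h_i`. -/
def hh (x : Data) (i : ℕ) : ℕ :=
  S.gm x (S.gpow x (S.g0 x) (S.bb x i)) (S.yy x (S.nn x + 1 - i))

/-- The input of the user. -/
def ini (x : Data) : Data := .pair x.fst (.pair (.num (S.nn x)) (.num (S.rho x)))

/-- The target identity. -/
def ids (x : Data) : ℕ := (S.A.choose.run (S.ini x)).toNat % ord x

/-- The element `z`. -/
def zz (x : Data) : ℕ :=
  S.gm x (S.gpow x (S.g0 x) (S.del x))
    (S.gm x (S.gpow x (S.hh x 0) (S.ids x)) (S.gpow x (S.hh x 1) (neg x 1)))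

/-- The public key. -/
def pkD (x : Data) : Data :=
  .pair (.num (S.g0 x)) (.pair (.num (S.g1 x)) (.pair (.num (S.g2 x)) (.pair (.num (S.g3 x))
    (.pair (.num (S.zz x)) (tab (fun i => .num (S.hh x i)) (S.nn x + 1))))))

/-- The view of the user after some answers of the authority. -/
def vw (x ans : Data) : Data := .pair (S.ini x) (.pair (S.pkD x) ans)

section

variable {x d : Data → Data} {k : Data → ℕ}

@[fun_prop] theorem polyNat_g0 (hx : PolyFun x) : PolyNat fun e => S.g0 (x e) := by
  unfold g0; fun_prop

@[fun_prop] theorem polyNat_g1 (hx : PolyFun x) : PolyNat fun e => S.g1 (x e) := by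
  unfold g1; fun_prop

@[fun_prop] theorem polyNat_g2 (hx : PolyFun x) : PolyNat fun e => S.g2 (x e) := by
  unfold g2; fun_prop

@[fun_prop] theorem polyNat_g3 (hx : PolyFun x) : PolyNat fun e => S.g3 (x e) := by
  unfold g3; fun_prop

@[fun_prop] theorem polyNat_hh (hx : PolyFun x) (hk : PolyNat k) :
    PolyNat fun e => S.hh (x e) (k e) := by
  unfold hh; fun_prop

@[fun_prop] theorem polyFun_ini (hx : PolyFun x) : PolyFun fun e => S.ini (x e) := by
  unfold ini; fun_prop

@[fun_prop] theorem polyNat_ids (hx : PolyFun x) : PolyNat fun e => S.ids (x e) := by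
  unfold ids
  exact .mod (.toNat (.run S.ppt.1 (by fun_prop))) (by fun_prop)

@[fun_prop] theorem polyNat_zz (hx : PolyFun x) : PolyNat fun e => S.zz (x e) := by
  unfold zz; fun_prop

@[fun_prop] theorem polyFun_pkD (hx : PolyFun x) : PolyFun fun e => S.pkD (x e) := by
  unfold pkD
  have : PolyFun fun e => tab (fun i => .num (S.hh (x e) i)) (S.nn (x e) + 1) :=
    .tab (f := fun e i => .num (S.hh (x e) i)) (by fun_prop) (by fun_prop)
      ((S.nn_bd.comp hx.size_bd).add (.const 1))
  fun_prop

@[fun_prop] theorem polyFun_vw (hx : PolyFun x) (hd : PolyFun d) :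
    PolyFun fun e => S.vw (x e) (d e) := by
  unfold vw; fun_prop

end

/-! #### Key generation -/

/-- A power of an identity. -/
def idp (x : Data) (ID j : ℕ) : ℕ := ID ^ min j (S.nn x + 1)

/-- The product that makes up the second component of a key. -/
def prodK (x : Data) (ID : ℕ) : ℕ :=
  iter (fun j a => S.gm x a (S.gpow x (S.yy x (j + 1)) (S.idp x ID j))) (S.gpow x (S.g0 x) 0)
    (S.nn x + 1)

/-- The product of higher powers in the first component of a key. -/
def prodL (x : Data) (ID : ℕ) : ℕ :=
  iter (fun j a => S.gm x a (S.gpow x (S.yy x (j + S.nn x + 3)) (S.idp x ID (j + 1))))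
    (S.gpow x (S.g0 x) 0) (S.nn x)

/-- The second component of a simulated key. -/
def kk2 (x : Data) (ID r τ : ℕ) : ℕ :=
  S.gm x (S.gpow x (S.g0 x) r) (S.gpow x (S.prodK x ID) τ)

/-- The first component of a simulated key. -/
def kk1 (x : Data) (ID r τ dt θ : ℕ) : ℕ :=
  S.gm x (S.gm x (S.gpow x (S.g1 x) (S.gam x * dt + θ + S.tht x))
      (S.gpow x (S.kk2 x ID r τ) (S.del x + S.ids x * S.bb x 0 + neg x (S.bb x 1))))
    (S.gm x (S.gpow x (S.gm x (S.gpow x (S.yy x (S.nn x + 1)) (S.ids x))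
        (S.gpow x (S.yy x (S.nn x)) (neg x 1))) r)
      (S.gm x (S.gpow x (S.gm x (S.gpow x (S.yy x (S.nn x + 1)) (neg x 1))
          (S.gpow x (S.yy x (2 * S.nn x + 2)) (S.idp x ID (S.nn x + 1)))) τ)
        (S.gpow x (S.prodL x ID) (neg x dt))))

/-- The delegation components of a simulated key. -/
def kkT (x : Data) (ID r τ i : ℕ) : ℕ :=
  S.gm x (S.gm x (S.gpow x (S.kk2 x ID r τ) (S.bb x (i + 1) + neg x (ID * S.bb x i)))
      (S.gpow x (S.gm x (S.yy x (S.nn x - i))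
        (S.gpow x (S.yy x (S.nn x + 1 - i)) (neg x ID))) r))
    (S.gpow x (S.gm x (S.yy x (S.nn x + 1 - i))
      (S.gpow x (S.yy x (2 * S.nn x + 2 - i)) (neg x (S.idp x ID (S.nn x + 1))))) τ)

/-- A simulated key. -/
def keyD (x : Data) (ID r τ dt θ t₁ : ℕ) : Data :=
  .pair (.num (S.kk1 x ID r τ dt θ)) (.pair (.num (S.kk2 x ID r τ))
    (.pair (tab (fun i => .num (S.kkT x ID r τ i)) (S.nn x)) (.num t₁)))

/-- The reduction modulo `bd` gives this for arbitrary numbers and whatever `mulG` returns, so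
iterated products stay short on all inputs. -/
theorem gm_le (x : Data) (a b : ℕ) : S.gm x a b ≤ S.bd x := (Nat.mod_lt _ (S.bd_pos x)).le

theorem gpow_le (x : Data) (a b : ℕ) : S.gpow x a b ≤ S.bd x := (Nat.mod_lt _ (S.bd_pos x)).le

section

variable {x : Data → Data} {ID r τ dt θ t₁ i : Data → ℕ}

@[fun_prop] theorem polyNat_idp (hx : PolyFun x) (hID : PolyNat ID) (hi : PolyNat i) :
    PolyNat fun e => S.idp (x e) (ID e) (i e) := by
  unfold idp
  exact .pow (by fun_prop) (by fun_prop)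
    (((S.nn_bd.comp hx.size_bd).add (.const 1)).mono fun _ => min_le_right _ _)

@[fun_prop] theorem polyNat_prodK (hx : PolyFun x) (hID : PolyNat ID) :
    PolyNat fun e => S.prodK (x e) (ID e) := by
  unfold prodK
  refine .iter (M := fun e => S.bd (x e)) (step := fun e j a => S.gm (x e) a
    (S.gpow (x e) (S.yy (x e) (j + 1)) (S.idp (x e) (ID e) j))) (by fun_prop) (by fun_prop)
    (by fun_prop) ((S.nn_bd.comp hx.size_bd).add (.const 1)) (S.bd_bd.comp hx.size_bd)
    fun e j _ => ?_
  cases j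
  · exact S.gpow_le _ _ _
  · exact S.gm_le _ _ _

@[fun_prop] theorem polyNat_prodL (hx : PolyFun x) (hID : PolyNat ID) :
    PolyNat fun e => S.prodL (x e) (ID e) := by
  unfold prodL
  refine .iter (M := fun e => S.bd (x e)) (step := fun e j a => S.gm (x e) a
    (S.gpow (x e) (S.yy (x e) (j + S.nn (x e) + 3)) (S.idp (x e) (ID e) (j + 1)))) (by fun_prop)
    (by fun_prop) (by fun_prop) (S.nn_bd.comp hx.size_bd) (S.bd_bd.comp hx.size_bd)
    fun e j _ => ?_
  cases j
  · exact S.gpow_le _ _ _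
  · exact S.gm_le _ _ _

@[fun_prop] theorem polyNat_kk2 (hx : PolyFun x) (hID : PolyNat ID) (hr : PolyNat r)
    (hτ : PolyNat τ) : PolyNat fun e => S.kk2 (x e) (ID e) (r e) (τ e) := by
  unfold kk2; fun_prop

@[fun_prop] theorem polyNat_kk1 (hx : PolyFun x) (hID : PolyNat ID) (hr : PolyNat r)
    (hτ : PolyNat τ) (hdt : PolyNat dt) (hθ : PolyNat θ) :
    PolyNat fun e => S.kk1 (x e) (ID e) (r e) (τ e) (dt e) (θ e) := by
  unfold kk1; fun_prop

@[fun_prop] theorem polyNat_kkT (hx : PolyFun x) (hID : PolyNat ID) (hr : PolyNat r)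
    (hτ : PolyNat τ) (hi : PolyNat i) :
    PolyNat fun e => S.kkT (x e) (ID e) (r e) (τ e) (i e) := by
  unfold kkT; fun_prop

@[fun_prop] theorem polyFun_keyD (hx : PolyFun x) (hID : PolyNat ID) (hr : PolyNat r)
    (hτ : PolyNat τ) (hdt : PolyNat dt) (hθ : PolyNat θ) (ht : PolyNat t₁) :
    PolyFun fun e => S.keyD (x e) (ID e) (r e) (τ e) (dt e) (θ e) (t₁ e) := by
  unfold keyD
  have : PolyFun fun e => tab (fun i => .num (S.kkT (x e) (ID e) (r e) (τ e) i)) (S.nn (x e)) :=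
    .tab (f := fun e i => .num (S.kkT (x e) (ID e) (r e) (τ e) i)) (by fun_prop) (by fun_prop)
      (S.nn_bd.comp hx.size_bd)
  fun_prop

end

end Sim

namespace Sim

variable (S : Sim)

/-! #### The key generation protocols -/

/-- The number of key generation protocols. -/
def qq (x : Data) : ℕ := S.A.queries.eval (kap x)

/-- The first message of the user. -/
def fm (x ans : Data) : Data := S.A.commit.run (S.vw x ans)

/-- The identity in the first message. -/
def qID (x ans : Data) : ℕ := (S.fm x ans).fst.toNat % ord x

/-- The commitment in the first message. -/
def qR (x ans : Data) : ℕ := (S.fm x ans).snd.fst.toNat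

/-- The group element that starts the proof of knowledge. -/
def qW (x ans : Data) : ℕ := (S.fm x ans).snd.snd.toNat

/-- The response to a challenge. -/
def rsp (x ans : Data) (c : ℕ) : Data := S.A.respond.run (.pair (S.vw x ans) (.num c))

/-- Is the response to a challenge correct? -/
def chk (x ans : Data) (c : ℕ) : ℕ :=
  sel (S.gm x (S.gpow x (S.g2 x) (S.rsp x ans c).fst.toNat)
      (S.gpow x (S.g0 x) (S.rsp x ans c).snd.toNat))
    (S.gm x (S.qW x ans) (S.gpow x (S.qR x ans) c)) 1 0

/-- How often an identity occurs in a list. -/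
def occ (x l : Data) (ID : ℕ) : ℕ :=
  ∑ j ∈ Finset.range (S.qq x), sel (l.nth (min j (S.qq x))).toNat (ID + 1) 1 0

/-- Does the authority issue a key? -/
def acc (x ans l : Data) (c : ℕ) : ℕ :=
  sel (S.mem x (S.qR x ans)) 1 (sel (S.mem x (S.qW x ans)) 1
    (sel (S.occ x l (S.qID x ans)) 0 (S.chk x ans c) 0) 0) 0

/-- The distance to a challenge that has a correct response (`0` if none is found). -/
def fnd (x ans : Data) (c : ℕ) : ℕ :=
  iter (fun i a => sel (S.chk x ans ((c + (i + 1)) % ord x)) 1 (i + 1) a) 0 (S.Kq.eval (kap x))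

/-- The response to the second challenge. -/
def rsp' (x ans : Data) (c : ℕ) : Data := S.rsp x ans ((c + S.fnd x ans c) % ord x)

/-- The extracted exponent of `g₂`. -/
def xt0 (x ans : Data) (c : ℕ) : ℕ :=
  ((S.rsp' x ans c).fst.toNat + neg x (S.rsp x ans c).fst.toNat) * inv x (S.fnd x ans c)

/-- The extracted exponent of `g`. -/
def xth (x ans : Data) (c : ℕ) : ℕ :=
  ((S.rsp' x ans c).snd.toNat + neg x (S.rsp x ans c).snd.toNat) * inv x (S.fnd x ans c)

/-- The authority's contribution to the last component of the key. -/
def xt1 (x ans : Data) (c s : ℕ) : ℕ :=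
  sel (S.qID x ans) (S.ids x) (S.tst x + neg x (S.xt0 x ans c)) s % ord x

/-- The difference between the last component of the key and that of the target key. -/
def xdt (x ans : Data) (c s : ℕ) : ℕ :=
  S.xt0 x ans c + S.xt1 x ans c s + neg x (S.tst x)

/-- The factor by which the randomness of the key is shifted. -/
def xta (x ans : Data) (c s : ℕ) : ℕ :=
  S.xdt x ans c s * inv x (S.qID x ans + neg x (S.ids x))

/-- The answer that contains a key. -/
def ansK (x ans : Data) (c r s : ℕ) : Data :=
  .pair (.num c) (S.keyD x (S.qID x ans) r (S.xta x ans c s) (S.xdt x ans c s) (S.xth x ans c)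
    (S.xt1 x ans c s))

/-- What a key generation protocol adds to the flag for failure, the answers and the list of
identities. -/
def upd (x : Data) (f : ℕ) (ans l : Data) (c r s : ℕ) : Data :=
  sel (S.acc x ans l c) 1
    (sel (S.fnd x ans c) 0
      (.pair (.num 1) (.pair (.pair (.pair (.num c) (.num 0)) ans) l))
      (.pair (.num f) (.pair (.pair (S.ansK x ans c r s) ans) (.pair (.num (S.qID x ans + 1)) l))))
    (.pair (.num f) (.pair (.pair (.pair (.num c) (.num 0)) ans) l))

/-- A key generation protocol, on a state that consists of the remaining coins, the flag, the
answers and the identities. -/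
def stp (x s : Data) : Data :=
  .pair (.num (s.fst.toNat / ord x / ord x / ord x))
    (S.upd x s.snd.fst.toNat s.snd.snd.fst s.snd.snd.snd (s.fst.toNat % ord x)
      (s.fst.toNat / ord x % ord x) (s.fst.toNat / ord x / ord x % ord x))

/-- The state after all key generation protocols. -/
def fin (x : Data) : Data :=
  iter (fun _ s => S.stp x s)
    (.pair (.num (S.tape' x)) (.pair (.num 0) (.pair (.num 0) (.num 0)))) (S.qq x)

theorem qq_bd : PolyBd S.qq := PolyBd.eval _ kap_bd

section

variable {x ans l : Data → Data} {c r s f : Data → ℕ}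

@[fun_prop] theorem polyNat_qq (hx : PolyFun x) : PolyNat fun e => S.qq (x e) := by
  unfold qq; fun_prop

@[fun_prop] theorem polyFun_fm (hx : PolyFun x) (ha : PolyFun ans) :
    PolyFun fun e => S.fm (x e) (ans e) := by
  unfold fm
  exact .run S.ppt.2.1 (by fun_prop)

@[fun_prop] theorem polyNat_qID (hx : PolyFun x) (ha : PolyFun ans) :
    PolyNat fun e => S.qID (x e) (ans e) := by unfold qID; fun_prop

@[fun_prop] theorem polyNat_qR (hx : PolyFun x) (ha : PolyFun ans) :
    PolyNat fun e => S.qR (x e) (ans e) := by unfold qR; fun_prop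

@[fun_prop] theorem polyNat_qW (hx : PolyFun x) (ha : PolyFun ans) :
    PolyNat fun e => S.qW (x e) (ans e) := by unfold qW; fun_prop

@[fun_prop] theorem polyFun_rsp (hx : PolyFun x) (ha : PolyFun ans) (hc : PolyNat c) :
    PolyFun fun e => S.rsp (x e) (ans e) (c e) := by
  unfold rsp
  exact .run S.ppt.2.2.1 (by fun_prop)

@[fun_prop] theorem polyNat_chk (hx : PolyFun x) (ha : PolyFun ans) (hc : PolyNat c) :
    PolyNat fun e => S.chk (x e) (ans e) (c e) := by unfold chk; fun_prop

@[fun_prop] theorem polyNat_occ (hx : PolyFun x) (hl : PolyFun l) (hc : PolyNat c) :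
    PolyNat fun e => S.occ (x e) (l e) (c e) := by
  unfold occ
  refine .sum (f := fun e j => AIBBE.sel ((l e).nth (min j (S.qq (x e)))).toNat (c e + 1) 1 0)
    (.sel (.toNat (.nth (by fun_prop) ?_ (by fun_prop))) (by fun_prop) (by fun_prop)
      (by fun_prop)) (by fun_prop) (S.qq_bd.comp hx.size_bd)
  refine (S.qq_bd.comp (u := fun e => x e.fst) ?_).mono fun _ => min_le_right _ _
  exact (hx.comp (.fst .id)).size_bd

@[fun_prop] theorem polyNat_acc (hx : PolyFun x) (ha : PolyFun ans) (hl : PolyFun l)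
    (hc : PolyNat c) : PolyNat fun e => S.acc (x e) (ans e) (l e) (c e) := by
  unfold acc; fun_prop

theorem iter_fnd_le (P : ℕ → ℕ) (k i : ℕ) (h : i ≤ k) :
    iter (fun i a => sel (P i) 1 (i + 1) a) 0 i ≤ k := by
  induction i with
  | zero => exact Nat.zero_le _
  | succ i ih =>
    simp only [iter, sel]
    split_ifs
    · exact h
    · exact ih (by omega)

@[fun_prop] theorem polyNat_fnd (hx : PolyFun x) (ha : PolyFun ans) (hc : PolyNat c) :
    PolyNat fun e => S.fnd (x e) (ans e) (c e) := by
  unfold fnd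
  have hb : PolyBd fun e => S.Kq.eval (kap (x e)) := (PolyBd.eval S.Kq kap_bd).comp hx.size_bd
  exact .iter (M := fun e => S.Kq.eval (kap (x e))) (init := fun _ => 0) (step := fun e i a =>
    AIBBE.sel (S.chk (x e) (ans e) ((c e + (i + 1)) % ord (x e))) 1 (i + 1) a) (by fun_prop)
    (by fun_prop) (by fun_prop) hb (hb.mono fun _ => natSize_le_self _)
    fun e i hi => iter_fnd_le _ _ _ hi

@[fun_prop] theorem polyFun_rsp' (hx : PolyFun x) (ha : PolyFun ans) (hc : PolyNat c) :
    PolyFun fun e => S.rsp' (x e) (ans e) (c e) := by unfold rsp'; fun_prop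

@[fun_prop] theorem polyNat_xt0 (hx : PolyFun x) (ha : PolyFun ans) (hc : PolyNat c) :
    PolyNat fun e => S.xt0 (x e) (ans e) (c e) := by unfold xt0; fun_prop

@[fun_prop] theorem polyNat_xth (hx : PolyFun x) (ha : PolyFun ans) (hc : PolyNat c) :
    PolyNat fun e => S.xth (x e) (ans e) (c e) := by unfold xth; fun_prop

@[fun_prop] theorem polyNat_xt1 (hx : PolyFun x) (ha : PolyFun ans) (hc : PolyNat c)
    (hs : PolyNat s) : PolyNat fun e => S.xt1 (x e) (ans e) (c e) (s e) := by
  unfold xt1; fun_prop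

@[fun_prop] theorem polyNat_xdt (hx : PolyFun x) (ha : PolyFun ans) (hc : PolyNat c)
    (hs : PolyNat s) : PolyNat fun e => S.xdt (x e) (ans e) (c e) (s e) := by
  unfold xdt; fun_prop

@[fun_prop] theorem polyNat_xta (hx : PolyFun x) (ha : PolyFun ans) (hc : PolyNat c)
    (hs : PolyNat s) : PolyNat fun e => S.xta (x e) (ans e) (c e) (s e) := by
  unfold xta; fun_prop

@[fun_prop] theorem polyFun_ansK (hx : PolyFun x) (ha : PolyFun ans) (hc : PolyNat c)
    (hr : PolyNat r) (hs : PolyNat s) :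
    PolyFun fun e => S.ansK (x e) (ans e) (c e) (r e) (s e) := by
  unfold ansK; fun_prop

@[fun_prop] theorem polyFun_upd (hx : PolyFun x) (hf : PolyNat f) (ha : PolyFun ans)
    (hl : PolyFun l) (hc : PolyNat c) (hr : PolyNat r) (hs : PolyNat s) :
    PolyFun fun e => S.upd (x e) (f e) (ans e) (l e) (c e) (r e) (s e) := by
  unfold upd; fun_prop

@[fun_prop] theorem polyFun_stp (hx : PolyFun x) (ha : PolyFun ans) :
    PolyFun fun e => S.stp (x e) (ans e) := by
  unfold stp; fun_prop

end

/-- A bound for the growth of the state. -/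
def grow (x : Data) : ℕ :=
  S.nn x * ((S.bd x).size + 1 + 1) + 2 * (S.bd x).size + 5 * (ord x).size + 20

theorem grow_bd : PolyBd S.grow := by
  refine .add (.add (.add (.mul S.nn_bd (.add (.add S.bd_bd (.const 1)) (.const 1)))
    (.mul (.const 2) S.bd_bd)) (.mul (.const 5) ord_bd)) (.const 20)

theorem keyD_size (x : Data) (ID r τ dt θ t₁ : ℕ) (ht : t₁ ≤ ord x) :
    (S.keyD x ID r τ dt θ t₁).size ≤
      S.nn x * ((S.bd x).size + 1 + 1) + 2 * (S.bd x).size + (ord x).size + 7 := by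
  have h1 := Nat.size_le_size (show S.kk1 x ID r τ dt θ ≤ S.bd x from S.gm_le _ _ _)
  have h2 := Nat.size_le_size (show S.kk2 x ID r τ ≤ S.bd x from S.gm_le _ _ _)
  have h3 := tab_size_le (fun i => .num (S.kkT x ID r τ i)) (S.nn x) ((S.bd x).size + 1)
    fun i _ => by
      have := Nat.size_le_size (show S.kkT x ID r τ i ≤ S.bd x from S.gm_le _ _ _)
      simp only [Data.size]
      omega
  have h4 := Nat.size_le_size ht
  simp only [keyD, Data.size]
  omega

/-- The growth is additive, because what enters the state is a challenge, a key of controlled size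
and an identity reduced modulo the order, and never a raw message of the user. A merely polynomial
growth per protocol could explode over polynomially many protocols. -/
theorem upd_shape (x : Data) (f : ℕ) (ans l : Data) (c r s : ℕ) (hc : c ≤ ord x) :
    ∃ f' ans' l', S.upd x f ans l c r s = .pair (.num f') (.pair ans' l') ∧
      f'.size + ans'.size + l'.size ≤ f.size + ans.size + l.size + S.grow x := by
  have h0 := Nat.size_le_size hc
  have h1 : (1 : ℕ).size = 1 := by simp
  have h3 : (0 : ℕ).size = 0 := by simp
  unfold upd
  by_cases ha : S.acc x ans l c = 1
  · rw [sel_pos ha]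
    by_cases hb : S.fnd x ans c = 0
    · rw [sel_pos hb]
      refine ⟨_, _, _, rfl, ?_⟩
      simp only [Data.size, grow]
      omega
    · rw [sel_neg hb]
      refine ⟨_, _, _, rfl, ?_⟩
      have h2 : S.qID x ans + 1 ≤ ord x := Nat.mod_lt _ (Nat.succ_pos _)
      have h4 := Nat.size_le_size h2
      have h5 := S.keyD_size x (S.qID x ans) r (S.xta x ans c s) (S.xdt x ans c s)
        (S.xth x ans c) (S.xt1 x ans c s) (Nat.mod_lt _ (Nat.succ_pos _)).le
      simp only [Data.size, grow, ansK]
      omega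
  · rw [sel_neg ha]
    refine ⟨_, _, _, rfl, ?_⟩
    simp only [Data.size, grow]
    omega

theorem stp_shape (x : Data) (w f : ℕ) (ans l : Data) :
    ∃ w' f' ans' l', S.stp x (.pair (.num w) (.pair (.num f) (.pair ans l))) =
      .pair (.num w') (.pair (.num f') (.pair ans' l')) ∧
      w'.size + f'.size + ans'.size + l'.size ≤ w.size + f.size + ans.size + l.size + S.grow x := by
  obtain ⟨f', ans', l', h, h'⟩ := S.upd_shape x f ans l (w % ord x) (w / ord x % ord x)
    (w / ord x / ord x % ord x) (Nat.mod_lt _ (Nat.succ_pos _)).le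
  have h2 : (w / ord x / ord x / ord x).size ≤ w.size :=
    Nat.size_le_size ((Nat.div_le_self _ _).trans
      ((Nat.div_le_self _ _).trans (Nat.div_le_self _ _)))
  refine ⟨w / ord x / ord x / ord x, f', ans', l', ?_, by omega⟩
  simp only [stp, Data.fst_pair, Data.snd_pair, Data.toNat_num, h]

@[fun_prop] theorem polyFun_fin {x : Data → Data} (hx : PolyFun x) :
    PolyFun fun e => S.fin (x e) := by
  suffices h : PolyFun S.fin from h.comp hx
  unfold fin
  have ht : PolyNat S.tape' := by fun_prop
  obtain ⟨q, hq⟩ : PolyBd fun x => (S.tape' x).size + S.qq x * S.grow x + 10 :=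
    .add (.add ht.size_bd (S.qq_bd.mul S.grow_bd)) (.const 10)
  refine .iter (step := fun x _ s => S.stp x s)
    (init := fun x => .pair (.num (S.tape' x)) (.pair (.num 0) (.pair (.num 0) (.num 0))))
    (n := S.qq) (by fun_prop) (by fun_prop) (by fun_prop) S.qq_bd ⟨q, fun x i hi => ?_⟩
  refine le_trans ?_ (hq x)
  have key : ∃ w f ans l, AIBBE.iter (fun _ s => S.stp x s)
      (.pair (.num (S.tape' x)) (.pair (.num 0) (.pair (.num 0) (.num 0)))) i =
      .pair (.num w) (.pair (.num f) (.pair ans l)) ∧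
      w.size + f.size + ans.size + l.size ≤ (S.tape' x).size + i * S.grow x + 2 := by
    clear hi
    induction i with
    | zero => exact ⟨_, _, _, _, rfl, by simp [Data.size]⟩
    | succ i ih =>
      obtain ⟨w, f, ans, l, h, h'⟩ := ih
      obtain ⟨w', f', ans', l', h2, h3⟩ := S.stp_shape x w f ans l
      refine ⟨w', f', ans', l', by rw [AIBBE.iter, h]; exact h2, ?_⟩
      rw [Nat.succ_mul]
      omega
  obtain ⟨w, f, ans, l, h, h'⟩ := key
  have h2 := Nat.mul_le_mul_right (S.grow x) hi
  rw [h]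
  simp only [Data.size]
  omega

/-! #### The answer of the reduction -/

/-- The failure flag at the end. -/
def flg (x : Data) : ℕ := (S.fin x).snd.fst.toNat

/-- The view of the user at the end. -/
def fv (x : Data) : Data := S.vw x (S.fin x).snd.snd.fst

/-- The output of the user. -/
def ky (x : Data) : Data := S.A.output.run (S.fv x)

/-- The component `K₁` of the user's key. -/
def ky1 (x : Data) : ℕ := (S.ky x).fst.toNat

/-- The component `K₂` of the user's key. -/
def ky2 (x : Data) : ℕ := (S.ky x).snd.fst.toNat

/-- The components `T_i` of the user's key. -/
def kyT (x : Data) (i : ℕ) : ℕ := ((S.ky x).snd.snd.fst.nth (min i (S.nn x))).toNat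

/-- The component `t` of the user's key. -/
def kyt (x : Data) : ℕ := (S.ky x).snd.snd.snd.toNat

/-- The number of components `T_i` that are not group elements. -/
def badT (x : Data) : ℕ := ∑ i ∈ Finset.range (S.nn x), sel (S.mem x (S.kyT x i)) 1 0 1

/-- The number of components `T_i` that violate the validity relation. -/
def badV (x : Data) : ℕ := ∑ i ∈ Finset.range (S.nn x),
  sel (S.pr x (S.g0 x) (S.kyT x i))
    (S.pr x (S.ky2 x) (S.gm x (S.hh x (i + 1)) (S.gpow x (S.hh x i) (neg x (S.ids x))))) 0 1

/-- Is the key of the user valid? -/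
def val (x : Data) : ℕ :=
  sel (S.mem x (S.ky1 x)) 1 (sel (S.mem x (S.ky2 x)) 1 (sel (S.badT x) 0
    (sel (S.pr x (S.ky1 x) (S.g0 x))
      (S.tm x (S.tm x (S.tpow x (S.pr x (S.g1 x) (S.g2 x)) (S.kyt x)) (S.pr x (S.g1 x) (S.g3 x)))
        (S.pr x (S.zz x) (S.ky2 x)))
      (sel (S.badV x) 0 1 0) 0) 0) 0) 0

/-- The decryption of a ciphertext with `C₀ = 1`. -/
def dec (x : Data) (C₁ C₂ C₃ : ℕ) : ℕ :=
  S.tm x (S.tm x (S.tpow x (S.pr x C₁ (S.gm x (S.ky1 x) (S.kyT x 0))) (neg x 1))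
    (S.pr x C₂ (S.ky2 x))) (S.tpow x C₃ (S.kyt x))

/-- The device is fed with the ciphertext whose decryption is `m`. -/
def trl (x : Data) (C₁ C₂ C₃ m w : ℕ) : ℕ :=
  sel (S.A.device.run (.pair (S.fv x) (.pair
    (.pair (.num (S.tm x m (S.tpow x (S.dec x C₁ C₂ C₃) (neg x 1))))
      (.pair (.num C₁) (.pair (.num C₂) (.num C₃))))
    (.pair (.pair (.num (S.ids x)) (.num 0)) (.num w))))).toNat m 1 0

/-- A random element of `GT`. -/
def gtE (x : Data) (n : ℕ) : ℕ := S.tpow x (S.pr x (S.g0 x) (S.g0 x)) n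

/-- The element of the receiver set. -/
def rcv (x : Data) : ℕ := S.gpow x (S.g0 x) (S.del x)

/-- The device is tested on an honest ciphertext. -/
def trlR (x : Data) : ℕ :=
  S.trl x (S.gpow x (S.g0 x) (S.dig x 0)) (S.gpow x (S.rcv x) (S.dig x 0))
    (S.tpow x (S.pr x (S.g1 x) (S.g2 x)) (S.dig x 0)) (S.gtE x (S.dig x 1)) (S.dev x 0)

/-- The device is tested on a ciphertext of the tracing algorithm. -/
def trlP (x : Data) : ℕ :=
  S.trl x (S.gpow x (S.g0 x) (S.dig x 2)) (S.gpow x (S.rcv x) (S.dig x 2))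
    (S.gtE x (S.dig x 3)) (S.gtE x (S.dig x 4)) (S.dev x 1)

/-- The device is tested on the challenge. -/
def trlC (x : Data) : ℕ :=
  S.trl x (chH x) (S.gpow x (chH x) (S.del x))
    (S.tm x (chT x) (S.tpow x (S.pr x (S.g1 x) (chH x)) (S.gam x))) (S.gtE x (S.dig x 5))
    (S.dev x 2)

/-- The answer of the reduction. -/
def out (x : Data) : ℕ :=
  sel (S.flg x) 0 (sel (S.val x) 1 (sel (S.trlR x) 1 (sel (S.trlP x) 1 0 (S.trlC x))
    (sel (S.trlP x) 1 (1 - S.trlC x) 0)) 0) 0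

section

variable {x : Data → Data} {i a b c m w : Data → ℕ}

@[fun_prop] theorem polyNat_flg (hx : PolyFun x) : PolyNat fun e => S.flg (x e) := by
  unfold flg; fun_prop

@[fun_prop] theorem polyFun_fv (hx : PolyFun x) : PolyFun fun e => S.fv (x e) := by
  unfold fv; fun_prop

@[fun_prop] theorem polyFun_ky (hx : PolyFun x) : PolyFun fun e => S.ky (x e) := by
  unfold ky
  exact .run S.ppt.2.2.2.1 (by fun_prop)

@[fun_prop] theorem polyNat_ky1 (hx : PolyFun x) : PolyNat fun e => S.ky1 (x e) := by
  unfold ky1; fun_prop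

@[fun_prop] theorem polyNat_ky2 (hx : PolyFun x) : PolyNat fun e => S.ky2 (x e) := by
  unfold ky2; fun_prop

@[fun_prop] theorem polyNat_kyt (hx : PolyFun x) : PolyNat fun e => S.kyt (x e) := by
  unfold kyt; fun_prop

@[fun_prop] theorem polyNat_kyT (hx : PolyFun x) (hi : PolyNat i) :
    PolyNat fun e => S.kyT (x e) (i e) := by
  unfold kyT
  exact .toNat (.nth (by fun_prop) ((S.nn_bd.comp hx.size_bd).mono fun _ => min_le_right _ _)
    (by fun_prop))

@[fun_prop] theorem polyNat_badT (hx : PolyFun x) : PolyNat fun e => S.badT (x e) := by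
  unfold badT
  exact .sum (f := fun e i => AIBBE.sel (S.mem (x e) (S.kyT (x e) i)) 1 0 1) (by fun_prop)
    (by fun_prop) (S.nn_bd.comp hx.size_bd)

@[fun_prop] theorem polyNat_badV (hx : PolyFun x) : PolyNat fun e => S.badV (x e) := by
  unfold badV
  exact .sum (f := fun e i => AIBBE.sel (S.pr (x e) (S.g0 (x e)) (S.kyT (x e) i))
    (S.pr (x e) (S.ky2 (x e)) (S.gm (x e) (S.hh (x e) (i + 1))
      (S.gpow (x e) (S.hh (x e) i) (neg (x e) (S.ids (x e)))))) 0 1) (by fun_prop)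
    (by fun_prop) (S.nn_bd.comp hx.size_bd)

@[fun_prop] theorem polyNat_val (hx : PolyFun x) : PolyNat fun e => S.val (x e) := by
  unfold val; fun_prop

@[fun_prop] theorem polyNat_dec (hx : PolyFun x) (ha : PolyNat a) (hb : PolyNat b)
    (hc : PolyNat c) : PolyNat fun e => S.dec (x e) (a e) (b e) (c e) := by
  unfold dec; fun_prop

@[fun_prop] theorem polyNat_trl (hx : PolyFun x) (ha : PolyNat a) (hb : PolyNat b)
    (hc : PolyNat c) (hm : PolyNat m) (hw : PolyNat w) :
    PolyNat fun e => S.trl (x e) (a e) (b e) (c e) (m e) (w e) := by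
  unfold trl
  exact .sel (.toNat (.run S.ppt.2.2.2.2 (by fun_prop))) hm (by fun_prop) (by fun_prop)

@[fun_prop] theorem polyNat_gtE (hx : PolyFun x) (ha : PolyNat a) :
    PolyNat fun e => S.gtE (x e) (a e) := by unfold gtE; fun_prop

@[fun_prop] theorem polyNat_rcv (hx : PolyFun x) : PolyNat fun e => S.rcv (x e) := by
  unfold rcv; fun_prop

@[fun_prop] theorem polyNat_trlR (hx : PolyFun x) : PolyNat fun e => S.trlR (x e) := by
  unfold trlR; fun_prop

@[fun_prop] theorem polyNat_trlP (hx : PolyFun x) : PolyNat fun e => S.trlP (x e) := by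
  unfold trlP; fun_prop

@[fun_prop] theorem polyNat_trlC (hx : PolyFun x) : PolyNat fun e => S.trlC (x e) := by
  unfold trlC; fun_prop

theorem polyNat_out : PolyNat S.out := by
  unfold out; fun_prop

end

/-- The reduction as a program. -/
theorem exists_prog : ∃ P : Prog, P.PolyTime ∧ ∀ x, P.run x = .num (S.out x) := S.polyNat_out

end Sim

/-! ### Exponents modulo the group order -/

section Pw

variable {H : Type} [CommGroup H] {p : ℕ}

/-- Powers with exponents modulo the group order. -/
def pw (g : H) (z : ZMod p) : H := g ^ z.val

theorem mul_pw (g h : H) (a : ZMod p) : pw (g * h) a = pw g a * pw h a := mul_pow _ _ _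

variable [Fact p.Prime]

@[simp] theorem pw_zero (g : H) : pw g (0 : ZMod p) = 1 := by simp [pw]

@[simp] theorem pw_one (g : H) : pw g (1 : ZMod p) = g := by
  have : Fact (1 < p) := ⟨(Fact.out : p.Prime).one_lt⟩
  simp [pw, ZMod.val_one]

variable [Fintype H]

theorem pow_natCast_val (hc : Fintype.card H = p) (g : H) (n : ℕ) :
    g ^ n = pw g (n : ZMod p) := by
  rw [pw, ZMod.val_natCast, ← hc, pow_mod_card]

theorem pw_add (hc : Fintype.card H = p) (g : H) (a b : ZMod p) :
    pw g (a + b) = pw g a * pw g b := by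
  have h := pow_natCast_val hc g (a.val + b.val)
  rw [pow_add, Nat.cast_add, ZMod.natCast_zmod_val, ZMod.natCast_zmod_val] at h
  exact h.symm

theorem pw_mul (hc : Fintype.card H = p) (g : H) (a b : ZMod p) :
    pw g (a * b) = pw (pw g a) b := by
  have h := pow_natCast_val hc g (a.val * b.val)
  rw [pow_mul, Nat.cast_mul, ZMod.natCast_zmod_val, ZMod.natCast_zmod_val] at h
  exact h.symm

theorem pw_neg (hc : Fintype.card H = p) (g : H) (a : ZMod p) : pw g (-a) = (pw g a)⁻¹ := by
  rw [eq_inv_iff_mul_eq_one, ← pw_add hc]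
  simp

theorem pw_injective (hc : Fintype.card H = p) {g : H} (hg : g ≠ 1) :
    Function.Injective (pw g : ZMod p → H) := by
  have ho : orderOf g = p := by
    have h1 : orderOf g ∣ p := hc ▸ orderOf_dvd_card
    rcases (Nat.dvd_prime (Fact.out : p.Prime)).1 h1 with h | h
    · exact absurd (orderOf_eq_one_iff.1 h) hg
    · exact h
  intro a b hab
  have h2 := pow_injOn_Iio_orderOf (x := g) (by simpa [ho] using a.val_lt)
    (by simpa [ho] using b.val_lt) hab
  exact ZMod.val_injective p h2

theorem pw_bijective (hc : Fintype.card H = p) {g : H} (hg : g ≠ 1) :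
    Function.Bijective (pw g : ZMod p → H) :=
  (Fintype.bijective_iff_injective_and_card _).2 ⟨pw_injective hc hg, by rw [ZMod.card, hc]⟩

end Pw

namespace BilinearGroup

variable (B : BilinearGroup)

theorem e_pw (g h : B.G) (a b : ZMod B.p) : B.e (pw g a) (pw h b) = pw (B.e g h) (a * b) := by
  have h1 := B.bilinear g h a.val b.val
  rw [zpow_natCast, zpow_natCast, ← Nat.cast_mul, zpow_natCast] at h1
  rw [pw, pw, h1, pow_natCast_val B.card_GT]
  simp

theorem e_pw_left (g h : B.G) (a : ZMod B.p) : B.e (pw g a) h = pw (B.e g h) a := by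
  have := B.e_pw g h a 1
  rwa [pw_one, mul_one] at this

theorem e_pw_right (g h : B.G) (a : ZMod B.p) : B.e g (pw h a) = pw (B.e g h) a := by
  have := B.e_pw g h 1 a
  rwa [pw_one, one_mul] at this

theorem e_self_ne_one {g : B.G} (hg : g ≠ 1) : B.e g g ≠ 1 := B.nondegenerate g g hg hg

theorem readG_eq_some {d : Data} {x : B.G} : B.readG d = some x ↔ B.encG x = d.toNat :=
  B.encG_injective.isPartialInv _ _

theorem readG_eq_none {d : Data} : B.readG d = none ↔ d.toNat ∉ Set.range B.encG := by
  rw [Option.eq_none_iff_forall_ne_some]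
  simp [readG_eq_some]

end BilinearGroup

/-! ### Inputs of the reduction -/

/-- A challenge for the reduction. -/
structure Ctx (S : Sim) where
  i : S.𝒢.Idx
  κ : ℕ
  N : ℕ
  hN : 1 ≤ N
  hNq : N ≤ S.Nq.eval κ
  hi : i ∈ (S.𝒢.gen κ).support
  g : (S.𝒢.grp i).G
  hg : g ≠ 1
  α : (ZMod (S.𝒢.grp i).p)ˣ
  h : (S.𝒢.grp i).G
  T : (S.𝒢.grp i).GT
  ω : ℕ

namespace Ctx

variable {S : Sim} (C : Ctx S)

/-- The groups. -/
abbrev B : BilinearGroup := S.𝒢.grp C.i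

/-- The powers of the generator in the challenge. -/
def powers : List Data :=
  ((List.range (2 * (C.N + 1) + 1)).filter (fun i => i ≠ C.N + 1 + 1)).map
    fun i => C.B.dG (C.g ^ ((C.α : ZMod C.B.p) ^ i).val)

/-- The input of the reduction. -/
def x : Data := .pair (C.B.params C.κ) (.pair (.num (C.N + 1))
    (.pair (.ofList C.powers) (.pair (C.B.dG C.h) (.pair (C.B.dGT C.T) (.num C.ω)))))

theorem kap_x : Sim.kap C.x = C.κ := by
  simp [Sim.kap, x, BilinearGroup.params, Nat.size_pow]

theorem ord_x : Sim.ord C.x = C.B.p := by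
  simp only [Sim.ord, x, BilinearGroup.params, Data.fst_pair, Data.snd_pair, Data.toNat_num]
  exact Nat.succ_pred_prime C.B.prime.out

theorem desc_x : Sim.desc C.x = C.B.desc := rfl

theorem nn_x : S.nn C.x = C.N := by
  simp only [Sim.nn, kap_x]
  simp [x, C.hNq]

theorem chH_x : Sim.chH C.x = C.B.encG C.h := rfl

theorem chT_x : Sim.chT C.x = C.B.encGT C.T := rfl

theorem encG_lt (y : C.B.G) : C.B.encG y < S.bd C.x := by
  have h1 := S.𝒢.encG_size C.κ C.i C.hi y
  simp only [BilinearGroup.dG, Data.size] at h1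
  rw [Sim.bd, kap_x, ← Nat.size_le]
  exact le_trans (Nat.le_succ _) h1

theorem encGT_lt (y : C.B.GT) : C.B.encGT y < S.bd C.x := by
  have h1 := S.𝒢.encGT_size C.κ C.i C.hi y
  simp only [BilinearGroup.dGT, Data.size] at h1
  rw [Sim.bd, kap_x, ← Nat.size_le]
  exact le_trans (Nat.le_succ _) h1

/-- Encodings lie below `bd` by the size bound of the generator, so the truncation in `gm` has no
effect here. -/
theorem gm_x (y z : C.B.G) : S.gm C.x (C.B.encG y) (C.B.encG z) = C.B.encG (y * z) := by
  have := S.𝒢.mulG_run C.i y z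
  simp only [BilinearGroup.dG] at this
  rw [Sim.gm, desc_x, this]
  exact Nat.mod_eq_of_lt (C.encG_lt _)

theorem tm_x (y z : C.B.GT) : S.tm C.x (C.B.encGT y) (C.B.encGT z) = C.B.encGT (y * z) := by
  have := S.𝒢.mulGT_run C.i y z
  simp only [BilinearGroup.dGT] at this
  rw [Sim.tm, desc_x, this]
  exact Nat.mod_eq_of_lt (C.encGT_lt _)

theorem pr_x (y z : C.B.G) : S.pr C.x (C.B.encG y) (C.B.encG z) = C.B.encGT (C.B.e y z) := by
  have := S.𝒢.pairing_run C.i y z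
  simp only [BilinearGroup.dG, BilinearGroup.dGT] at this
  rw [Sim.pr, desc_x, this]
  rfl

theorem mem_x (n : ℕ) : S.mem C.x n = 1 ↔ n ∈ Set.range C.B.encG := by
  rw [Sim.mem, desc_x]
  constructor
  · intro h
    by_contra hn
    rw [S.𝒢.memG_run_notMem C.i n hn] at h
    simp at h
  · rintro ⟨y, rfl⟩
    have := S.𝒢.memG_run_mem C.i y
    rw [BilinearGroup.dG] at this
    rw [this]
    rfl

theorem gpow_x (y : C.B.G) (n : ℕ) :
    S.gpow C.x (C.B.encG y) n = C.B.encG (pw y (n : ZMod C.B.p)) := by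
  have h1 := powLoop_eq (fun a y => a = C.B.encG y) (op := S.gm C.x)
    (fun a b u v ha hb => by rw [ha, hb, gm_x]) (rfl : C.B.encG y = _) (n + (C.B.p - 1))
  -- Square and multiply gives an exponent that is too large by one; the shift by `p - 1` turns it
  -- into `n + p`, which acts as `n` in a group of order `p`.
  have h2 : n + (C.B.p - 1) + 1 = n + C.B.p := by
    have := C.B.prime.out.pos
    omega
  rw [Sim.gpow, ord_x, h1, Nat.mod_eq_of_lt (C.encG_lt _), h2, pow_natCast_val C.B.card_G]
  simp

theorem tpow_x (y : C.B.GT) (n : ℕ) :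
    S.tpow C.x (C.B.encGT y) n = C.B.encGT (pw y (n : ZMod C.B.p)) := by
  have h1 := powLoop_eq (fun a y => a = C.B.encGT y) (op := S.tm C.x)
    (fun a b u v ha hb => by rw [ha, hb, tm_x]) (rfl : C.B.encGT y = _) (n + (C.B.p - 1))
  have h2 : n + (C.B.p - 1) + 1 = n + C.B.p := by
    have := C.B.prime.out.pos
    omega
  rw [Sim.tpow, ord_x, h1, Nat.mod_eq_of_lt (C.encGT_lt _), h2, pow_natCast_val C.B.card_GT]
  simp

theorem inv_x (n : ℕ) : ((Sim.inv C.x n : ℕ) : ZMod C.B.p) = (n : ZMod C.B.p)⁻¹ := by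
  have h1 := powLoop_eq (fun a (y : ZMod C.B.p) => (a : ZMod C.B.p) = y)
    (op := fun a b => a * b % C.B.p) (fun a b u v ha hb => by simp [ha, hb])
    (rfl : (n : ZMod C.B.p) = _) (2 * C.B.p - 4)
  rw [Sim.inv, ord_x, h1]
  have h2 := C.B.prime.out.two_le
  by_cases h : (n : ZMod C.B.p) = 0
  · rw [h]
    simp
  · refine eq_inv_of_mul_eq_one_left ?_
    -- By Fermat, the power `2p - 3` inverts. The number `2p - 4` is free of truncation for every
    -- prime, including `2`.
    rw [← pow_succ, show 2 * C.B.p - 4 + 1 + 1 = (C.B.p - 1) * 2 by omega, pow_mul,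
      ZMod.pow_card_sub_one_eq_one h, one_pow]

theorem neg_x (n : ℕ) : ((Sim.neg C.x n : ℕ) : ZMod C.B.p) = -(n : ZMod C.B.p) := by
  rw [Sim.neg, ord_x, Nat.cast_mul, Nat.cast_sub C.B.prime.out.one_le]
  simp

theorem filter_range (n k : ℕ) (hk : k < n) : (List.range n).filter (fun i => i ≠ k) =
    List.range k ++ (List.range (n - k - 1)).map (fun i => k + 1 + i) := by
  obtain ⟨m, rfl⟩ : ∃ m, n = k + (m + 1) := ⟨n - k - 1, by omega⟩
  rw [List.range_add, List.filter_append, List.range_succ_eq_map]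
  have h1 : (List.range k).filter (fun i => decide (i ≠ k)) = List.range k := by
    rw [List.filter_eq_self]
    intro a ha
    have := List.mem_range.1 ha
    simp
    omega
  rw [h1]
  simp only [List.map_cons, List.map_map, add_zero]
  rw [List.filter_cons_of_neg (by simp), List.filter_eq_self.2 (by simp)]
  simp only [Function.comp_def, show k + (m + 1) - k - 1 = m by omega]
  congr 2
  funext i
  simp only [Nat.succ_eq_add_one]
  omega

theorem nth_ofList (l : List Data) (k : ℕ) : (Data.ofList l).nth k = l.getD k (.num 0) := by
  induction l generalizing k with
  | nil =>
    have : ∀ k, Data.nth k (.num 0) = .num 0 := by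
      intro k
      induction k with
      | zero => rfl
      | succ k ih => exact ih
    simpa [Data.ofList] using this k
  | cons a l ih =>
    cases k with
    | zero => rfl
    | succ k => simpa [Data.ofList, Data.nth] using ih k

/-- The exponent `α`. -/
abbrev a : ZMod C.B.p := C.α

/-- The list omits the exponent `N + 2`, so later entries sit one place earlier. The two hypotheses
describe exactly the available powers; discharging them at each use checks that the reduction never
needs the missing one. -/
theorem yy_x (j : ℕ) (hj : j ≠ C.N + 2) (hj' : j ≤ 2 * C.N + 2) :
    S.yy C.x j = C.B.encG (pw C.g (C.a ^ j)) := by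
  have e : C.x.snd.snd.fst = .ofList C.powers := rfl
  rw [Sim.yy, nn_x, e, nth_ofList, powers, filter_range _ _ (by omega)]
  by_cases h : j ≤ C.N + 1
  · rw [sel_pos (by omega), min_eq_left (by omega)]
    rw [List.getD_eq_getElem _ _ (by simp; omega), List.getElem_map,
      List.getElem_append_left (by simp; omega), List.getElem_range]
    rfl
  · rw [sel_neg (by omega), min_eq_left (by omega)]
    rw [List.getD_eq_getElem _ _ (by simp; omega), List.getElem_map,
      List.getElem_append_right (by simp; omega), List.getElem_map, List.getElem_range,
      List.length_range]
    rw [show C.N + 1 + 1 + 1 + (j - 1 - (C.N + 1 + 1)) = j by omega]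
    rfl

end Ctx

theorem tab_eq_ofFn (f : ℕ → Data) (n : ℕ) : tab f n = .ofList (List.ofFn fun i : Fin n => f i) := by
  rw [tab]
  congr 1
  apply List.ext_getElem <;> simp

/-- The blinded key for given randomness. -/
def mkKey {B : BilinearGroup} {N : ℕ} (pk : PublicKey B N) (α : (ZMod B.p)ˣ) (ID : ZMod B.p)
    (R : B.G) (r t₁ : ZMod B.p) : Key B N where
  K₁ := pw (pw pk.g₂ t₁ * R * pk.g₃) (α : ZMod B.p) * pw pk.z r
  K₂ := pw pk.g r
  T := fun i => pw (pk.h i.succ) r * pw (pk.h i.castSucc) (-ID * r)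
  t := t₁

/-! ### The public key of the reduction -/

namespace Ctx

variable {S : Sim} (C : Ctx S)

theorem gm_pw (y : C.B.G) (u v : ZMod C.B.p) :
    S.gm C.x (C.B.encG (pw y u)) (C.B.encG (pw y v)) = C.B.encG (pw y (u + v)) := by
  rw [gm_x, pw_add C.B.card_G]

theorem gpow_pw (y : C.B.G) (u : ZMod C.B.p) (n : ℕ) :
    S.gpow C.x (C.B.encG (pw y u)) n = C.B.encG (pw y (u * (n : ZMod C.B.p))) := by
  rw [gpow_x, pw_mul C.B.card_G]

/-- The known part of the exponent of `g₂`. -/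
def γ : ZMod C.B.p := (S.gam C.x : ℕ)

/-- The known part of the exponent of `g₃`. -/
def θ : ZMod C.B.p := (S.tht C.x : ℕ)

/-- The last component of the key for the target identity. -/
def ts : ZMod C.B.p := (S.tst C.x : ℕ)

/-- The known part of the exponent of `z`. -/
def δ : ZMod C.B.p := (S.del C.x : ℕ)

/-- The known parts of the exponents of the elements `h_i`. -/
def b (i : ℕ) : ZMod C.B.p := (S.bb C.x i : ℕ)

/-- The input of the user. -/
def init : Data := .pair (C.B.params C.κ) (.pair (.num C.N) (.num (S.rho C.x)))

/-- The target identity. -/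
def ID : ZMod C.B.p := C.B.readZ (S.A.choose.run C.init)

/-- The exponents of the elements `h_i`. -/
def ah (i : ℕ) : ZMod C.B.p := C.b i + C.a ^ (C.N + 1 - i)

/-- The exponent of `z`. -/
def az : ZMod C.B.p := C.δ + C.ID * C.ah 0 - C.ah 1

/-- The exponent of `g₂`. -/
def a2 : ZMod C.B.p := C.a ^ (C.N + 1) + C.γ

/-- The public key. -/
def pk : PublicKey C.B C.N where
  g := C.g
  g₁ := pw C.g C.a
  g₂ := pw C.g C.a2
  g₃ := pw C.g (C.θ - C.ts * C.a2)
  z := pw C.g C.az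
  h := fun i => pw C.g (C.ah i)

theorem g0_x : S.g0 C.x = C.B.encG (pw C.g (1 : ZMod C.B.p)) := by
  rw [Sim.g0, yy_x _ _ (by omega) (by omega), pow_zero]

theorem g1_x : S.g1 C.x = C.B.encG (pw C.g C.a) := by
  rw [Sim.g1, yy_x _ _ (by have := C.hN; omega) (by omega), pow_one]

theorem g2_x : S.g2 C.x = C.B.encG (pw C.g C.a2) := by
  rw [Sim.g2, nn_x, yy_x _ _ (by omega) (by omega), g0_x, gpow_pw, gm_pw, one_mul]
  rfl

theorem g3_x : S.g3 C.x = C.B.encG (pw C.g (C.θ - C.ts * C.a2)) := by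
  rw [Sim.g3, g2_x, g0_x, gpow_pw, gpow_pw, gm_pw, one_mul, neg_x]
  congr 2
  rw [θ, ts]
  ring

theorem hh_x (i : ℕ) : S.hh C.x i = C.B.encG (pw C.g (C.ah i)) := by
  rw [Sim.hh, nn_x, yy_x _ _ (by omega) (by omega), g0_x, gpow_pw, gm_pw, one_mul]
  rfl

theorem ini_x : S.ini C.x = C.init := by
  rw [Sim.ini, nn_x]
  rfl

theorem ids_x : S.ids C.x = C.ID.val := by
  rw [Sim.ids, ini_x, ord_x, ID, BilinearGroup.readZ, ZMod.val_natCast]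

theorem ids_cast : ((S.ids C.x : ℕ) : ZMod C.B.p) = C.ID := by
  rw [ids_x, ZMod.natCast_zmod_val]

theorem zz_x : S.zz C.x = C.B.encG (pw C.g C.az) := by
  rw [Sim.zz, hh_x, hh_x, g0_x, gpow_pw, gpow_pw, gpow_pw, gm_pw, gm_pw, neg_x, ids_cast]
  congr 2
  simp only [az, δ]
  push_cast
  ring

theorem pkD_x : S.pkD C.x = C.pk.toData := by
  rw [Sim.pkD, PublicKey.toData, g0_x, g1_x, g2_x, g3_x, zz_x, nn_x, tab_eq_ofFn]
  simp only [hh_x, pw_one]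
  rfl

theorem vw_x (ans : List Data) : S.vw C.x (.ofList ans) = view C.init C.pk ans := by
  rw [Sim.vw, pkD_x, ini_x]
  rfl

/-! ### The simulated keys -/

/-- The shift of the randomness of a key. -/
def Q (ID : ZMod C.B.p) : ZMod C.B.p := ∑ j ∈ Finset.range (C.N + 1), C.a ^ (j + 1) * ID ^ j

theorem prodK_x (n : ℕ) : S.prodK C.x n = C.B.encG (pw C.g (C.Q n)) := by
  rw [Sim.prodK, nn_x, g0_x, gpow_pw, Q]
  have : ∀ k ≤ C.N + 1, iter (fun j a => S.gm C.x a
      (S.gpow C.x (S.yy C.x (j + 1)) (S.idp C.x n j))) (C.B.encG (pw C.g (1 * ((0 : ℕ) : ZMod C.B.p)))) k =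
      C.B.encG (pw C.g (∑ j ∈ Finset.range k, C.a ^ (j + 1) * (n : ZMod C.B.p) ^ j)) := by
    intro k hk
    induction k with
    | zero => simp [iter]
    | succ k ih =>
      rw [iter, ih (by omega), yy_x _ _ (by omega) (by omega), gpow_pw, gm_pw,
        Finset.sum_range_succ, Sim.idp, nn_x, min_eq_left (by omega), Nat.cast_pow]
  exact this _ le_rfl

theorem prodL_x (n : ℕ) : S.prodL C.x n = C.B.encG (pw C.g
    (∑ j ∈ Finset.range C.N, C.a ^ (j + C.N + 3) * (n : ZMod C.B.p) ^ (j + 1))) := by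
  rw [Sim.prodL, nn_x, g0_x, gpow_pw]
  have : ∀ k ≤ C.N, iter (fun j a => S.gm C.x a
      (S.gpow C.x (S.yy C.x (j + C.N + 3)) (S.idp C.x n (j + 1))))
        (C.B.encG (pw C.g (1 * ((0 : ℕ) : ZMod C.B.p)))) k =
      C.B.encG (pw C.g (∑ j ∈ Finset.range k, C.a ^ (j + C.N + 3) *
        (n : ZMod C.B.p) ^ (j + 1))) := by
    intro k hk
    induction k with
    | zero => simp [iter]
    | succ k ih =>
      rw [iter, ih (by omega), yy_x _ _ (by omega) (by omega), gpow_pw, gm_pw,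
        Finset.sum_range_succ, Sim.idp, nn_x, min_eq_left (by omega), Nat.cast_pow]
  exact this _ le_rfl

/-- `Q` is a geometric sum of ratio `ID * α`, and the other factor is `α ^ m` times `1 - ID * α`, so
only the end terms survive. For `1 ≤ m ≤ N` neither of their exponents `m + 1` and `N + 2 + m` is
the missing `N + 2`. -/
theorem Q_telescope (ID : ZMod C.B.p) (m : ℕ) : C.Q ID * (C.a ^ m - ID * C.a ^ (m + 1)) =
    C.a ^ (m + 1) - ID ^ (C.N + 1) * C.a ^ (C.N + 2 + m) := by
  have h := Finset.sum_range_sub' (fun j => C.a ^ (j + 1 + m) * ID ^ j) (C.N + 1)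
  rw [Q, Finset.sum_mul]
  calc _ = ∑ j ∈ Finset.range (C.N + 1), (C.a ^ (j + 1 + m) * ID ^ j -
        C.a ^ (j + 1 + 1 + m) * ID ^ (j + 1)) := Finset.sum_congr rfl fun j _ => by ring
    _ = _ := by rw [h]; ring

theorem kk2_x (n r τ : ℕ) : S.kk2 C.x n r τ = C.B.encG (pw C.g ((r : ZMod C.B.p) + C.Q n * (τ : ZMod C.B.p))) := by
  rw [Sim.kk2, g0_x, prodK_x, gpow_pw, gpow_pw, gm_pw, one_mul]

/-- The shifted part telescopes with `m = N - i`, and `i < N` ensures `m ≥ 1`. This works for every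
`τ`, so no relation with `dt` is required here. -/
theorem kkT_x (n r τ i : ℕ) (hi : i < C.N) : S.kkT C.x n r τ i =
    C.B.encG (pw C.g (((r : ZMod C.B.p) + C.Q n * (τ : ZMod C.B.p)) *
      (C.ah (i + 1) - (n : ZMod C.B.p) * C.ah i))) := by
  rw [Sim.kkT, kk2_x, nn_x, yy_x _ _ (by omega) (by omega), yy_x _ _ (by omega) (by omega),
    yy_x _ _ (by omega) (by omega)]
  simp only [gpow_pw, gm_pw, Nat.cast_add, neg_x, Sim.idp, nn_x, min_self, Nat.cast_pow,
    Nat.cast_mul]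
  congr 2
  have h := C.Q_telescope n (C.N - i)
  obtain ⟨m, hm⟩ : ∃ m, C.N = i + m := ⟨C.N - i, by omega⟩
  simp only [ah, b]
  rw [show C.N + 1 - (i + 1) = m by omega, show C.N + 1 - i = m + 1 by omega,
    show 2 * C.N + 2 - i = C.N + 2 + m by omega, show C.N - i = m by omega] at *
  linear_combination (-(τ : ZMod C.B.p)) * h

/-- The forbidden term `dt * α ^ (N + 2)` comes from the factor `α * a2 * dt`. The unknown part `ID*
* α ^ (N + 1) - α ^ N` of the exponent of `z` is `-(α ^ N - ID * α ^ (N + 1)) - (ID - ID*) * α ^ (N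
+ 1)`. Multiplied by `Q * τ`, the first summand telescopes, while the second becomes `-dt * Q * α ^
(N + 1)`, whose lowest term is the required cancellation. Its other terms have exponents `N + 3` to
`2 * N + 2` and are supplied by `prodL`. -/
theorem kk1_x (n r τ dt θ : ℕ) (hτ : (τ : ZMod C.B.p) * (n - C.ID) = dt) :
    S.kk1 C.x n r τ dt θ = C.B.encG (pw C.g
      (C.a * (C.a2 * (dt : ZMod C.B.p) + (θ : ZMod C.B.p) + C.θ) +
        ((r : ZMod C.B.p) + C.Q n * (τ : ZMod C.B.p)) * C.az)) := by
  have hN := C.hN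
  rw [Sim.kk1, kk2_x, nn_x, yy_x _ _ (by omega) (by omega), yy_x _ _ (by omega) (by omega),
    yy_x _ _ (by omega) (by omega), g1_x, prodL_x]
  simp only [gpow_pw, gm_pw, Nat.cast_add, neg_x, Sim.idp, nn_x, min_self, Nat.cast_pow,
    Nat.cast_mul, ids_cast, Nat.cast_one]
  congr 2
  have h := C.Q_telescope n C.N
  have hQ : C.Q n * C.a ^ (C.N + 1) = C.a ^ (C.N + 2) +
      ∑ j ∈ Finset.range C.N, C.a ^ (j + C.N + 3) * (n : ZMod C.B.p) ^ (j + 1) := by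
    rw [Q, Finset.sum_range_succ', add_mul, Finset.sum_mul, add_comm]
    congr 1
    · ring
    · exact Finset.sum_congr rfl fun j _ => by ring
  simp only [az, ah, a2, b, Ctx.θ, γ, δ]
  rw [show C.N + 1 - 0 = C.N + 1 by omega, show C.N + 1 - 1 = C.N by omega,
    show 2 * C.N + 2 = C.N + 2 + C.N by omega]
  generalize (∑ j ∈ Finset.range C.N, C.a ^ (j + C.N + 3) * (n : ZMod C.B.p) ^ (j + 1)) = L at *
  generalize C.Q n = Qn at *
  rw [← hτ]
  linear_combination (τ : ZMod C.B.p) * h + (τ : ZMod C.B.p) * (n - C.ID) * hQ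

/-- The relation between `nτ` and `ndt` covers both kinds of identities: for the target it forces
`ndt` to vanish modulo the order, for any other it determines `nτ`. The pair `(t₀, θ')` enters the
key only through the commitment and `ndt`, so any representation of the commitment yields the key
that the authority would send. -/
theorem keyD_x (ID t₀ θ' r t₁ : ZMod C.B.p) (nr nτ ndt nθ : ℕ)
    (hr : (nr : ZMod C.B.p) + C.Q ID * nτ = r) (hdt : (ndt : ZMod C.B.p) = t₀ + t₁ - C.ts)
    (hθ : (nθ : ZMod C.B.p) = θ') (hτ : (nτ : ZMod C.B.p) * (ID - C.ID) = ndt) :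
    S.keyD C.x ID.val nr nτ ndt nθ t₁.val =
      (mkKey C.pk C.α ID (pw C.pk.g₂ t₀ * pw C.pk.g θ') r t₁).toData := by
  have e1 : ((ID.val : ℕ) : ZMod C.B.p) = ID := ZMod.natCast_zmod_val ID
  rw [Sim.keyD, kk1_x _ _ _ _ _ _ (by rwa [e1]), kk2_x, Key.toData, nn_x, tab_eq_ofFn, e1, hr, hθ,
    hdt]
  have e2 (i : Fin C.N) : S.kkT C.x ID.val nr nτ i =
      C.B.encG (pw C.g (r * (C.ah (i + 1) - ID * C.ah i))) := by
    rw [kkT_x _ _ _ _ _ i.2, e1, hr]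
  simp only [e2, mkKey, pk, BilinearGroup.dG, BilinearGroup.dZ, ← pw_mul C.B.card_G,
    ← pw_add C.B.card_G, Fin.val_succ, Fin.val_castSucc]
  congr 4
  · ring
  · congr 2
    funext i
    congr 3
    ring

end Ctx

open Classical in
/-- The last number `k ≤ K` such that `c + k` satisfies `P` (`0` if there is none). -/
noncomputable def found {p : ℕ} (P : ZMod p → Prop) (c : ZMod p) (K : ℕ) : ℕ :=
  iter (fun i a => if P (c + ((i + 1 : ℕ) : ZMod p)) then i + 1 else a) 0 K

open Classical in
-- Searching consecutive challenges instead of random ones makes the search deterministic, so that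
-- its failures can be counted over `c` alone.
theorem found_spec {p : ℕ} (P : ZMod p → Prop) (c : ZMod p) (K : ℕ) :
    (found P c K = 0 ∧ ∀ k, 1 ≤ k → k ≤ K → ¬ P (c + (k : ZMod p))) ∨
      (1 ≤ found P c K ∧ found P c K ≤ K ∧ P (c + (found P c K : ZMod p))) := by
  induction K with
  | zero => exact .inl ⟨rfl, fun k h1 h2 => by omega⟩
  | succ K ih =>
    have e : found P c (K + 1) = if P (c + ((K + 1 : ℕ) : ZMod p)) then K + 1 else found P c K := rfl
    rw [e]
    split_ifs with h
    · exact .inr ⟨by omega, le_rfl, h⟩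
    · rcases ih with ⟨h1, h2⟩ | ⟨h1, h2, h3⟩
      · refine .inl ⟨h1, fun k hk hk' => ?_⟩
        rcases Nat.lt_or_ge K k with hlt | hge
        · rwa [show k = K + 1 by omega]
        · exact h2 k hk hge
      · exact .inr ⟨h1, by omega, h3⟩

/-! ### Key generation with explicit randomness -/

section Typed

variable {B : BilinearGroup} {N : ℕ} (A : DishonestUser) (init : Data) (pk : PublicKey B N)

/-- The first message of a key generation protocol. -/
def firstMsg (ans : List Data) : Data := A.commit.run (view init pk ans)

/-- The identity for which a key is requested. -/
def reqID (ans : List Data) : ZMod B.p := B.readZ (firstMsg A init pk ans).fst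

/-- The commitment. -/
noncomputable def reqR (ans : List Data) : B.G := (B.readG (firstMsg A init pk ans).snd.fst).getD 1

/-- The group element that starts the proof of knowledge. -/
noncomputable def reqW (ans : List Data) : B.G := (B.readG (firstMsg A init pk ans).snd.snd).getD 1

/-- The response to a challenge. -/
def reply (ans : List Data) (c : ZMod B.p) : Data :=
  A.respond.run (.pair (view init pk ans) (B.dZ c))

/-- The first component of the response. -/
def replyU (ans : List Data) (c : ZMod B.p) : ZMod B.p := B.readZ (reply A init pk ans c).fst

/-- The second component of the response. -/
def replyV (ans : List Data) (c : ZMod B.p) : ZMod B.p := B.readZ (reply A init pk ans c).snd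

/-- The response to the challenge is correct. -/
def Correct (ans : List Data) (c : ZMod B.p) : Prop :=
  pw pk.g₂ (replyU A init pk ans c) * pw pk.g (replyV A init pk ans c) =
    reqW A init pk ans * pw (reqR A init pk ans) c

/-- The request consists of group elements and is for a new identity. -/
def Fresh (st : List Data × List (ZMod B.p)) : Prop :=
  B.readG (firstMsg A init pk st.1).snd.fst ≠ none ∧
    B.readG (firstMsg A init pk st.1).snd.snd ≠ none ∧ reqID A init pk st.1 ∉ st.2

open Classical in
-- All reasons for refusal lead to the same state, so the nested matches collapse to one case
-- distinction. The default values `1` in `reqR` and `reqW` never matter, because `Fresh` demands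
-- that both messages are group elements.
theorem session_eq (α : (ZMod B.p)ˣ) (st : List Data × List (ZMod B.p)) :
    session A init pk α st = (unif (ZMod B.p)).bind fun c =>
      if Fresh A init pk st ∧ Correct A init pk st.1 c then
        (unif (ZMod B.p)ˣ).bind fun r => (unif (ZMod B.p)ˣ).bind fun t₁ =>
          PMF.pure (.pair (B.dZ c) (mkKey pk α (reqID A init pk st.1) (reqR A init pk st.1) r
            t₁).toData :: st.1, reqID A init pk st.1 :: st.2)
      else PMF.pure (.pair (B.dZ c) (.num 0) :: st.1, st.2) := by
  unfold session
  change PMF.bind _ _ = _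
  congr 1
  funext c
  rcases hR : B.readG (firstMsg A init pk st.1).snd.fst with _ | R
  · have h1 : ¬ (Fresh A init pk st ∧ Correct A init pk st.1 c) := fun h => h.1.1 hR
    rw [if_neg h1]
    simp only [firstMsg] at hR
    simp only [hR]
    rfl
  rcases hW : B.readG (firstMsg A init pk st.1).snd.snd with _ | W
  · have h1 : ¬ (Fresh A init pk st ∧ Correct A init pk st.1 c) := fun h => h.1.2.1 hW
    rw [if_neg h1]
    simp only [firstMsg] at hR hW
    simp only [hR, hW]
    rfl
  have e : (reqID A init pk st.1 ∉ st.2 ∧ pk.g₂ ^ (replyU A init pk st.1 c).val *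
      pk.g ^ (replyV A init pk st.1 c).val = W * R ^ c.val) ↔
      (Fresh A init pk st ∧ Correct A init pk st.1 c) := by
    rw [Fresh, Correct, reqR, reqW, hR, hW]
    simp [pw]
  have eR : reqR A init pk st.1 = R := by rw [reqR, hR]; rfl
  by_cases h : Fresh A init pk st ∧ Correct A init pk st.1 c
  · have h' := e.2 h
    rw [if_pos h, eR]
    simp only [firstMsg] at hR hW
    simp only [hR, hW]
    unfold reqID replyU replyV reply firstMsg at h'
    rw [if_pos h', issueKey]
    change PMF.bind (PMF.bind _ _) _ = _
    rw [PMF.bind_bind]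
    congr 1
    funext r
    change PMF.bind (PMF.bind _ _) _ = _
    rw [PMF.bind_bind]
    congr 1
    funext t
    change PMF.bind (PMF.pure _) _ = _
    rw [PMF.pure_bind]
    rfl
  · have h' := fun h'' => h (e.1 h'')
    rw [if_neg h]
    simp only [firstMsg] at hR hW
    simp only [hR, hW]
    unfold reqID replyU replyV reply firstMsg at h'
    rw [if_neg h']
    rfl

/-- The extracted exponent of `g₂`. -/
def extT (ans : List Data) (c : ZMod B.p) (k : ℕ) : ZMod B.p :=
  (replyU A init pk ans (c + k) - replyU A init pk ans c) * (k : ZMod B.p)⁻¹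

/-- The extracted exponent of `g`. -/
def extΘ (ans : List Data) (c : ZMod B.p) (k : ℕ) : ZMod B.p :=
  (replyV A init pk ans (c + k) - replyV A init pk ans c) * (k : ZMod B.p)⁻¹

/-- Special soundness: dividing the two verification equations eliminates `W` and leaves `R ^ k`,
and `k` is invertible modulo the order. -/
theorem extract {ans : List Data} {c : ZMod B.p} {k : ℕ} (hk : (k : ZMod B.p) ≠ 0)
    (h : Correct A init pk ans c) (h' : Correct A init pk ans (c + k)) :
    pw pk.g₂ (extT A init pk ans c k) * pw pk.g (extΘ A init pk ans c k) = reqR A init pk ans := by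
  have h1 : pw pk.g₂ (replyU A init pk ans (c + k) - replyU A init pk ans c) *
      pw pk.g (replyV A init pk ans (c + k) - replyV A init pk ans c) =
      pw (reqR A init pk ans) (k : ZMod B.p) := by
    unfold Correct at h h'
    rw [sub_eq_add_neg, sub_eq_add_neg, pw_add B.card_G, pw_add B.card_G, pw_neg B.card_G,
      pw_neg B.card_G, mul_mul_mul_comm, h', ← mul_inv, h, pw_add B.card_G, mul_inv_eq_iff_eq_mul]
    ac_rfl
  rw [extT, extΘ, pw_mul B.card_G, pw_mul B.card_G, ← mul_pw, h1, ← pw_mul B.card_G,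
    mul_inv_cancel₀ hk, pw_one]

/-- The challenges with correct responses that the simulator finds by rewinding. -/
noncomputable def rewind (K : ℕ) (ans : List Data) (c : ZMod B.p) : ℕ :=
  found (Correct A init pk ans) c K

/-- The authority's contribution to the last component of a simulated key. -/
noncomputable def simT (K : ℕ) (ID₀ ts : ZMod B.p) (ans : List Data) (c s : ZMod B.p) : ZMod B.p :=
  if reqID A init pk ans = ID₀ then ts - extT A init pk ans c (rewind A init pk K ans c) else s

/-- The randomness of a simulated key. -/
noncomputable def simR (K : ℕ) (sh : ZMod B.p → ZMod B.p) (ID₀ ts : ZMod B.p) (ans : List Data)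
    (c r s : ZMod B.p) : ZMod B.p :=
  r + sh (reqID A init pk ans) * ((extT A init pk ans c (rewind A init pk K ans c) +
    simT A init pk K ID₀ ts ans c s - ts) * (reqID A init pk ans - ID₀)⁻¹)

open Classical in
/-- A simulated key generation protocol with challenge `c` and randomness `r`, `s`.  The state
consists of a flag for failure, the answers, and the identities that were given keys. -/
noncomputable def simStep (α : (ZMod B.p)ˣ) (K : ℕ) (sh : ZMod B.p → ZMod B.p) (ID₀ ts : ZMod B.p)
    (st : Bool × List Data × List (ZMod B.p)) (c r s : ZMod B.p) :
    Bool × List Data × List (ZMod B.p) :=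
  if Fresh A init pk st.2 ∧ Correct A init pk st.2.1 c then
    if rewind A init pk K st.2.1 c = 0 then (true, .pair (B.dZ c) (.num 0) :: st.2.1, st.2.2)
    else (st.1, .pair (B.dZ c) (mkKey pk α (reqID A init pk st.2.1) (reqR A init pk st.2.1)
      (simR A init pk K sh ID₀ ts st.2.1 c r s) (simT A init pk K ID₀ ts st.2.1 c s)).toData ::
        st.2.1, reqID A init pk st.2.1 :: st.2.2)
  else (st.1, .pair (B.dZ c) (.num 0) :: st.2.1, st.2.2)

/-- A number of simulated key generation protocols, with randomness from a tape. -/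
noncomputable def simRun (α : (ZMod B.p)ˣ) (K : ℕ) (sh : ZMod B.p → ZMod B.p) (ID₀ ts : ZMod B.p) :
    ℕ → Bool × List Data × List (ZMod B.p) → ℕ → Bool × List Data × List (ZMod B.p)
  | 0, st, _ => st
  | n + 1, st, w => simRun α K sh ID₀ ts n (simStep A init pk α K sh ID₀ ts st w (w / B.p : ℕ)
      (w / B.p / B.p : ℕ)) (w / B.p / B.p / B.p)

end Typed

/-! ### The program carries out the simulated key generation -/

namespace Ctx

variable {S : Sim} (C : Ctx S)

/-- A state of the program. -/
def encSt (w : ℕ) (st : Bool × List Data × List (ZMod C.B.p)) : Data :=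
  .pair (.num w) (.pair (.num (if st.1 then 1 else 0)) (.pair (.ofList st.2.1)
    (.ofList (st.2.2.map fun z => .num (z.val + 1)))))

section

variable (ans : List Data)

theorem fm_x : S.fm C.x (.ofList ans) = firstMsg S.A C.init C.pk ans := by
  rw [Sim.fm, vw_x]; rfl

theorem qID_x : S.qID C.x (.ofList ans) = (reqID S.A C.init C.pk ans).val := by
  rw [Sim.qID, fm_x, ord_x, reqID, BilinearGroup.readZ, ZMod.val_natCast]

theorem rsp_x (c : ZMod C.B.p) : S.rsp C.x (.ofList ans) c.val = reply S.A C.init C.pk ans c := by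
  rw [Sim.rsp, vw_x]; rfl

theorem mem_qR : S.mem C.x (S.qR C.x (.ofList ans)) = 1 ↔
    C.B.readG (firstMsg S.A C.init C.pk ans).snd.fst ≠ none := by
  rw [mem_x, Sim.qR, fm_x, Ne, BilinearGroup.readG_eq_none, not_not]

theorem mem_qW : S.mem C.x (S.qW C.x (.ofList ans)) = 1 ↔
    C.B.readG (firstMsg S.A C.init C.pk ans).snd.snd ≠ none := by
  rw [mem_x, Sim.qW, fm_x, Ne, BilinearGroup.readG_eq_none, not_not]

theorem qR_x (h : S.mem C.x (S.qR C.x (.ofList ans)) = 1) :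
    S.qR C.x (.ofList ans) = C.B.encG (reqR S.A C.init C.pk ans) := by
  rw [mem_qR] at h
  obtain ⟨y, hy⟩ := Option.ne_none_iff_exists'.1 h
  rw [reqR, hy, Sim.qR, fm_x]
  exact (C.B.readG_eq_some.1 hy).symm

theorem qW_x (h : S.mem C.x (S.qW C.x (.ofList ans)) = 1) :
    S.qW C.x (.ofList ans) = C.B.encG (reqW S.A C.init C.pk ans) := by
  rw [mem_qW] at h
  obtain ⟨y, hy⟩ := Option.ne_none_iff_exists'.1 h
  rw [reqW, hy, Sim.qW, fm_x]
  exact (C.B.readG_eq_some.1 hy).symm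

theorem chk_x (h : S.mem C.x (S.qR C.x (.ofList ans)) = 1)
    (h' : S.mem C.x (S.qW C.x (.ofList ans)) = 1) (c : ZMod C.B.p) :
    S.chk C.x (.ofList ans) c.val = 1 ↔ Correct S.A C.init C.pk ans c := by
  rw [Sim.chk, rsp_x, qR_x _ _ h, qW_x _ _ h', g2_x, g0_x, gpow_x, gpow_x, gpow_x, gm_x, gm_x,
    pw_one, ZMod.natCast_zmod_val]
  by_cases h1 : Correct S.A C.init C.pk ans c
  · exact iff_of_true (sel_pos (congrArg _ h1)) h1
  · refine iff_of_false (fun h3 => ?_) h1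
    have h2 := fun h2 => h1 (C.B.encG_injective h2)
    exact absurd ((sel_neg h2).symm.trans h3) (by simp)

/-- Identities are stored as `val + 1`, because reading past the end of a list returns `0`, which
must not pass for the identity `0`. The bound on the length is needed since only as many entries are
inspected as there are protocols. -/
theorem occ_x (l : List (ZMod C.B.p)) (hl : l.length ≤ S.A.queries.eval C.κ) (ID : ZMod C.B.p) :
    S.occ C.x (.ofList (l.map fun z => .num (z.val + 1))) ID.val = 0 ↔ ID ∉ l := by
  rw [Sim.occ, Finset.sum_eq_zero_iff, Sim.qq, kap_x]
  have h (j : ℕ) : ((Data.ofList (l.map fun z => .num (z.val + 1))).nth j).toNat = ID.val + 1 ↔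
      l[j]? = some ID := by
    rw [nth_ofList, List.getD_eq_getElem?_getD, List.getElem?_map]
    rcases l[j]? with _ | z
    · simp
    · simp [(ZMod.val_injective C.B.p).eq_iff]
  constructor
  · intro h1 hID
    obtain ⟨j, hj⟩ := List.mem_iff_getElem?.1 hID
    have hj' : j < l.length := by
      by_contra hn
      rw [List.getElem?_eq_none (by omega)] at hj
      simp at hj
    have h2 := h1 j (Finset.mem_range.2 (by omega))
    rw [min_eq_left (by omega), sel_pos ((h j).2 hj)] at h2
    omega
  · intro hID j hj
    have hj' := Finset.mem_range.1 hj
    rw [min_eq_left (by omega), sel_neg]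
    intro h2
    exact hID (List.mem_iff_getElem?.2 ⟨j, (h j).1 h2⟩)

theorem acc_x (l : List (ZMod C.B.p)) (hl : l.length ≤ S.A.queries.eval C.κ) (c : ZMod C.B.p) :
    S.acc C.x (.ofList ans) (.ofList (l.map fun z => .num (z.val + 1))) c.val = 1 ↔
      Fresh S.A C.init C.pk (ans, l) ∧ Correct S.A C.init C.pk ans c := by
  rw [Sim.acc, Fresh, ← mem_qR, ← mem_qW, qID_x, ← occ_x C l hl]
  by_cases h1 : S.mem C.x (S.qR C.x (.ofList ans)) = 1
  · by_cases h2 : S.mem C.x (S.qW C.x (.ofList ans)) = 1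
    · rw [sel_pos h1, sel_pos h2, ← chk_x C ans h1 h2]
      by_cases h3 : S.occ C.x (.ofList (l.map fun z => .num (z.val + 1)))
          (reqID S.A C.init C.pk ans).val = 0
      · rw [sel_pos h3]
        simp [h1, h2, h3]
      · rw [sel_neg h3]
        simp [h3]
    · rw [sel_pos h1, sel_neg h2]
      simp [h2]
  · rw [sel_neg h1]
    simp [h1]

theorem fnd_x (h : S.mem C.x (S.qR C.x (.ofList ans)) = 1)
    (h' : S.mem C.x (S.qW C.x (.ofList ans)) = 1) (c : ZMod C.B.p) :
    S.fnd C.x (.ofList ans) c.val = rewind S.A C.init C.pk (S.Kq.eval C.κ) ans c := by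
  rw [Sim.fnd, rewind, found, kap_x]
  congr 1
  funext i a
  have e : (c.val + (i + 1)) % Sim.ord C.x = (c + ((i + 1 : ℕ) : ZMod C.B.p)).val := by
    rw [ord_x, ← ZMod.val_natCast, Nat.cast_add, ZMod.natCast_zmod_val]
  rw [e]
  by_cases h1 : Correct S.A C.init C.pk ans (c + ((i + 1 : ℕ) : ZMod C.B.p))
  · rw [if_pos h1, sel_pos ((chk_x C ans h h' _).2 h1)]
  · rw [if_neg h1, sel_neg fun h2 => h1 ((chk_x C ans h h' _).1 h2)]

/-- The numbers that the program extracts agree modulo the order with the typed quantities, and they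
satisfy the relation that `keyD_x` asks for; the rest is bookkeeping over the three possible
outcomes of a protocol. -/
theorem upd_x (st : Bool × List Data × List (ZMod C.B.p))
    (hl : st.2.2.length ≤ S.A.queries.eval C.κ) (hK : S.Kq.eval C.κ < C.B.p)
    (c : ZMod C.B.p) (r s w : ℕ) :
    .pair (.num w) (S.upd C.x (if st.1 then 1 else 0) (.ofList st.2.1)
      (.ofList (st.2.2.map fun z => .num (z.val + 1))) c.val r s) =
    C.encSt w (simStep S.A C.init C.pk C.α (S.Kq.eval C.κ) C.Q C.ID C.ts st c r s) := by
  rw [Sim.upd, simStep]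
  by_cases h : Fresh S.A C.init C.pk st.2 ∧ Correct S.A C.init C.pk st.2.1 c
  · rw [if_pos h, sel_pos ((acc_x C st.2.1 st.2.2 hl c).2 h)]
    have hR := (mem_qR C st.2.1).2 h.1.1
    have hW := (mem_qW C st.2.1).2 h.1.2.1
    have hf := fnd_x C st.2.1 hR hW c
    by_cases hk : rewind S.A C.init C.pk (S.Kq.eval C.κ) st.2.1 c = 0
    · rw [if_pos hk, sel_pos (hf.trans hk)]
      rfl
    · rw [if_neg hk, sel_neg (by rwa [hf])]
      simp only [encSt, Data.ofList, List.map_cons, qID_x]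
      congr 4
      rw [Sim.ansK]
      congr 1
      generalize hkk : rewind S.A C.init C.pk (S.Kq.eval C.κ) st.2.1 c = k at *
      have hspec := found_spec (Correct S.A C.init C.pk st.2.1) c (S.Kq.eval C.κ)
      rw [← rewind, hkk] at hspec
      rcases hspec with ⟨h1, -⟩ | ⟨h1, h2, h3⟩
      · exact absurd h1 hk
      -- The search goes no further than `Kq < p`, so the two challenges differ and their distance
      -- can be inverted.
      have hk0 : (k : ZMod C.B.p) ≠ 0 := by
        rw [Ne, ZMod.natCast_eq_zero_iff]
        exact fun hd => absurd (Nat.le_of_dvd (by omega) hd) (by omega)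
      have hc' : (c.val + k) % Sim.ord C.x = (c + (k : ZMod C.B.p)).val := by
        rw [ord_x, ← ZMod.val_natCast, Nat.cast_add, ZMod.natCast_zmod_val]
      have e0 : ((S.xt0 C.x (.ofList st.2.1) c.val : ℕ) : ZMod C.B.p) =
          extT S.A C.init C.pk st.2.1 c k := by
        rw [Sim.xt0, Sim.rsp', hf, hc', rsp_x, rsp_x, Nat.cast_mul, Nat.cast_add, neg_x, inv_x,
          ← sub_eq_add_neg]
        rfl
      have eθ : ((S.xth C.x (.ofList st.2.1) c.val : ℕ) : ZMod C.B.p) =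
          extΘ S.A C.init C.pk st.2.1 c k := by
        rw [Sim.xth, Sim.rsp', hf, hc', rsp_x, rsp_x, Nat.cast_mul, Nat.cast_add, neg_x, inv_x,
          ← sub_eq_add_neg]
        rfl
      have e1 : S.xt1 C.x (.ofList st.2.1) c.val s =
          (simT S.A C.init C.pk (S.Kq.eval C.κ) C.ID C.ts st.2.1 c s).val := by
        rw [Sim.xt1, ord_x, ← ZMod.val_natCast, simT, qID_x, ids_x, hkk]
        congr 1
        by_cases hID : reqID S.A C.init C.pk st.2.1 = C.ID
        · rw [if_pos hID, sel_pos (by rw [hID]), Nat.cast_add, neg_x, e0, ← sub_eq_add_neg]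
          rfl
        · rw [if_neg hID, sel_neg (fun h => hID (ZMod.val_injective _ h))]
      have edt : ((S.xdt C.x (.ofList st.2.1) c.val s : ℕ) : ZMod C.B.p) =
          extT S.A C.init C.pk st.2.1 c k +
            simT S.A C.init C.pk (S.Kq.eval C.κ) C.ID C.ts st.2.1 c s - C.ts := by
        rw [Sim.xdt, Nat.cast_add, Nat.cast_add, neg_x, e0, e1, ZMod.natCast_zmod_val,
          ← sub_eq_add_neg]
        rfl
      have eta : ((S.xta C.x (.ofList st.2.1) c.val s : ℕ) : ZMod C.B.p) =
          (extT S.A C.init C.pk st.2.1 c k +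
            simT S.A C.init C.pk (S.Kq.eval C.κ) C.ID C.ts st.2.1 c s - C.ts) *
            (reqID S.A C.init C.pk st.2.1 - C.ID)⁻¹ := by
        rw [Sim.xta, Nat.cast_mul, inv_x, Nat.cast_add, neg_x, edt, qID_x, ids_x,
          ZMod.natCast_zmod_val, ZMod.natCast_zmod_val, ← sub_eq_add_neg]
      rw [← extract S.A C.init C.pk hk0 h.2 h3, e1, qID_x]
      refine keyD_x C _ _ _ _ _ _ _ _ _ ?_ edt eθ ?_
      · rw [eta, simR, hkk]
      -- For the target identity the choice of `simT` makes both sides `0`; otherwise the difference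
      -- of the identities is invertible.
      · rw [eta, edt]
        by_cases hID : reqID S.A C.init C.pk st.2.1 = C.ID
        · rw [simT, if_pos hID, hID, hkk]
          ring
        · rw [mul_assoc, inv_mul_cancel₀ (sub_ne_zero.2 hID), mul_one]
  · rw [if_neg h, sel_neg (fun h' => h ((acc_x C st.2.1 st.2.2 hl c).1 h'))]
    rfl

end

theorem stp_x (st : Bool × List Data × List (ZMod C.B.p))
    (hl : st.2.2.length ≤ S.A.queries.eval C.κ) (hK : S.Kq.eval C.κ < C.B.p) (w : ℕ) :
    S.stp C.x (C.encSt w st) = C.encSt (w / C.B.p / C.B.p / C.B.p)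
      (simStep S.A C.init C.pk C.α (S.Kq.eval C.κ) C.Q C.ID C.ts st w (w / C.B.p : ℕ)
        (w / C.B.p / C.B.p : ℕ)) := by
  have h := C.upd_x st hl hK (w : ZMod C.B.p) (w / C.B.p % C.B.p) (w / C.B.p / C.B.p % C.B.p)
    (w / C.B.p / C.B.p / C.B.p)
  rw [ZMod.natCast_mod, ZMod.natCast_mod, ZMod.val_natCast] at h
  rw [← h, Sim.stp, ord_x]
  rfl

theorem simStep_length {B : BilinearGroup} {N : ℕ} (A : DishonestUser) (init : Data)
    (pk : PublicKey B N) (α : (ZMod B.p)ˣ) (K : ℕ) (sh : ZMod B.p → ZMod B.p) (ID₀ ts : ZMod B.p)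
    (st : Bool × List Data × List (ZMod B.p)) (c r s : ZMod B.p) :
    (simStep A init pk α K sh ID₀ ts st c r s).2.2.length ≤ st.2.2.length + 1 := by
  rw [simStep]
  split_ifs <;> simp

theorem iter_stp (hK : S.Kq.eval C.κ < C.B.p) (n : ℕ) :
    ∀ (st : Bool × List Data × List (ZMod C.B.p)) (w : ℕ),
      st.2.2.length + n ≤ S.A.queries.eval C.κ →
      ∃ w', (S.stp C.x)^[n] (C.encSt w st) = C.encSt w'
        (simRun S.A C.init C.pk C.α (S.Kq.eval C.κ) C.Q C.ID C.ts n st w) := by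
  induction n with
  | zero => exact fun st w _ => ⟨w, rfl⟩
  | succ n ih =>
    intro st w h
    rw [Function.iterate_succ_apply, stp_x C st (by omega) hK]
    refine ih _ _ ?_
    have := simStep_length S.A C.init C.pk C.α (S.Kq.eval C.κ) C.Q C.ID C.ts st w (w / C.B.p : ℕ)
      (w / C.B.p / C.B.p : ℕ)
    omega

theorem iter_eq_iterate {α : Type} (f : α → α) (a : α) (n : ℕ) : iter (fun _ s => f s) a n = f^[n] a := by
  induction n with
  | zero => rfl
  | succ n ih => rw [iter, ih, Function.iterate_succ_apply']

/-- The state after the simulated key generation protocols. -/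
noncomputable def run : Bool × List Data × List (ZMod C.B.p) :=
  simRun S.A C.init C.pk C.α (S.Kq.eval C.κ) C.Q C.ID C.ts (S.A.queries.eval C.κ)
    (false, [], []) (S.tape' C.x)

theorem fin_x (hK : S.Kq.eval C.κ < C.B.p) : ∃ w, S.fin C.x = C.encSt w C.run := by
  rw [Sim.fin, iter_eq_iterate, Sim.qq, kap_x]
  exact C.iter_stp hK _ (false, [], []) (S.tape' C.x) (by simp)

theorem flg_x (hK : S.Kq.eval C.κ < C.B.p) : S.flg C.x = 0 ↔ C.run.1 = false := by
  obtain ⟨w, hw⟩ := C.fin_x hK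
  rw [Sim.flg, hw]
  simp only [encSt, Data.fst_pair, Data.snd_pair, Data.toNat_num]
  cases C.run.1 <;> simp

theorem fv_x (hK : S.Kq.eval C.κ < C.B.p) : S.fv C.x = view C.init C.pk C.run.2.1 := by
  obtain ⟨w, hw⟩ := C.fin_x hK
  rw [Sim.fv, hw]
  exact C.vw_x _

end Ctx

/-! ### Keys read from data, and ciphertexts for a single receiver -/

section Typed

variable {B : BilinearGroup} {N : ℕ}

theorem Key.read_eq_some {d : Data} {K : Key B N} : Key.read B N d = some K ↔
    B.encG K.K₁ = d.fst.toNat ∧ B.encG K.K₂ = d.snd.fst.toNat ∧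
      (∀ i : Fin N, B.encG (K.T i) = (d.snd.snd.fst.nth i).toNat) ∧
      K.t = B.readZ d.snd.snd.snd := by
  have hinj : Function.Injective (fun (T : Fin N → B.G) i => B.encG (T i)) := fun T T' h =>
    funext fun i => B.encG_injective (congrFun h i)
  have e : Key.read B N d = (B.readG d.fst).bind fun K₁ => (B.readG d.snd.fst).bind fun K₂ =>
      (Function.partialInv (fun (T : Fin N → B.G) i => B.encG (T i))
        (fun i => (Data.nth i d.snd.snd.fst).toNat)).bind fun T =>
          some ⟨K₁, K₂, T, B.readZ d.snd.snd.snd⟩ := rfl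
  rw [e]
  simp only [Option.bind_eq_some_iff, B.readG_eq_some, Option.some.injEq]
  constructor
  · rintro ⟨K₁, h1, K₂, h2, T, h3, rfl⟩
    exact ⟨h1, h2, fun i => congrFun ((hinj.isPartialInv _ _).1 h3) i, rfl⟩
  · rintro ⟨h1, h2, h3, h4⟩
    exact ⟨_, h1, _, h2, K.T, (hinj.isPartialInv _ _).2 (funext h3), by rw [← h4]⟩

/-- The other receivers form the empty set, whose polynomial is `1`, so `T₀` is the only delegation
component that contributes. -/
theorem decrypt_singleton (hN : 1 ≤ N) (K : Key B N) (ID : ZMod B.p) (C₁ C₂ : B.G) (C₃ : B.GT) :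
    decrypt K ID {ID} ⟨1, C₁, C₂, C₃⟩ =
      (B.e C₁ (K.K₁ * K.T ⟨0, hN⟩))⁻¹ * B.e C₂ K.K₂ * pw C₃ K.t := by
  obtain ⟨M, rfl⟩ : ∃ M, N = M + 1 := ⟨N - 1, by omega⟩
  have h1 : Fact (1 < B.p) := ⟨B.prime.out.one_lt⟩
  rw [decrypt, Key.delegate]
  simp only [Finset.erase_singleton, idPoly, Finset.prod_empty, coeff_one, one_mul]
  rw [Fin.prod_univ_succ, Finset.prod_eq_one]
  · simp [ZMod.val_one, pw]
  · intro i _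
    rw [if_neg (by simp)]
    simp

theorem receiverElt_singleton (hN : 1 ≤ N) (pk : PublicKey B N) (ID : ZMod B.p) :
    receiverElt pk {ID} = pk.z * (pw (pk.h 0) (-ID) * pk.h ⟨1, by omega⟩) := by
  obtain ⟨M, rfl⟩ : ∃ M, N = M + 1 := ⟨N - 1, by omega⟩
  have h1 : Fact (1 < B.p) := ⟨B.prime.out.one_lt⟩
  rw [receiverElt]
  simp only [idPoly, Finset.prod_singleton, coeff_sub, coeff_X, coeff_C]
  rw [Fin.prod_univ_succ, Fin.prod_univ_succ, Finset.prod_eq_one]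
  · simp [ZMod.val_one, pw]
  · intro i _
    simp

/-- The ciphertext with given components whose decryption is `m`. -/
noncomputable def trialC (K : Key B N) (ID : ZMod B.p) (C₁ C₂ : B.G) (C₃ m : B.GT) : Ciphertext B :=
  ⟨m * (decrypt K ID {ID} ⟨1, C₁, C₂, C₃⟩)⁻¹, C₁, C₂, C₃⟩

/-- The device, run with coins `w`, opens the ciphertext whose decryption is `m`. -/
def Opens (A : DishonestUser) (v : Data) (K : Key B N) (ID : ZMod B.p) (C₁ C₂ : B.G)
    (C₃ m : B.GT) (w : ℕ) : Prop :=
  (A.device.run (.pair v (.pair (trialC K ID C₁ C₂ C₃ m).toData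
    (.pair (.ofList [B.dZ ID]) (.num w))))).toNat = B.encGT m

end Typed

/-! ### The answer of the program in terms of group elements -/

namespace Ctx

variable {S : Sim} (C : Ctx S)

theorem tm_inv (y : C.B.GT) : S.tpow C.x (C.B.encGT y) (Sim.neg C.x 1) = C.B.encGT y⁻¹ := by
  rw [tpow_x, neg_x, Nat.cast_one, pw_neg C.B.card_GT, pw_one]

/-- The key that the user outputs. -/
noncomputable def key : Option (Key C.B C.N) :=
  Key.read C.B C.N (S.A.output.run (view C.init C.pk C.run.2.1))

theorem ky_x (hK : S.Kq.eval C.κ < C.B.p) : S.ky C.x = S.A.output.run (view C.init C.pk C.run.2.1) := by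
  rw [Sim.ky, fv_x C hK]

theorem key_eq_some (hK : S.Kq.eval C.κ < C.B.p) {K : Key C.B C.N} : C.key = some K ↔
    S.ky1 C.x = C.B.encG K.K₁ ∧ S.ky2 C.x = C.B.encG K.K₂ ∧
      (∀ i : Fin C.N, S.kyT C.x i = C.B.encG (K.T i)) ∧
      ((S.kyt C.x : ℕ) : ZMod C.B.p) = K.t := by
  rw [key, Key.read_eq_some, ← ky_x C hK]
  have h (i : Fin C.N) : min (i : ℕ) C.N = i := min_eq_left i.2.le
  simp only [Sim.ky1, Sim.ky2, Sim.kyT, Sim.kyt, nn_x, h, BilinearGroup.readZ, eq_comm]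

/-- Validity is decidable from the public key by membership tests and pairings. The sums `badT` and
`badV` count violations, so they vanish exactly when all components pass. -/
theorem val_x (hK : S.Kq.eval C.κ < C.B.p) : S.val C.x = 1 ↔ ∃ K, C.key = some K ∧ K.Valid C.pk C.ID := by
  have hbadT : S.badT C.x = 0 ↔ ∀ i : Fin C.N, S.mem C.x (S.kyT C.x i) = 1 := by
    rw [Sim.badT, nn_x, Finset.sum_eq_zero_iff]
    constructor
    · intro h i
      by_contra hn
      have := h i (Finset.mem_range.2 i.2)
      rw [sel_neg hn] at this
      omega
    · intro h i hi
      exact sel_pos (h ⟨i, Finset.mem_range.1 hi⟩)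
  have key {K : Key C.B C.N} (h : C.key = some K) :
      (S.mem C.x (S.ky1 C.x) = 1 ∧ S.mem C.x (S.ky2 C.x) = 1 ∧ S.badT C.x = 0) ∧
      (S.pr C.x (S.ky1 C.x) (S.g0 C.x) = S.tm C.x (S.tm C.x (S.tpow C.x
        (S.pr C.x (S.g1 C.x) (S.g2 C.x)) (S.kyt C.x)) (S.pr C.x (S.g1 C.x) (S.g3 C.x)))
        (S.pr C.x (S.zz C.x) (S.ky2 C.x)) ∧ S.badV C.x = 0 ↔ K.Valid C.pk C.ID) := by
    obtain ⟨h1, h2, h3, h4⟩ := (key_eq_some C hK).1 h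
    refine ⟨⟨?_, ?_, ?_⟩, ?_⟩
    · rw [h1, mem_x]; exact ⟨_, rfl⟩
    · rw [h2, mem_x]; exact ⟨_, rfl⟩
    · rw [hbadT]
      intro i
      rw [h3, mem_x]; exact ⟨_, rfl⟩
    · rw [h1, h2, g0_x, g1_x, g2_x, g3_x, zz_x, pr_x, pr_x, pr_x, pr_x, tpow_x, h4, tm_x, tm_x,
        C.B.encGT_injective.eq_iff, Key.Valid]
      refine and_congr ?_ ?_
      · rw [pw_one]; rfl
      · have hV (i : Fin C.N) : S.pr C.x (S.g0 C.x) (S.kyT C.x i) = S.pr C.x (S.ky2 C.x)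
            (S.gm C.x (S.hh C.x (i + 1)) (S.gpow C.x (S.hh C.x i) (Sim.neg C.x (S.ids C.x)))) ↔
            C.B.e C.pk.g (K.T i) =
              C.B.e K.K₂ (C.pk.h i.succ * C.pk.h i.castSucc ^ (-C.ID).val) := by
          rw [h2, h3, g0_x, hh_x, hh_x, gpow_x, gm_x, pr_x, pr_x, C.B.encGT_injective.eq_iff, neg_x,
            ids_cast, pw_one]
          rfl
        rw [Sim.badV, nn_x, Finset.sum_eq_zero_iff]
        constructor
        · intro h i
          by_contra hn
          have := h i (Finset.mem_range.2 i.2)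
          rw [sel_neg (fun h5 => hn ((hV i).1 h5))] at this
          omega
        · intro h i hi
          exact sel_pos ((hV ⟨i, Finset.mem_range.1 hi⟩).2 (h _))
  rw [Sim.val]
  constructor
  · intro h
    by_cases h1 : S.mem C.x (S.ky1 C.x) = 1
    swap
    · rw [sel_neg h1] at h; omega
    by_cases h2 : S.mem C.x (S.ky2 C.x) = 1
    swap
    · rw [sel_pos h1, sel_neg h2] at h; omega
    by_cases h3 : S.badT C.x = 0
    swap
    · rw [sel_pos h1, sel_pos h2, sel_neg h3] at h; omega
    rw [sel_pos h1, sel_pos h2, sel_pos h3] at h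
    have h3' := hbadT.1 h3
    rw [mem_x] at h1 h2
    simp only [mem_x] at h3'
    obtain ⟨k1, hk1⟩ := h1
    obtain ⟨k2, hk2⟩ := h2
    choose T hT using h3'
    have hkey : C.key = some ⟨k1, k2, T, ((S.kyt C.x : ℕ) : ZMod C.B.p)⟩ :=
      (key_eq_some C hK).2 ⟨hk1.symm, hk2.symm, fun i => (hT i).symm, rfl⟩
    refine ⟨_, hkey, (key hkey).2.1 ?_⟩
    by_cases h4 : S.pr C.x (S.ky1 C.x) (S.g0 C.x) = S.tm C.x (S.tm C.x (S.tpow C.x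
        (S.pr C.x (S.g1 C.x) (S.g2 C.x)) (S.kyt C.x)) (S.pr C.x (S.g1 C.x) (S.g3 C.x)))
        (S.pr C.x (S.zz C.x) (S.ky2 C.x))
    · refine ⟨h4, ?_⟩
      rw [sel_pos h4] at h
      by_contra h5
      rw [sel_neg h5] at h
      omega
    · rw [sel_neg h4] at h; omega
  · rintro ⟨K, hkey, hV⟩
    obtain ⟨⟨h1, h2, h3⟩, h4⟩ := key hkey
    obtain ⟨h5, h6⟩ := h4.2 hV
    rw [sel_pos h1, sel_pos h2, sel_pos h3, sel_pos h5, sel_pos h6]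

theorem trl_x (hK : S.Kq.eval C.κ < C.B.p) {K : Key C.B C.N} (h : C.key = some K) (C₁ C₂ : C.B.G) (C₃ m : C.B.GT) (w : ℕ) :
    S.trl C.x (C.B.encG C₁) (C.B.encG C₂) (C.B.encGT C₃) (C.B.encGT m) w = 1 ↔
      Opens S.A (view C.init C.pk C.run.2.1) K C.ID C₁ C₂ C₃ m w := by
  obtain ⟨h1, h2, h3, h4⟩ := (key_eq_some C hK).1 h
  have h3' := h3 ⟨0, C.hN⟩
  have hd : S.dec C.x (C.B.encG C₁) (C.B.encG C₂) (C.B.encGT C₃) =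
      C.B.encGT (decrypt K C.ID {C.ID} ⟨1, C₁, C₂, C₃⟩) := by
    rw [decrypt_singleton C.hN, Sim.dec, h1, h2, h3', gm_x, pr_x, pr_x, tm_inv, tpow_x, tm_x, tm_x,
      h4]
  rw [Sim.trl, hd, tm_inv, tm_x, fv_x C hK, ids_x, Opens]
  by_cases hO : Opens S.A (view C.init C.pk C.run.2.1) K C.ID C₁ C₂ C₃ m w
  · exact iff_of_true (sel_pos hO) hO
  · refine iff_of_false (fun h5 => ?_) hO
    exact absurd ((sel_neg hO).symm.trans h5) (by simp)

theorem trl_le (C₁ C₂ C₃ m w : ℕ) : S.trl C.x C₁ C₂ C₃ m w ≤ 1 := by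
  rw [Sim.trl, sel]
  split_ifs <;> simp

/-- This is the purpose of the choice of `z`: the unknown exponents of `h₀` and `h₁` cancel for the
target identity, so the component `C₂` can be formed from `C₁ = g ^ s` without knowing `s`. -/
theorem rcv_eq : receiverElt C.pk {C.ID} = pw C.g C.δ := by
  rw [receiverElt_singleton C.hN]
  simp only [pk, ← pw_mul C.B.card_G, ← pw_add C.B.card_G]
  congr 1
  simp only [az, Fin.val_zero]
  ring

/-- An exponent chosen by the reduction. -/
def d (k : ℕ) : ZMod C.B.p := (S.dig C.x k : ℕ)

/-- The result of a test of the device on an honest ciphertext. -/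
def okR (K : Key C.B C.N) : Prop :=
  Opens S.A (view C.init C.pk C.run.2.1) K C.ID (pw C.pk.g (C.d 0))
    (pw (receiverElt C.pk {C.ID}) (C.d 0)) (pw (C.B.e C.pk.g₁ C.pk.g₂) (C.d 0))
    (pw (C.B.e C.g C.g) (C.d 1)) (S.dev C.x 0)

/-- The result of a test of the device on a ciphertext of the tracing algorithm. -/
def okP (K : Key C.B C.N) : Prop :=
  Opens S.A (view C.init C.pk C.run.2.1) K C.ID (pw C.pk.g (C.d 2))
    (pw (receiverElt C.pk {C.ID}) (C.d 2)) (pw (C.B.e C.g C.g) (C.d 3))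
    (pw (C.B.e C.g C.g) (C.d 4)) (S.dev C.x 1)

/-- The result of a test of the device on the challenge. -/
def okC (K : Key C.B C.N) : Prop :=
  Opens S.A (view C.init C.pk C.run.2.1) K C.ID C.h (pw C.h C.δ)
    (C.T * pw (C.B.e C.pk.g₁ C.h) C.γ) (pw (C.B.e C.g C.g) (C.d 5)) (S.dev C.x 2)

/-- The usefulness of the device does not occur: the program cannot decide it, and the comparison of
the three tests makes it unnecessary. -/
theorem out_x (hK : S.Kq.eval C.κ < C.B.p) : S.out C.x = 1 ↔ C.run.1 = false ∧ ∃ K, C.key = some K ∧ K.Valid C.pk C.ID ∧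
    (C.okR K ∧ ¬ C.okP K ∧ C.okC K ∨ ¬ C.okR K ∧ C.okP K ∧ ¬ C.okC K) := by
  have hgt (n : ℕ) : S.gtE C.x n = C.B.encGT (pw (C.B.e C.g C.g) (n : ZMod C.B.p)) := by
    rw [Sim.gtE, g0_x, pr_x, tpow_x, pw_one]
  have hrcv : S.rcv C.x = C.B.encG (receiverElt C.pk {C.ID}) := by
    rw [Sim.rcv, g0_x, gpow_x, pw_one, rcv_eq C]
    rfl
  rw [Sim.out]
  by_cases hf : S.flg C.x = 0
  swap
  · have := (flg_x C hK).not.1 hf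
    rw [sel_neg hf]
    simp [this]
  rw [sel_pos hf]
  have hf' := (flg_x C hK).1 hf
  by_cases hv : S.val C.x = 1
  swap
  · rw [sel_neg hv]
    rw [val_x C hK] at hv
    push Not at hv
    refine iff_of_false (by simp) ?_
    rintro ⟨-, K, h1, h2, -⟩
    exact hv K h1 h2
  rw [sel_pos hv]
  obtain ⟨K, hKey, hV⟩ := (val_x C hK).1 hv
  have hR : S.trlR C.x = 1 ↔ C.okR K := by
    rw [Sim.trlR, g0_x, g1_x, g2_x, hrcv, gpow_x, gpow_x, pr_x, tpow_x, hgt, trl_x C hK hKey, pw_one]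
    rfl
  have hP : S.trlP C.x = 1 ↔ C.okP K := by
    rw [Sim.trlP, g0_x, hrcv, gpow_x, gpow_x, hgt, hgt, trl_x C hK hKey, pw_one]
    rfl
  have hY : S.trlC C.x = 1 ↔ C.okC K := by
    rw [Sim.trlC, g1_x, chH_x, chT_x, gpow_x, pr_x, tpow_x, tm_x, hgt, trl_x C hK hKey]
    rfl
  have hY1 : S.trlC C.x ≤ 1 := trl_le C _ _ _ _ _
  have huniq : (∃ K, C.key = some K ∧ K.Valid C.pk C.ID ∧
      (C.okR K ∧ ¬ C.okP K ∧ C.okC K ∨ ¬ C.okR K ∧ C.okP K ∧ ¬ C.okC K)) ↔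
      (C.okR K ∧ ¬ C.okP K ∧ C.okC K ∨ ¬ C.okR K ∧ C.okP K ∧ ¬ C.okC K) := by
    constructor
    · rintro ⟨K', h1, -, h2⟩
      rw [hKey, Option.some.injEq] at h1
      rwa [h1]
    · exact fun h => ⟨K, hKey, hV, h⟩
  rw [huniq, ← hR, ← hP, ← hY]
  simp only [hf', true_and]
  by_cases h1 : S.trlR C.x = 1
  · by_cases h2 : S.trlP C.x = 1
    · rw [sel_pos h1, sel_pos h2]
      simp [h1, h2]
    · rw [sel_pos h1, sel_neg h2]
      simp [h1, h2]
  · by_cases h2 : S.trlP C.x = 1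
    · rw [sel_neg h1, sel_pos h2]
      simp [h1, h2]
      omega
    · rw [sel_neg h1, sel_neg h2]
      simp [h1, h2]

end Ctx

/-! ### Averages -/

/-- The average of a function on a finite type. -/
noncomputable def avg {α : Type} [Fintype α] (f : α → ℝ) : ℝ := (∑ a, f a) / Fintype.card α

/-- The average of a function on the numbers below `n`. -/
noncomputable def avgR (n : ℕ) (f : ℕ → ℝ) : ℝ := (∑ i ∈ Finset.range n, f i) / n

section Avg

variable {α β : Type} [Fintype α] [Fintype β]

theorem avg_const [Nonempty α] (c : ℝ) : avg (fun _ : α => c) = c := by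
  have : (Fintype.card α : ℝ) ≠ 0 := by simp
  rw [avg]
  simp only [Finset.sum_const, Finset.card_univ, nsmul_eq_mul]
  field_simp

theorem avg_mono {f g : α → ℝ} (h : ∀ a, f a ≤ g a) : avg f ≤ avg g := by
  unfold avg
  gcongr
  exact h _

theorem avg_nonneg {f : α → ℝ} (h : ∀ a, 0 ≤ f a) : 0 ≤ avg f :=
  div_nonneg (Finset.sum_nonneg fun a _ => h a) (Nat.cast_nonneg _)

theorem avg_le_one {f : α → ℝ} (h : ∀ a, f a ≤ 1) : avg f ≤ 1 := by
  refine div_le_one_of_le₀ ?_ (Nat.cast_nonneg _)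
  simpa using Finset.sum_le_sum fun a (_ : a ∈ Finset.univ) => h a

theorem avg_add (f g : α → ℝ) : avg (fun a => f a + g a) = avg f + avg g := by
  rw [avg, Finset.sum_add_distrib, add_div]
  rfl

theorem avg_sub (f g : α → ℝ) : avg (fun a => f a - g a) = avg f - avg g := by
  rw [avg, Finset.sum_sub_distrib, sub_div]
  rfl

theorem avg_const_mul (c : ℝ) (f : α → ℝ) : avg (fun a => c * f a) = c * avg f := by
  rw [avg, ← Finset.mul_sum, mul_div_assoc]
  rfl

theorem avg_mul_const (c : ℝ) (f : α → ℝ) : avg (fun a => f a * c) = avg f * c := by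
  simp only [mul_comm _ c, avg_const_mul]

theorem avg_comm (f : α → β → ℝ) : avg (fun a => avg fun b => f a b) = avg fun b => avg fun a => f a b := by
  simp only [avg, Finset.sum_div]
  rw [Finset.sum_comm]
  refine Finset.sum_congr rfl fun b _ => Finset.sum_congr rfl fun a _ => ?_
  rw [div_right_comm]

theorem avg_bij {e : α → β} (he : Function.Bijective e) (f : β → ℝ) :
    avg (fun a => f (e a)) = avg f := by
  rw [avg, avg, Fintype.card_of_bijective he, he.sum_comp f]

theorem avg_add_const [Nonempty α] (f : α → ℝ) (c : ℝ) : avg (fun a => f a + c) = avg f + c := by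
  rw [avg_add, avg_const]

theorem abs_avg_le {f : α → ℝ} {c : ℝ} [Nonempty α] (h : ∀ a, |f a| ≤ c) : |avg f| ≤ c := by
  rw [abs_le]
  constructor
  · rw [← avg_const (α := α) (-c)]
    exact avg_mono fun a => (abs_le.1 (h a)).1
  · rw [← avg_const (α := α) c]
    exact avg_mono fun a => (abs_le.1 (h a)).2

end Avg

theorem avgR_eq (n : ℕ) (f : ℕ → ℝ) : avgR n f = avg fun i : Fin n => f i := by
  rw [avgR, avg, Finset.sum_range, Fintype.card_fin]

/-- Remainder and quotient of a uniform number below `b * M` are uniform and independent. All coins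
of the reduction form a single number, and this is how they are taken apart. -/
theorem avgR_mul (b M : ℕ) (f : ℕ → ℕ → ℝ) :
    avgR (b * M) (fun w => f (w % b) (w / b)) = avgR b fun c => avgR M fun w => f c w := by
  rcases Nat.eq_zero_or_pos b with rfl | hb
  · simp [avgR]
  have h : ∑ w ∈ Finset.range (b * M), f (w % b) (w / b) =
      ∑ c ∈ Finset.range b, ∑ w ∈ Finset.range M, f c w := by
    induction M with
    | zero => simp
    | succ M ih =>
      rw [Nat.mul_succ, Finset.sum_range_add, ih]
      simp only [Finset.sum_range_succ]
      rw [Finset.sum_add_distrib]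
      congr 1
      refine Finset.sum_congr rfl fun c hc => ?_
      have hc' := Finset.mem_range.1 hc
      rw [Nat.mul_add_mod, Nat.mod_eq_of_lt hc', Nat.mul_add_div hb, Nat.div_eq_of_lt hc', add_zero]
  simp only [avgR, h, Nat.cast_mul, Finset.sum_div]
  refine Finset.sum_congr rfl fun c _ => Finset.sum_congr rfl fun w _ => ?_
  rw [div_div, mul_comm]

theorem avgR_cast {p : ℕ} [NeZero p] (f : ZMod p → ℝ) : avgR p (fun c => f (c : ZMod p)) = avg f := by
  rw [avgR, avg, ZMod.card]
  congr 1
  refine Finset.sum_nbij' (fun c => (c : ZMod p)) (fun z => z.val) ?_ ?_ ?_ ?_ ?_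
  · simp
  · intro z _
    exact Finset.mem_range.2 z.val_lt
  · intro c hc
    exact ZMod.val_cast_of_lt (Finset.mem_range.1 hc)
  · intro z _
    exact ZMod.natCast_zmod_val z
  · simp

/-- Sampling from a long tape modulo `M` is almost uniform. -/
theorem avgR_mod (A M : ℕ) (hA : 0 < A) (hM : 0 < M) (f : ℕ → ℝ) (h0 : ∀ a, 0 ≤ f a)
    (h1 : ∀ a, f a ≤ 1) : |avgR A (fun w => f (w % M)) - avgR M f| ≤ M / A := by
  have hs (k : ℕ) : ∑ w ∈ Finset.range (M * k), f (w % M) = k * ∑ c ∈ Finset.range M, f c := by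
    induction k with
    | zero => simp
    | succ k ih =>
      rw [Nat.mul_succ, Finset.sum_range_add, ih]
      push_cast
      rw [add_mul, one_mul]
      congr 1
      refine Finset.sum_congr rfl fun c hc => ?_
      rw [Nat.mul_add_mod, Nat.mod_eq_of_lt (Finset.mem_range.1 hc)]
  -- Complete blocks of length `M` are averaged exactly; the error stems from the last, incomplete
  -- block, which is shorter than `M`.
  have hA' : A = M * (A / M) + A % M := (Nat.div_add_mod A M).symm
  have hr : A % M < M := Nat.mod_lt _ hM
  have hsum : ∑ w ∈ Finset.range A, f (w % M) =
      (A / M : ℕ) * ∑ c ∈ Finset.range M, f c + ∑ c ∈ Finset.range (A % M), f c := by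
    conv_lhs => rw [hA']
    rw [Finset.sum_range_add, hs]
    congr 1
    refine Finset.sum_congr rfl fun c hc => ?_
    rw [Nat.mul_add_mod, Nat.mod_eq_of_lt ((Finset.mem_range.1 hc).trans hr)]
  rw [avgR, avgR, hsum]
  have hS0 : 0 ≤ ∑ c ∈ Finset.range M, f c := Finset.sum_nonneg fun a _ => h0 a
  have hS1 : ∑ c ∈ Finset.range M, f c ≤ M := by
    simpa using Finset.sum_le_sum fun a (_ : a ∈ Finset.range M) => h1 a
  have hR0 : 0 ≤ ∑ c ∈ Finset.range (A % M), f c := Finset.sum_nonneg fun a _ => h0 a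
  have hR1 : ∑ c ∈ Finset.range (A % M), f c ≤ (A % M : ℕ) := by
    simpa using Finset.sum_le_sum fun a (_ : a ∈ Finset.range (A % M)) => h1 a
  generalize ∑ c ∈ Finset.range M, f c = X at *
  generalize ∑ c ∈ Finset.range (A % M), f c = Y at *
  have hAR : (A : ℝ) = M * (A / M : ℕ) + (A % M : ℕ) := by exact_mod_cast hA'
  have hrR : ((A % M : ℕ) : ℝ) ≤ M := by exact_mod_cast hr.le
  have hM' : (0 : ℝ) < M := by exact_mod_cast hM
  have hA0 : (0 : ℝ) < A := by exact_mod_cast hA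
  generalize ((A / M : ℕ) : ℝ) = k at *
  generalize ((A % M : ℕ) : ℝ) = r at *
  have e : (k * X + Y) / A - X / M = (Y - X / M * r) / A := by
    rw [div_sub_div _ _ hA0.ne' hM'.ne', div_eq_div_iff (by positivity) hA0.ne', hAR]
    field_simp
    ring
  have hXM : X / M ≤ 1 := by rwa [div_le_one hM']
  have hXM0 : 0 ≤ X / M := by positivity
  rw [e, abs_div, abs_of_pos hA0]
  gcongr
  rw [abs_le]
  constructor <;> nlinarith

theorem abs_avg_units_sub_le {p : ℕ} [Fact p.Prime] (f : ZMod p → ℝ) (h0 : ∀ a, 0 ≤ f a)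
    (h1 : ∀ a, f a ≤ 1) : |avg (fun u : (ZMod p)ˣ => f u) - avg f| ≤ 1 / p := by
  have hS : ∑ z, f z = f 0 + ∑ u : (ZMod p)ˣ, f u := by
    rw [← Finset.add_sum_erase _ _ (Finset.mem_univ (0 : ZMod p))]
    congr 1
    symm
    refine Finset.sum_bij' (fun u _ => (u : ZMod p))
      (fun z hz => Units.mk0 z (Finset.ne_of_mem_erase hz)) ?_ ?_ ?_ ?_ ?_
    · intro u _
      simp
    · simp
    · intro u _
      ext
      simp
    · intro z _
      simp
    · simp
  have hp := (Fact.out : p.Prime).one_lt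
  have hp' : (1 : ℝ) < p := by exact_mod_cast hp
  have hX0 : 0 ≤ ∑ u : (ZMod p)ˣ, f u := Finset.sum_nonneg fun a _ => h0 _
  have hX1 : ∑ u : (ZMod p)ˣ, f u ≤ p - 1 := by
    have := Finset.sum_le_sum fun (a : (ZMod p)ˣ) (_ : a ∈ Finset.univ) => h1 a
    rw [Finset.sum_const, Finset.card_univ, ZMod.card_units, nsmul_eq_mul, mul_one,
      Nat.cast_sub hp.le] at this
    simpa using this
  rw [avg, avg, hS, ZMod.card_units, ZMod.card, Nat.cast_sub hp.le, Nat.cast_one]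
  generalize ∑ u : (ZMod p)ˣ, f u = X at *
  have hp1 : (0 : ℝ) < p - 1 := by linarith
  -- Passing to units drops only the value at `0`, so the error is a difference of two numbers in
  -- `[0, 1]`, divided by `p`.
  have e : X / ((p : ℝ) - 1) - (f 0 + X) / p = (X / (p - 1) - f 0) / p := by
    field_simp
    ring
  have h2 : X / ((p : ℝ) - 1) ≤ 1 := by rwa [div_le_one hp1]
  have h3 : 0 ≤ X / ((p : ℝ) - 1) := by positivity
  rw [e, abs_div, abs_of_pos (by linarith : (0 : ℝ) < p)]
  gcongr
  rw [abs_le]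
  constructor <;> linarith [h0 0, h1 0]

/-! ### Probabilities -/

theorem Pr_nonneg (d : PMF Bool) : 0 ≤ Pr d := ENNReal.toReal_nonneg

theorem Pr_le_one (d : PMF Bool) : Pr d ≤ 1 := by
  rw [Pr, ← ENNReal.toReal_one]
  exact ENNReal.toReal_mono ENNReal.one_ne_top (d.coe_le_one true)

theorem Pr_pure (b : Bool) : Pr (PMF.pure b) = if b then 1 else 0 := by
  cases b <;> simp [Pr, PMF.pure_apply]

theorem Pr_bind {α : Type} (μ : PMF α) (k : α → PMF Bool) :
    Pr (μ.bind k) = ∑' a, (μ a).toReal * Pr (k a) := by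
  rw [Pr, PMF.bind_apply, ENNReal.tsum_toReal_eq]
  · simp only [ENNReal.toReal_mul]
    rfl
  · exact fun a => ENNReal.mul_ne_top (μ.apply_ne_top a) ((k a).apply_ne_top true)

theorem Pr_bind_unif {α : Type} [Fintype α] [Nonempty α] (k : α → PMF Bool) :
    Pr ((unif α).bind k) = avg fun a => Pr (k a) := by
  have h (a : α) : unif α a = (Fintype.card α : ENNReal)⁻¹ := by
    change @PMF.uniformOfFintype α (Fintype.ofFinite α) _ a = _
    -- `unif` carries its own finiteness instance, which is identified here with the ambient one.
    rw [Subsingleton.elim (Fintype.ofFinite α) ‹Fintype α›, PMF.uniformOfFintype_apply]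
  rw [Pr_bind, tsum_fintype, avg, Finset.sum_div]
  refine Finset.sum_congr rfl fun a _ => ?_
  rw [h, ENNReal.toReal_inv, ENNReal.toReal_natCast, div_eq_inv_mul]

theorem Pr_bind_coins (n : ℕ) (k : Data → PMF Bool) :
    Pr ((coins n).bind k) = avgR (2 ^ n) fun w => Pr (k (.num w)) := by
  rw [coins, PMF.bind_map]
  change Pr ((PMF.bind (unif (Fin (2 ^ n))) fun a => PMF.pure (a : ℕ)).bind _) = _
  rw [PMF.bind_bind, Pr_bind_unif, avgR_eq]
  simp only [PMF.pure_bind]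
  rfl

theorem Pr_bind_map_coins {α : Type} (n : ℕ) (f : Data → α) (k : α → PMF Bool) :
    Pr (((coins n).map f).bind k) = avgR (2 ^ n) fun w => Pr (k (f (.num w))) := by
  rw [PMF.bind_map, Pr_bind_coins]
  rfl

theorem summable_toReal {α : Type} (μ : PMF α) : Summable fun a => (μ a).toReal := by
  apply ENNReal.summable_toReal
  rw [μ.tsum_coe]
  exact ENNReal.one_ne_top

theorem tsum_toReal {α : Type} (μ : PMF α) : ∑' a, (μ a).toReal = 1 := by
  rw [← ENNReal.tsum_toReal_eq (fun a => μ.apply_ne_top a), μ.tsum_coe]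
  rfl

/-- The counter never decreases, so it ends at `0` only if every repetition fails; no other value of
its distribution is needed. -/
theorem Pr_counter (b : PMF Bool) (L : ℕ) {α : Type} (x y : α) (k : α → PMF Bool) (hx : Pr (k x) = 1)
    (hy : Pr (k y) = 0) :
    Pr (((counter b L).bind fun n => PMF.pure (if n = 0 then x else y)).bind k) =
      (1 - Pr b) ^ L := by
  have hb : b false = 1 - b true := by
    have h := b.tsum_coe
    rw [tsum_fintype, Fintype.sum_bool] at h
    exact ENNReal.eq_sub_of_add_eq (b.apply_ne_top true) ((add_comm _ _).trans h)
  have hf : (b false).toReal = 1 - Pr b := by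
    rw [hb, ENNReal.toReal_sub_of_le (b.coe_le_one true) ENNReal.one_ne_top]
    rfl
  have hc : ∀ L, ((counter b L) 0).toReal = (1 - Pr b) ^ L := by
    intro L
    induction L with
    | zero =>
      change ((PMF.pure 0 : PMF ℕ) 0).toReal = _
      simp
    | succ L ih =>
      have e : counter b (L + 1) = (counter b L).bind fun n => b.bind fun x =>
        PMF.pure (if x then n + 1 else n) := rfl
      rw [e, PMF.bind_apply, tsum_eq_single 0]
      · rw [ENNReal.toReal_mul, ih, PMF.bind_apply, tsum_fintype, Fintype.sum_bool]
        simp [hf, pow_succ]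
      · intro n hn
        rw [PMF.bind_apply, tsum_fintype, Fintype.sum_bool]
        simp [hn, Ne.symm hn]
  rw [PMF.bind_bind, Pr_bind, tsum_eq_single 0, hc, PMF.pure_bind, if_pos rfl, hx, mul_one]
  intro n hn
  rw [PMF.pure_bind, if_neg hn, hy, mul_zero]

/-! ### Real and simulated key generation compared -/

section Induction

variable {B : BilinearGroup} {N : ℕ} (A : DishonestUser) (init : Data) (pk : PublicKey B N)
  (α : (ZMod B.p)ˣ)

/-- The state after a key generation protocol that fails. -/
def botState (st : List Data × List (ZMod B.p)) (c : ZMod B.p) : List Data × List (ZMod B.p) :=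
  (.pair (B.dZ c) (.num 0) :: st.1, st.2)

/-- The state after a key generation protocol in which a key is issued. -/
noncomputable def keyState (st : List Data × List (ZMod B.p)) (c r t : ZMod B.p) :
    List Data × List (ZMod B.p) :=
  (.pair (B.dZ c) (mkKey pk α (reqID A init pk st.1) (reqR A init pk st.1) r t).toData :: st.1,
    reqID A init pk st.1 :: st.2)

open Classical in
/-- The expectation of a function of the state after a number of key generation protocols. -/
noncomputable def realVal (F : List Data × List (ZMod B.p) → ℝ) :
    ℕ → List Data × List (ZMod B.p) → ℝ
  | 0, st => F st
  | n + 1, st => avg fun c => if Fresh A init pk st ∧ Correct A init pk st.1 c then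
      avg fun r : (ZMod B.p)ˣ => avg fun t : (ZMod B.p)ˣ =>
        realVal F n (keyState A init pk α st c r t)
      else realVal F n (botState st c)

/-- Key generation protocols that start in a given state. -/
noncomputable def sessionsFrom : ℕ → List Data × List (ZMod B.p) →
    PMF (List Data × List (ZMod B.p))
  | 0, st => PMF.pure st
  | n + 1, st => (session A init pk α st).bind (sessionsFrom n)

/-- `sessions` appends a protocol at the end, whereas the comparison below conditions on the first
protocol; this identity moves a protocol from one end to the other. -/
theorem sessionsFrom_succ (n : ℕ) (st : List Data × List (ZMod B.p)) :
    sessionsFrom A init pk α (n + 1) st =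
      (sessionsFrom A init pk α n st).bind (session A init pk α) := by
  induction n generalizing st with
  | zero =>
    simp only [sessionsFrom, PMF.pure_bind]
    exact PMF.bind_pure _
  | succ n ih =>
    rw [sessionsFrom, sessionsFrom, PMF.bind_bind]
    congr 1
    funext st'
    exact ih st'

theorem sessions_eq (n : ℕ) : sessions A init pk α n = sessionsFrom A init pk α n ([], []) := by
  induction n with
  | zero => rfl
  | succ n ih => rw [sessions, ih, sessionsFrom_succ]

theorem Pr_sessionsFrom (k : List Data × List (ZMod B.p) → PMF Bool) (n : ℕ)
    (st : List Data × List (ZMod B.p)) : Pr ((sessionsFrom A init pk α n st).bind k) =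
      realVal A init pk α (fun st => Pr (k st)) n st := by
  induction n generalizing st with
  | zero => rw [sessionsFrom, PMF.pure_bind]; rfl
  | succ n ih =>
    rw [sessionsFrom, PMF.bind_bind, session_eq, PMF.bind_bind, Pr_bind_unif, realVal]
    congr 1
    funext c
    split_ifs with h
    · rw [PMF.bind_bind, Pr_bind_unif]
      congr 1
      funext r
      rw [PMF.bind_bind, Pr_bind_unif]
      congr 1
      funext t
      rw [PMF.pure_bind, ih]
      rfl
    · rw [PMF.pure_bind, ih]
      rfl

theorem Pr_sessions (k : List Data × List (ZMod B.p) → PMF Bool) (n : ℕ) :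
    Pr ((sessions A init pk α n).bind k) =
      realVal A init pk α (fun st => Pr (k st)) n ([], []) := by
  rw [sessions_eq, Pr_sessionsFrom]

variable (K : ℕ) (sh : ZMod B.p → ZMod B.p) (ID₀ : ZMod B.p)

/-- The value of a final state of the simulation. -/
def flagged (F : List Data × List (ZMod B.p) → ℝ) (st : Bool × List Data × List (ZMod B.p)) : ℝ :=
  if st.1 then 0 else F st.2

/-- The expectation of a function of the state after simulated key generation protocols; failures
of the simulation do not contribute. -/
noncomputable def simVal (F : List Data × List (ZMod B.p) → ℝ) (ts : ZMod B.p) :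
    ℕ → Bool × List Data × List (ZMod B.p) → ℝ
  | 0, st => flagged F st
  | n + 1, st => avg fun c => avg fun r => avg fun s =>
      simVal F ts n (simStep A init pk α K sh ID₀ ts st c r s)

/-- Each protocol consumes the three lowest digits of the tape in base `p`; these are independent,
so reading the tape amounts to fresh averages over the challenge, `r` and `s`. -/
theorem simVal_tape (F : List Data × List (ZMod B.p) → ℝ) (ts : ZMod B.p) (n : ℕ)
    (st : Bool × List Data × List (ZMod B.p)) :
    avgR (B.p ^ (3 * n)) (fun w => flagged F (simRun A init pk α K sh ID₀ ts n st w)) =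
      simVal A init pk α K sh ID₀ F ts n st := by
  induction n generalizing st with
  | zero => simp [avgR, simVal, simRun]
  | succ n ih =>
    let f₃ (c r s : ℕ) (w : ℕ) : ℝ :=
      flagged F (simRun A init pk α K sh ID₀ ts n (simStep A init pk α K sh ID₀ ts st c r s) w)
    let f₂ (c r : ℕ) (w : ℕ) : ℝ := f₃ c r (w % B.p) (w / B.p)
    let f₁ (c : ℕ) (w : ℕ) : ℝ := f₂ c (w % B.p) (w / B.p)
    have e : (fun w => flagged F (simRun A init pk α K sh ID₀ ts (n + 1) st w)) =
        fun w => f₁ (w % B.p) (w / B.p) := by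
      funext w
      simp only [f₁, f₂, f₃, simRun, ZMod.natCast_mod]
    have s₁ (c : ℕ) : avgR (B.p * (B.p * B.p ^ (3 * n))) (f₁ c) =
        avgR B.p fun r => avgR (B.p * B.p ^ (3 * n)) (f₂ c r) := avgR_mul _ _ (f₂ c)
    have s₂ (c r : ℕ) : avgR (B.p * B.p ^ (3 * n)) (f₂ c r) =
        avgR B.p fun s => avgR (B.p ^ (3 * n)) (f₃ c r s) := avgR_mul _ _ (f₃ c r)
    have s₃ (c r s : ℕ) : avgR (B.p ^ (3 * n)) (f₃ c r s) = simVal A init pk α K sh ID₀ F ts n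
        (simStep A init pk α K sh ID₀ ts st c r s) := ih _
    rw [e, show B.p ^ (3 * (n + 1)) = B.p * (B.p * (B.p * B.p ^ (3 * n))) by ring, avgR_mul, simVal,
      ← avgR_cast]
    congr 1
    funext c
    rw [s₁, ← avgR_cast]
    congr 1
    funext r
    rw [s₂, ← avgR_cast]
    congr 1
    funext s
    exact s₃ c r s

variable {F : List Data × List (ZMod B.p) → ℝ}

theorem realVal_nonneg (h0 : ∀ st, 0 ≤ F st) (n : ℕ) (st : List Data × List (ZMod B.p)) :
    0 ≤ realVal A init pk α F n st := by
  induction n generalizing st with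
  | zero => exact h0 st
  | succ n ih =>
    refine avg_nonneg fun c => ?_
    split_ifs
    · exact avg_nonneg fun r => avg_nonneg fun t => ih _
    · exact ih _

theorem realVal_le_one (h1 : ∀ st, F st ≤ 1) (n : ℕ) (st : List Data × List (ZMod B.p)) :
    realVal A init pk α F n st ≤ 1 := by
  induction n generalizing st with
  | zero => exact h1 st
  | succ n ih =>
    refine avg_le_one fun c => ?_
    split_ifs
    · exact avg_le_one fun r => avg_le_one fun t => ih _
    · exact ih _

theorem simVal_nonneg (h0 : ∀ st, 0 ≤ F st) (ts : ZMod B.p) (n : ℕ)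
    (st : Bool × List Data × List (ZMod B.p)) : 0 ≤ simVal A init pk α K sh ID₀ F ts n st := by
  induction n generalizing st with
  | zero =>
    rw [simVal, flagged]
    split_ifs
    · exact le_rfl
    · exact h0 _
  | succ n ih => exact avg_nonneg fun c => avg_nonneg fun r => avg_nonneg fun s => ih _

open Classical in
/-- Few challenges that have a correct response are followed by a long gap. -/
theorem avg_gap_le {p : ℕ} [NeZero p] (P : ZMod p → Prop) (K : ℕ) :
    avg (fun c => if P c ∧ found P c K = 0 then (1 : ℝ) else 0) ≤ 1 / (K + 1) := by
  let bad : Finset (ZMod p) := Finset.univ.filter fun c => P c ∧ found P c K = 0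
  have hbad {c : ZMod p} (hc : c ∈ bad) :
      P c ∧ ∀ k, 1 ≤ k → k ≤ K → ¬ P (c + (k : ZMod p)) := by
    obtain ⟨h1, h2⟩ := (Finset.mem_filter.1 hc).2
    refine ⟨h1, ?_⟩
    rcases found_spec P c K with h | h
    · exact h.2
    · omega
  -- The blocks `c, c + 1, …, c + K` of bad challenges `c` are disjoint and have `K + 1` elements:
  -- an overlap would put one bad challenge, which has a correct response, within distance `K` after
  -- another. Counting the blocks in `ZMod p` gives the bound.
  have hinj : Set.InjOn (fun x : ZMod p × ℕ => x.1 + (x.2 : ZMod p))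
      (bad ×ˢ Finset.range (K + 1) : Finset _) := by
    rintro ⟨c, i⟩ hx ⟨c', i'⟩ hx' h
    simp only [Finset.coe_product, Set.mem_prod, Finset.mem_coe, Finset.mem_range] at hx hx' h
    obtain ⟨hc, hi⟩ := hx
    obtain ⟨hc', hi'⟩ := hx'
    rcases lt_trichotomy i i' with hlt | rfl | hlt
    · exfalso
      refine (hbad hc').2 (i' - i) (by omega) (by omega) ?_
      rw [Nat.cast_sub hlt.le]
      convert (hbad hc).1 using 1
      linear_combination -h
    · rw [add_right_cancel h]
    · exfalso
      refine (hbad hc).2 (i - i') (by omega) (by omega) ?_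
      rw [Nat.cast_sub hlt.le]
      convert (hbad hc').1 using 1
      linear_combination h
  have hcard := Finset.card_le_card_of_injOn _ (fun _ _ => Finset.mem_univ _) hinj
  rw [Finset.card_product, Finset.card_range, Finset.card_univ, ZMod.card] at hcard
  have hcard' : (bad.card : ℝ) * (K + 1) ≤ p := by exact_mod_cast hcard
  have hp : (0 : ℝ) < p := by exact_mod_cast NeZero.pos p
  rw [avg, ZMod.card, Finset.sum_boole, div_le_div_iff₀ hp (by positivity), one_mul]
  exact hcard'

/-- Sampling from the units costs little. -/
theorem avg_units_le {p : ℕ} [Fact p.Prime] (f : ZMod p → ℝ) (h0 : ∀ a, 0 ≤ f a)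
    (h1 : ∀ a, f a ≤ 1) : avg (fun u : (ZMod p)ˣ => f u) ≤ avg f + 1 / p := by
  linarith [(abs_le.1 (abs_avg_units_sub_le f h0 h1)).2]

theorem avg_units_units_le {p : ℕ} [Fact p.Prime] (f : ZMod p → ZMod p → ℝ)
    (h0 : ∀ a b, 0 ≤ f a b) (h1 : ∀ a b, f a b ≤ 1) :
    avg (fun u : (ZMod p)ˣ => avg fun v : (ZMod p)ˣ => f u v) ≤
      avg (fun u => avg fun v => f u v) + 2 / p := by
  have e := avg_units_le (fun a => avg fun v : (ZMod p)ˣ => f a v)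
    (fun a => avg_nonneg fun v => h0 _ _) (fun a => avg_le_one fun v => h1 _ _)
  have e2 : avg (fun u => avg fun v : (ZMod p)ˣ => f u v) ≤
      avg (fun u => avg fun v => f u v) + 1 / p := by
    rw [← avg_add_const]
    exact avg_mono fun u => avg_units_le _ (h0 u) (h1 u)
  have e3 : (2 : ℝ) / p = 1 / p + 1 / p := by ring
  linarith

theorem avg_shift {p : ℕ} [NeZero p] (f : ZMod p → ℝ) (c : ZMod p) :
    avg (fun z => f (z + c)) = avg f :=
  avg_bij (Equiv.addRight c).bijective f

theorem avg_shift_sub {p : ℕ} [NeZero p] (f : ZMod p → ℝ) (c : ZMod p) :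
    avg (fun z => f (z - c)) = avg f :=
  avg_bij (Equiv.subRight c).bijective f

/-- The simulation loses little if the target identity already has a key. -/
theorem realVal_le_simVal (h0 : ∀ st, 0 ≤ F st) (h1 : ∀ st, F st ≤ 1) (ts : ZMod B.p)
    (n : ℕ) (st : List Data × List (ZMod B.p)) (hst : ID₀ ∈ st.2) :
    realVal A init pk α F n st ≤ simVal A init pk α K sh ID₀ F ts n (false, st) +
      n * (1 / (K + 1) + 2 / B.p) := by
  classical
  induction n generalizing st with
  | zero => simp [realVal, simVal, flagged]
  | succ n ih =>
    rw [realVal, simVal]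
    have key (c : ZMod B.p) : (if Fresh A init pk st ∧ Correct A init pk st.1 c then
        avg fun r : (ZMod B.p)ˣ => avg fun t : (ZMod B.p)ˣ =>
          realVal A init pk α F n (keyState A init pk α st c r t)
        else realVal A init pk α F n (botState st c)) ≤
        (avg fun r => avg fun s => simVal A init pk α K sh ID₀ F ts n
          (simStep A init pk α K sh ID₀ ts (false, st) c r s)) +
        (if Correct A init pk st.1 c ∧ found (Correct A init pk st.1) c K = 0 then (1 : ℝ) else 0) +
        (n * (1 / (K + 1) + 2 / B.p) + 2 / B.p) := by
      have hp : (0 : ℝ) ≤ n * (1 / (K + 1) + 2 / B.p) := by positivity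
      have hp' : (0 : ℝ) ≤ 2 / B.p := by positivity
      -- If a key is due but extraction fails, the indicator of the gap pays for the trivial bound
      -- `1`; the last two cases are refusals.
      split_ifs with hA hb hb
      · have e1 : 0 ≤ avg fun r => avg fun s => simVal A init pk α K sh ID₀ F ts n
            (simStep A init pk α K sh ID₀ ts (false, st) c r s) :=
          avg_nonneg fun r => avg_nonneg fun s => simVal_nonneg A init pk α K sh ID₀ h0 _ _ _
        have e2 : (avg fun r : (ZMod B.p)ˣ => avg fun t : (ZMod B.p)ˣ =>
            realVal A init pk α F n (keyState A init pk α st c r t)) ≤ 1 :=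
          avg_le_one fun r => avg_le_one fun t => realVal_le_one A init pk α h1 _ _
        linarith
      -- The target already has a key, so a fresh request is for another identity; there `t₁` is the
      -- free sample `s` and only `r` is shifted.
      · have hID : reqID A init pk st.1 ≠ ID₀ := fun h => hA.1.2.2 (h ▸ hst)
        have hw : rewind A init pk K st.1 c ≠ 0 := fun h => hb ⟨hA.2, h⟩
        have e2 := avg_units_units_le (fun r t => realVal A init pk α F n
          (keyState A init pk α st c r t)) (fun _ _ => realVal_nonneg A init pk α h0 _ _)
          (fun _ _ => realVal_le_one A init pk α h1 _ _)
        have e3 : (avg fun r => avg fun s => simVal A init pk α K sh ID₀ F ts n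
            (simStep A init pk α K sh ID₀ ts (false, st) c r s)) = avg fun r => avg fun s =>
              simVal A init pk α K sh ID₀ F ts n (false, keyState A init pk α st c r s) := by
          -- The shift of `r` depends on `s`, so `r` is averaged for fixed `s`, where the shift is a
          -- translation.
          rw [avg_comm, avg_comm (fun r s => simVal A init pk α K sh ID₀ F ts n
            (false, keyState A init pk α st c r s))]
          congr 1
          funext s
          rw [← avg_shift (fun r => simVal A init pk α K sh ID₀ F ts n
            (false, keyState A init pk α st c r s)) (sh (reqID A init pk st.1) *
            ((extT A init pk st.1 c (rewind A init pk K st.1 c) + s - ts) * (reqID A init pk st.1 - ID₀)⁻¹))]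
          congr 1
          funext r
          rw [simStep, if_pos hA, if_neg hw, simR, simT, if_neg hID]
          rfl
        have e4 : (avg fun r => avg fun s => realVal A init pk α F n
            (keyState A init pk α st c r s)) ≤ (avg fun r => avg fun s =>
              simVal A init pk α K sh ID₀ F ts n (false, keyState A init pk α st c r s)) +
              n * (1 / (K + 1) + 2 / B.p) := by
          rw [← avg_add_const]
          refine avg_mono fun r => ?_
          rw [← avg_add_const]
          exact avg_mono fun s => ih _ (List.mem_cons_of_mem _ hst)
        linarith
      · have e1 : 0 ≤ avg fun r => avg fun s => simVal A init pk α K sh ID₀ F ts n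
            (simStep A init pk α K sh ID₀ ts (false, st) c r s) :=
          avg_nonneg fun r => avg_nonneg fun s => simVal_nonneg A init pk α K sh ID₀ h0 _ _ _
        have e2 : realVal A init pk α F n (botState st c) ≤ 1 := realVal_le_one A init pk α h1 _ _
        linarith
      · have e1 : (avg fun r => avg fun s => simVal A init pk α K sh ID₀ F ts n
            (simStep A init pk α K sh ID₀ ts (false, st) c r s)) =
              simVal A init pk α K sh ID₀ F ts n (false, botState st c) := by
          simp only [simStep, if_neg hA, avg_const]
          rfl
        have e2 := ih (botState st c) hst
        linarith
    refine (avg_mono key).trans ?_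
    rw [avg_add_const, avg_add]
    have hg := avg_gap_le (Correct A init pk st.1) K
    push_cast
    linarith

/-- The simulation loses little. -/
theorem realVal_le_avg_simVal (h0 : ∀ st, 0 ≤ F st) (h1 : ∀ st, F st ≤ 1)
    (n : ℕ) (st : List Data × List (ZMod B.p)) :
    realVal A init pk α F n st ≤ (avg fun ts => simVal A init pk α K sh ID₀ F ts n (false, st)) +
      n * (1 / (K + 1) + 2 / B.p) := by
  classical
  induction n generalizing st with
  | zero => simp [realVal, simVal, flagged, avg_const]
  | succ n ih =>
    simp only [realVal, simVal]
    -- The challenge is moved outside. The variable `ts` stays averaged, because it supplies the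
    -- randomness of the target key once this key is requested.
    rw [avg_comm]
    have key (c : ZMod B.p) : (if Fresh A init pk st ∧ Correct A init pk st.1 c then
        avg fun r : (ZMod B.p)ˣ => avg fun t : (ZMod B.p)ˣ =>
          realVal A init pk α F n (keyState A init pk α st c r t)
        else realVal A init pk α F n (botState st c)) ≤
        (avg fun ts => avg fun r => avg fun s => simVal A init pk α K sh ID₀ F ts n
          (simStep A init pk α K sh ID₀ ts (false, st) c r s)) +
        (if Correct A init pk st.1 c ∧ found (Correct A init pk st.1) c K = 0 then (1 : ℝ) else 0) +
        (n * (1 / (K + 1) + 2 / B.p) + 2 / B.p) := by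
      have hp : (0 : ℝ) ≤ n * (1 / (K + 1) + 2 / B.p) := by positivity
      have hp' : (0 : ℝ) ≤ 2 / B.p := by positivity
      have e1 : 0 ≤ avg fun ts => avg fun r => avg fun s => simVal A init pk α K sh ID₀ F ts n
          (simStep A init pk α K sh ID₀ ts (false, st) c r s) :=
        avg_nonneg fun ts => avg_nonneg fun r => avg_nonneg fun s =>
          simVal_nonneg A init pk α K sh ID₀ h0 _ _ _
      split_ifs with hA hb hb
      · have e2 : (avg fun r : (ZMod B.p)ˣ => avg fun t : (ZMod B.p)ˣ =>
            realVal A init pk α F n (keyState A init pk α st c r t)) ≤ 1 :=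
          avg_le_one fun r => avg_le_one fun t => realVal_le_one A init pk α h1 _ _
        linarith
      · have hw : rewind A init pk K st.1 c ≠ 0 := fun h => hb ⟨hA.2, h⟩
        have e2 := avg_units_units_le (fun r t => realVal A init pk α F n
          (keyState A init pk α st c r t)) (fun _ _ => realVal_nonneg A init pk α h0 _ _)
          (fun _ _ => realVal_le_one A init pk α h1 _ _)
        -- the shift of the randomness is immaterial
        have e3 : (avg fun ts => avg fun r => avg fun s => simVal A init pk α K sh ID₀ F ts n
            (simStep A init pk α K sh ID₀ ts (false, st) c r s)) =
            avg fun s => avg fun ts => avg fun r => simVal A init pk α K sh ID₀ F ts n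
              (false, keyState A init pk α st c r (simT A init pk K ID₀ ts st.1 c s)) := by
          rw [avg_comm (fun s ts => avg fun r => simVal A init pk α K sh ID₀ F ts n
            (false, keyState A init pk α st c r (simT A init pk K ID₀ ts st.1 c s)))]
          congr 1
          funext ts
          rw [avg_comm]
          congr 1
          funext s
          rw [← avg_shift (fun r => simVal A init pk α K sh ID₀ F ts n
            (false, keyState A init pk α st c r (simT A init pk K ID₀ ts st.1 c s)))
            (sh (reqID A init pk st.1) * ((extT A init pk st.1 c
            (rewind A init pk K st.1 c) + simT A init pk K ID₀ ts st.1 c s - ts) *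
            (reqID A init pk st.1 - ID₀)⁻¹))]
          congr 1
          funext r
          rw [simStep, if_pos hA, if_neg hw, simR]
          rfl
        have e4 : (avg fun r => avg fun s => realVal A init pk α F n
            (keyState A init pk α st c r s)) ≤ (avg fun s => avg fun ts => avg fun r =>
              simVal A init pk α K sh ID₀ F ts n
              (false, keyState A init pk α st c r (simT A init pk K ID₀ ts st.1 c s))) +
              n * (1 / (K + 1) + 2 / B.p) := by
          rw [avg_comm]
          by_cases hID : reqID A init pk st.1 = ID₀
          -- For the target key `t₁ = ts - t₀`, and averaging over `ts` replaces averaging over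
          -- `t₁`. From here on `ts` is tied to the view, so the version with fixed `ts` takes over.
          · simp only [simT, if_pos hID, avg_const]
            rw [← avg_shift_sub (fun s => avg fun r => realVal A init pk α F n
              (keyState A init pk α st c r s)) (extT A init pk st.1 c (rewind A init pk K st.1 c)),
              ← avg_add_const]
            refine avg_mono fun ts => ?_
            rw [← avg_add_const]
            refine avg_mono fun r => ?_
            exact realVal_le_simVal A init pk α K sh ID₀ h0 h1 ts n _
              (by simp [keyState, hID])
          -- After the shift of `r` is absorbed, any other key is independent of `ts`, which stays
          -- available for the induction hypothesis.
          · simp only [simT, if_neg hID]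
            rw [← avg_add_const]
            refine avg_mono fun s => ?_
            rw [avg_comm, ← avg_add_const]
            exact avg_mono fun r => ih _
        linarith
      · have e2 : realVal A init pk α F n (botState st c) ≤ 1 := realVal_le_one A init pk α h1 _ _
        linarith
      · have e3 : (avg fun ts => avg fun r => avg fun s => simVal A init pk α K sh ID₀ F ts n
            (simStep A init pk α K sh ID₀ ts (false, st) c r s)) =
              avg fun ts => simVal A init pk α K sh ID₀ F ts n (false, botState st c) := by
          simp only [simStep, if_neg hA, avg_const]
          rfl
        have e2 := ih (botState st c)
        linarith
    refine (avg_mono key).trans ?_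
    rw [avg_add_const, avg_add]
    have hg := avg_gap_le (Correct A init pk st.1) K
    push_cast
    linarith

end Induction

/-! ### Independent digits and the comparison of three tests -/

section Avg

variable {α β : Type} [Fintype α] [Fintype β]

theorem avg_prod (f : α × β → ℝ) : avg f = avg fun a => avg fun b => f (a, b) := by
  simp only [avg, Fintype.sum_prod_type, Fintype.card_prod, Nat.cast_mul, Finset.sum_div, div_div]
  refine Finset.sum_congr rfl fun a _ => Finset.sum_congr rfl fun b _ => ?_
  rw [mul_comm]

theorem abs_avg_sub_le [Nonempty α] {f g : α → ℝ} {c : ℝ} (h : ∀ a, |f a - g a| ≤ c) :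
    |avg f - avg g| ≤ c := by
  rw [← avg_sub]
  exact abs_avg_le h

theorem abs_avgR_sub_le {n : ℕ} (hn : 0 < n) {f g : ℕ → ℝ} {c : ℝ} (h : ∀ a, |f a - g a| ≤ c) :
    |avgR n f - avgR n g| ≤ c := by
  have : Nonempty (Fin n) := ⟨⟨0, hn⟩⟩
  rw [avgR_eq, avgR_eq]
  exact abs_avg_sub_le fun a => h a

/-- The digits of a random number are independent. -/
theorem avgR_digits {p : ℕ} [NeZero p] (n : ℕ) (f : (Fin n → ZMod p) → ℝ) :
    avgR (p ^ n) (fun w => f fun i => ((w / p ^ (i : ℕ) : ℕ) : ZMod p)) = avg f := by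
  induction n with
  | zero =>
    rw [pow_zero, avgR, avg, Finset.sum_range_one, Fintype.sum_unique, Fintype.card_unique]
    congr 2
    exact Subsingleton.elim _ _
  | succ n ih =>
    let F (c w : ℕ) : ℝ := f (Fin.cons (c : ZMod p) fun i : Fin n =>
      ((w / p ^ (i : ℕ) : ℕ) : ZMod p))
    have e : (fun w => f fun i : Fin (n + 1) => ((w / p ^ (i : ℕ) : ℕ) : ZMod p)) = fun w =>
        F (w % p) (w / p) := by
      funext w
      simp only [F]
      congr 1
      funext i
      refine Fin.cases ?_ (fun i => ?_) i
      · simp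
      · simp [Nat.div_div_eq_div_mul, pow_succ']
    rw [e, pow_succ', avgR_mul]
    have h (c : ℕ) : (avgR (p ^ n) fun w => F c w) = avg fun v => f (Fin.cons (c : ZMod p) v) :=
      ih fun v => f (Fin.cons (c : ZMod p) v)
    simp only [h]
    rw [avgR_cast (fun c => avg fun v => f (Fin.cons c v))]
    have hb : Function.Bijective fun x : ZMod p × (Fin n → ZMod p) =>
        (Fin.cons x.1 x.2 : Fin (n + 1) → ZMod p) :=
      (Fin.consEquiv fun _ : Fin (n + 1) => ZMod p).bijective
    rw [← avg_bij hb, avg_prod]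

open Classical in
/-- The indicator of a proposition. -/
noncomputable def ind (P : Prop) : ℝ := if P then 1 else 0

theorem ind_nonneg (P : Prop) : 0 ≤ ind P := by
  rw [ind]; split_ifs <;> simp

theorem ind_le_one (P : Prop) : ind P ≤ 1 := by
  rw [ind]; split_ifs <;> simp

theorem Pr_pure_beq (a b : ℕ) : Pr (PMF.pure (a == b)) = ind (a = b) := by
  rw [Pr_pure, ind]
  by_cases h : a = b <;> simp [h]

/-- The outcome of three tests of which the third one is compared with the others. -/
def Verd (R P C : Prop) : Prop := R ∧ ¬ P ∧ C ∨ ¬ R ∧ P ∧ ¬ C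

theorem ind_verd (R P C : Prop) : ind (Verd R P C) =
    ind R * (1 - ind P) * ind C + (1 - ind R) * ind P * (1 - ind C) := by
  by_cases hR : R <;> by_cases hP : P <;> by_cases hC : C <;> simp [ind, Verd, hR, hP, hC]

/-- The three tests are independent. With success probabilities `r`, `x`, `c` the value is affine in
`c` with slope `r (1 - x) - (1 - r) x = r - x`, so the values at `c = r` and `c = x` differ by `(r -
x) ^ 2`, whatever the sign of `r - x`. -/
theorem avg_verd {γ : Type} [Fintype γ] [Nonempty α] [Nonempty β] [Nonempty γ] (R : α → Prop)
    (P : β → Prop) (C : γ → Prop) : (avg fun x => avg fun y => avg fun z => ind (Verd (R x) (P y) (C z))) =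
    (avg fun x => ind (R x)) * (1 - avg fun y => ind (P y)) * (avg fun z => ind (C z)) +
      (1 - avg fun x => ind (R x)) * (avg fun y => ind (P y)) * (1 - avg fun z => ind (C z)) := by
  simp only [ind_verd, avg_add, avg_const_mul, avg_mul_const, avg_sub, avg_const]

end Avg

section Tape

variable {B : BilinearGroup} {N : ℕ} (A : DishonestUser) (init : Data) (pk : PublicKey B N)
  (α : (ZMod B.p)ˣ) (K : ℕ) (sh : ZMod B.p → ZMod B.p) (ID₀ ts : ZMod B.p)

/-- Only the `3 * n` lowest digits of the tape are read. This allows the sampling error to be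
estimated with a power of `p` as modulus. -/
theorem simRun_mod (n : ℕ) (st : Bool × List Data × List (ZMod B.p)) (w : ℕ) :
    simRun A init pk α K sh ID₀ ts n st (w % B.p ^ (3 * n)) =
      simRun A init pk α K sh ID₀ ts n st w := by
  induction n generalizing st w with
  | zero => rfl
  | succ n ih =>
    have e : B.p ^ (3 * (n + 1)) = B.p * (B.p * (B.p * B.p ^ (3 * n))) := by ring
    have c (w M : ℕ) : ((w % (B.p * M) : ℕ) : ZMod B.p) = w := by
      rw [← ZMod.natCast_mod, Nat.mod_mul_right_mod, ZMod.natCast_mod]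
    simp only [simRun, e, c, Nat.mod_mul_right_div_self, ih]

end Tape

/-! ### The answer of the reduction as a function of its random choices -/

section Typed

variable {B : BilinearGroup} {N : ℕ}

/-- The public key that the simulation uses. -/
def simPk (hN : 1 ≤ N) (g : B.G) (a ID γ θ ts δ : ZMod B.p) (ah : Fin (N + 1) → ZMod B.p) :
    PublicKey B N where
  g := g
  g₁ := pw g a
  g₂ := pw g (a ^ (N + 1) + γ)
  g₃ := pw g (θ - ts * (a ^ (N + 1) + γ))
  z := pw g (δ + ID * ah 0 - ah ⟨1, by omega⟩)
  h := fun i => pw g (ah i)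

/-- The input of the user. -/
def userInput (B : BilinearGroup) (κ N ρ : ℕ) : Data :=
  .pair (B.params κ) (.pair (.num N) (.num ρ))

/-- The target identity. -/
def target (A : DishonestUser) (B : BilinearGroup) (κ N ρ : ℕ) : ZMod B.p :=
  B.readZ (A.choose.run (userInput B κ N ρ))

open Classical in
/-- The value of a function at the view and the key of the user, if the key is valid. -/
noncomputable def onKey (A : DishonestUser) (init : Data) (pk : PublicKey B N) (ID : ZMod B.p)
    (φ : Data → Key B N → ℝ) (st : List Data × List (ZMod B.p)) : ℝ :=
  match Key.read B N (A.output.run (view init pk st.1)) with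
  | none => 0
  | some K => if K.Valid pk ID then φ (view init pk st.1) K else 0

section Tests

variable (A : DishonestUser) (pk : PublicKey B N) (ID : ZMod B.p) (v : Data) (K : Key B N)

/-- The device opens an honest ciphertext. -/
def HonestTest (s : ZMod B.p) (m : B.GT) (w : ℕ) : Prop :=
  Opens A v K ID (pw pk.g s) (pw (receiverElt pk {ID}) s) (pw (B.e pk.g₁ pk.g₂) s) m w

/-- The device opens a ciphertext of the tracing algorithm. -/
def ProbeTest (s : ZMod B.p) (C₃ m : B.GT) (w : ℕ) : Prop :=
  Opens A v K ID (pw pk.g s) (pw (receiverElt pk {ID}) s) C₃ m w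

/-- The device opens a ciphertext that is made of the challenge. -/
def ChalTest (h : B.G) (T : B.GT) (δ γ : ZMod B.p) (m : B.GT) (w : ℕ) : Prop :=
  Opens A v K ID h (pw h δ) (T * pw (B.e pk.g₁ h) γ) m w

variable (κ : ℕ)

/-- The probability that the device opens an honest ciphertext with exponent `s`. -/
noncomputable def honestAt (s : ZMod B.p) : ℝ :=
  avg fun m : B.GT => avg fun w : Fin (2 ^ A.deviceCoins.eval κ) =>
    ind (HonestTest A pk ID v K s m w)

/-- The probability that the device opens a ciphertext of the tracing algorithm with exponent
`s`. -/
noncomputable def probeAt (s : ZMod B.p) : ℝ :=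
  avg fun C₃ : B.GT => avg fun m : B.GT => avg fun w : Fin (2 ^ A.deviceCoins.eval κ) =>
    ind (ProbeTest A pk ID v K s C₃ m w)

/-- The squared difference of the two probabilities. -/
noncomputable def gap : ℝ := (avg (honestAt A pk ID v K κ) - avg (probeAt A pk ID v K κ)) ^ 2

end Tests

variable (A : DishonestUser) (κ : ℕ) (hN : 1 ≤ N) (g : B.G) (α : (ZMod B.p)ˣ) (k : ℕ)
  (sh : ZMod B.p → ZMod B.p)

/-- The final state of the simulation. -/
noncomputable def simEnd (ρ : ℕ) (pk : PublicKey B N) (ts : ZMod B.p) (τ : ℕ) :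
    Bool × List Data × List (ZMod B.p) :=
  simRun A (userInput B κ N ρ) pk α k sh (target A B κ N ρ) ts (A.queries.eval κ) (false, [], []) τ

/-- The exponents of the elements `h_i`. -/
def expo (a : ZMod B.p) (b : Fin (N + 1) → ZMod B.p) (i : Fin (N + 1)) : ZMod B.p :=
  b i + a ^ (N + 1 - (i : ℕ))

/-- The answer of the reduction, as a function of its random choices. -/
noncomputable def outVal (h : B.G) (T : B.GT) (ρ w₀ w₁ w₂ : ℕ) (d : Fin 10 → ZMod B.p)
    (b : Fin (N + 1) → ZMod B.p) (τ : ℕ) : ℝ :=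
  flagged (onKey A (userInput B κ N ρ)
    (simPk hN g α (target A B κ N ρ) (d 6) (d 7) (d 8) (d 9) (expo (α : ZMod B.p) b)) (target A B κ N ρ)
    fun v K => ind (Verd
      (HonestTest A (simPk hN g α (target A B κ N ρ) (d 6) (d 7) (d 8) (d 9) (expo (α : ZMod B.p) b))
        (target A B κ N ρ) v K (d 0) (pw (B.e g g) (d 1)) w₀)
      (ProbeTest A (simPk hN g α (target A B κ N ρ) (d 6) (d 7) (d 8) (d 9) (expo (α : ZMod B.p) b))
        (target A B κ N ρ) v K (d 2) (pw (B.e g g) (d 3)) (pw (B.e g g) (d 4)) w₁)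
      (ChalTest A (simPk hN g α (target A B κ N ρ) (d 6) (d 7) (d 8) (d 9) (expo (α : ZMod B.p) b))
        (target A B κ N ρ) v K h T (d 9) (d 6) (pw (B.e g g) (d 5)) w₂)))
    (simEnd A κ α k sh ρ
      (simPk hN g α (target A B κ N ρ) (d 6) (d 7) (d 8) (d 9) (expo (α : ZMod B.p) b)) (d 8) τ)

variable {A κ hN g α k sh}

theorem onKey_nonneg {init : Data} {pk : PublicKey B N} {ID : ZMod B.p} {φ : Data → Key B N → ℝ}
    (h : ∀ v K, 0 ≤ φ v K) (st : List Data × List (ZMod B.p)) : 0 ≤ onKey A init pk ID φ st := by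
  rw [onKey]
  split
  · exact le_rfl
  · split_ifs
    · exact h _ _
    · exact le_rfl

theorem onKey_le_one {init : Data} {pk : PublicKey B N} {ID : ZMod B.p} {φ : Data → Key B N → ℝ}
    (h : ∀ v K, φ v K ≤ 1) (st : List Data × List (ZMod B.p)) : onKey A init pk ID φ st ≤ 1 := by
  rw [onKey]
  split
  · exact zero_le_one
  · split_ifs
    · exact h _ _
    · exact zero_le_one

theorem flagged_nonneg {F : List Data × List (ZMod B.p) → ℝ} (h : ∀ st, 0 ≤ F st)
    (st : Bool × List Data × List (ZMod B.p)) : 0 ≤ flagged F st := by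
  rw [flagged]
  split_ifs
  · exact le_rfl
  · exact h _

theorem flagged_le_one {F : List Data × List (ZMod B.p) → ℝ} (h : ∀ st, F st ≤ 1)
    (st : Bool × List Data × List (ZMod B.p)) : flagged F st ≤ 1 := by
  rw [flagged]
  split_ifs
  · exact zero_le_one
  · exact h _

theorem outVal_nonneg (h : B.G) (T : B.GT) (ρ w₀ w₁ w₂ : ℕ) (d : Fin 10 → ZMod B.p)
    (b : Fin (N + 1) → ZMod B.p) (τ : ℕ) : 0 ≤ outVal A κ hN g α k sh h T ρ w₀ w₁ w₂ d b τ :=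
  flagged_nonneg (onKey_nonneg fun _ _ => ind_nonneg _) _

theorem outVal_le_one (h : B.G) (T : B.GT) (ρ w₀ w₁ w₂ : ℕ) (d : Fin 10 → ZMod B.p)
    (b : Fin (N + 1) → ZMod B.p) (τ : ℕ) : outVal A κ hN g α k sh h T ρ w₀ w₁ w₂ d b τ ≤ 1 :=
  flagged_le_one (onKey_le_one fun _ _ => ind_le_one _) _

variable {γ' : Type} [Fintype γ']

/-- Failure of the simulation and the user's key are settled before the device is tested, so an
average over the choices made for the tests passes inside. -/
theorem avg_flagged_onKey [Nonempty γ'] {init : Data} {pk : PublicKey B N} {ID : ZMod B.p}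
    (φ : γ' → Data → Key B N → ℝ) (st : Bool × List Data × List (ZMod B.p)) :
    (avg fun c => flagged (onKey A init pk ID (φ c)) st) =
      flagged (onKey A init pk ID fun v K => avg fun c => φ c v K) st := by
  unfold flagged onKey
  rcases st with ⟨fl, ans, l⟩
  cases fl
  · simp only [Bool.false_eq_true, if_false]
    rcases Key.read B N (A.output.run (view init pk ans)) with _ | K
    · simp only [avg_const]
    · by_cases h : K.Valid pk ID <;> simp only [h, if_true, if_false, avg_const]
  · simp only [if_true, avg_const]

theorem flagged_onKey_sub {init : Data} {pk : PublicKey B N} {ID : ZMod B.p}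
    (φ ψ : Data → Key B N → ℝ) (st : Bool × List Data × List (ZMod B.p)) :
    flagged (onKey A init pk ID φ) st - flagged (onKey A init pk ID ψ) st =
      flagged (onKey A init pk ID fun v K => φ v K - ψ v K) st := by
  unfold flagged onKey
  rcases st with ⟨fl, ans, l⟩
  cases fl
  · simp only [Bool.false_eq_true, if_false]
    rcases Key.read B N (A.output.run (view init pk ans)) with _ | K
    · simp
    · by_cases h : K.Valid pk ID <;> simp only [h, if_true, if_false, sub_self]
  · simp only [if_true, sub_self]

theorem simEnd_mod (ρ : ℕ) (pk : PublicKey B N) (ts : ZMod B.p) (τ : ℕ) :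
    simEnd A κ α k sh ρ pk ts (τ % B.p ^ (3 * A.queries.eval κ)) = simEnd A κ α k sh ρ pk ts τ :=
  simRun_mod _ _ _ _ _ _ _ _ _ _ _

end Typed

/-! ### Reading the random choices from the coins -/

namespace Ctx

variable {S : Sim} (C : Ctx S)

theorem ind_out (hK : S.Kq.eval C.κ < C.B.p) : ind (S.out C.x = 1) =
    outVal S.A C.κ C.hN C.g C.α (S.Kq.eval C.κ) C.Q C.h C.T (S.rho C.x) (S.dev C.x 0) (S.dev C.x 1)
      (S.dev C.x 2) (fun i => C.d i) (fun i => C.b i) (S.tape' C.x) := by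
  have e : outVal S.A C.κ C.hN C.g C.α (S.Kq.eval C.κ) C.Q C.h C.T (S.rho C.x) (S.dev C.x 0)
      (S.dev C.x 1) (S.dev C.x 2) (fun i => C.d i) (fun i => C.b i) (S.tape' C.x) =
      flagged (onKey S.A C.init C.pk C.ID fun v K => ind (Verd
        (HonestTest S.A C.pk C.ID v K (C.d 0) (pw (C.B.e C.g C.g) (C.d 1)) (S.dev C.x 0))
        (ProbeTest S.A C.pk C.ID v K (C.d 2) (pw (C.B.e C.g C.g) (C.d 3))
          (pw (C.B.e C.g C.g) (C.d 4)) (S.dev C.x 1))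
        (ChalTest S.A C.pk C.ID v K C.h C.T C.δ C.γ (pw (C.B.e C.g C.g) (C.d 5)) (S.dev C.x 2))))
      C.run := rfl
  rw [e, flagged, onKey]
  have h := C.out_x hK
  change _ ↔ C.run.1 = false ∧ ∃ K, C.key = some K ∧ K.Valid C.pk C.ID ∧
    Verd (C.okR K) (C.okP K) (C.okC K) at h
  rw [h]
  cases hf : C.run.1
  · simp only [Bool.false_eq_true, if_false, true_and]
    rcases hk : C.key with _ | K
    · have hk' : Key.read C.B C.N (S.A.output.run (view C.init C.pk C.run.2.1)) = none := hk
      simp [hk', ind]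
    · have hk' : Key.read C.B C.N (S.A.output.run (view C.init C.pk C.run.2.1)) = some K := hk
      rw [hk']
      by_cases hV : K.Valid C.pk C.ID
      · simp only [hV, if_true, Option.some.injEq]
        congr 1
        refine propext ⟨?_, fun h => ⟨K, rfl, hV, h⟩⟩
        rintro ⟨K', rfl, -, h⟩
        exact h
      · simp only [hV, if_false]
        rw [ind, if_neg]
        rintro ⟨K', h1, h2, -⟩
        rw [Option.some.injEq] at h1
        exact hV (h1 ▸ h2)
  · simp [ind]

end Ctx

/-- Reading three samples from a long tape. -/
theorem abs_avgR_tape_le (X a b c : ℕ) (hX : 0 < X) (ha : 0 < a) (hb : 0 < b) (hc : 0 < c)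
    (H : ℕ → ℕ → ℕ → ℝ) (h0 : ∀ u v w, 0 ≤ H u v w) (h1 : ∀ u v w, H u v w ≤ 1)
    (hmod : ∀ u v w, H u v (w % c) = H u v w) :
    |avgR X (fun t => H (t % a) (t / a % b) (t / a / b)) -
      avgR a (fun u => avgR b fun v => avgR c fun w => H u v w)| ≤ (a * (b * c) : ℕ) / X := by
  let f (t : ℕ) : ℝ := H (t % a) (t / a % b) (t / a / b)
  have hf (t : ℕ) : f (t % (a * (b * c))) = f t := by
    simp only [f, Nat.mod_mul_right_mod, Nat.mod_mul_right_div_self, hmod]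
  have h := avgR_mod X (a * (b * c)) hX (by positivity) f (fun _ => h0 _ _ _) (fun _ => h1 _ _ _)
  simp only [hf] at h
  have e1 : avgR (a * (b * c)) f = avgR a fun u => avgR (b * c) fun t => H u (t % b) (t / b) :=
    avgR_mul a (b * c) fun u t => H u (t % b) (t / b)
  have e2 (u : ℕ) : (avgR (b * c) fun t => H u (t % b) (t / b)) =
      avgR b fun v => avgR c fun w => H u v w := avgR_mul b c (H u)
  rw [e1] at h
  simpa only [e2] using h

theorem cast_mod_pow_div (p n i t : ℕ) (hi : i < n) :
    ((t % p ^ n / p ^ i : ℕ) : ZMod p) = (t / p ^ i : ℕ) := by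
  obtain ⟨m, rfl⟩ : ∃ m, n = i + (1 + m) := ⟨n - i - 1, by omega⟩
  rw [pow_add, pow_add, pow_one, Nat.mod_mul_right_div_self, ← ZMod.natCast_mod,
    Nat.mod_mul_right_mod, ZMod.natCast_mod]

theorem avgR_mul₄ (a b n : ℕ) (F : ℕ → ℕ → ℕ → ℕ → ℕ → ℝ) :
    avgR (a * (b * (b * (b * n)))) (fun w => F (w % a) (w / a % b) (w / a / b % b)
      (w / a / b / b % b) (w / a / b / b / b)) =
    avgR a fun r => avgR b fun x => avgR b fun y => avgR b fun z => avgR n fun t => F r x y z t := by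
  have e1 := avgR_mul a (b * (b * (b * n))) fun r w =>
    F r (w % b) (w / b % b) (w / b / b % b) (w / b / b / b)
  have e2 (r : ℕ) := avgR_mul b (b * (b * n)) fun x w => F r x (w % b) (w / b % b) (w / b / b)
  have e3 (r x : ℕ) := avgR_mul b (b * n) fun y w => F r x y (w % b) (w / b)
  have e4 (r x y : ℕ) := avgR_mul b n fun z w => F r x y z w
  simp only [e2, e3, e4] at e1
  exact e1

namespace Ctx

variable {S : Sim} (C : Ctx S)

/-- The challenge with other coins. -/
def withCoins (ω : ℕ) : Ctx S := { C with ω := ω }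

/-- The number of coins that the reduction uses, with `X` coins for the sampling of exponents. -/
def coinLen (X : ℕ) : ℕ := S.A.coins.eval C.κ + (S.A.deviceCoins.eval C.κ +
  (S.A.deviceCoins.eval C.κ + (S.A.deviceCoins.eval C.κ + X)))

/-- The number of samples modulo the group order. -/
def tapeLen : ℕ := 10 + (C.N + 1 + 3 * S.A.queries.eval C.κ)

/-- The coins of the user and of the three device runs are read without error, as their numbers are
powers of two. Only the samples modulo `p` are inexact: ten exponents, the `bᵢ`, and three per
protocol, all taken from `X` bits. -/
theorem avgR_out (hK : S.Kq.eval C.κ < C.B.p) (X : ℕ) :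
    |avgR (2 ^ C.coinLen X) (fun ω => ind (S.out (C.withCoins ω).x = 1)) -
      avgR (2 ^ S.A.coins.eval C.κ) (fun ρ => avg fun w₀ : Fin (2 ^ S.A.deviceCoins.eval C.κ) =>
        avg fun w₁ : Fin (2 ^ S.A.deviceCoins.eval C.κ) =>
        avg fun w₂ : Fin (2 ^ S.A.deviceCoins.eval C.κ) => avg fun d => avg fun b =>
          avg fun τ : Fin (C.B.p ^ (3 * S.A.queries.eval C.κ)) =>
        outVal S.A C.κ C.hN C.g C.α (S.Kq.eval C.κ) C.Q C.h C.T ρ w₀ w₁ w₂ d b τ)| ≤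
    (C.B.p ^ C.tapeLen : ℕ) / (2 ^ X : ℕ) := by
  have hp := C.B.prime.out.pos
  let H (ρ w₀ w₁ w₂ u v w : ℕ) : ℝ := outVal S.A C.κ C.hN C.g C.α (S.Kq.eval C.κ) C.Q C.h C.T ρ
    w₀ w₁ w₂ (fun i => (u / C.B.p ^ (i : ℕ) : ℕ)) (fun i => (v / C.B.p ^ (i : ℕ) : ℕ)) w
  let F (ρ w₀ w₁ w₂ t : ℕ) : ℝ := H ρ w₀ w₁ w₂
    (t % C.B.p ^ 10) (t / C.B.p ^ 10 % C.B.p ^ (C.N + 1)) (t / C.B.p ^ 10 / C.B.p ^ (C.N + 1))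
  have hH (ω : ℕ) : ind (S.out (C.withCoins ω).x = 1) = F
      (ω % 2 ^ S.A.coins.eval C.κ)
      (ω / 2 ^ S.A.coins.eval C.κ % 2 ^ S.A.deviceCoins.eval C.κ)
      (ω / 2 ^ S.A.coins.eval C.κ / 2 ^ S.A.deviceCoins.eval C.κ % 2 ^ S.A.deviceCoins.eval C.κ)
      (ω / 2 ^ S.A.coins.eval C.κ / 2 ^ S.A.deviceCoins.eval C.κ / 2 ^ S.A.deviceCoins.eval C.κ %
        2 ^ S.A.deviceCoins.eval C.κ)
      (ω / 2 ^ S.A.coins.eval C.κ / 2 ^ S.A.deviceCoins.eval C.κ / 2 ^ S.A.deviceCoins.eval C.κ /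
        2 ^ S.A.deviceCoins.eval C.κ) := by
    have hu : S.userCoins (C.withCoins ω).x = 2 ^ S.A.coins.eval C.κ := by
      rw [Sim.userCoins, kap_x]; rfl
    have hd : S.devCoins (C.withCoins ω).x = 2 ^ S.A.deviceCoins.eval C.κ := by
      rw [Sim.devCoins, kap_x]; rfl
    have ht : S.tape (C.withCoins ω).x = ω / 2 ^ S.A.coins.eval C.κ /
        2 ^ S.A.deviceCoins.eval C.κ / 2 ^ S.A.deviceCoins.eval C.κ /
        2 ^ S.A.deviceCoins.eval C.κ := by
      rw [Sim.tape, hu, hd, pow_succ, pow_two, ← Nat.div_div_eq_div_mul, ← Nat.div_div_eq_div_mul]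
      rfl
    have h1 := (C.withCoins ω).ind_out hK
    have ho : Sim.ord (C.withCoins ω).x = C.B.p := ord_x _
    have hn : S.nn (C.withCoins ω).x = C.N := nn_x _
    rw [h1]
    simp only [F, H]
    have e1 : S.rho (C.withCoins ω).x = ω % 2 ^ S.A.coins.eval C.κ := by
      rw [Sim.rho, hu]; rfl
    have e2 : S.dev (C.withCoins ω).x 0 =
        ω / 2 ^ S.A.coins.eval C.κ % 2 ^ S.A.deviceCoins.eval C.κ := by
      rw [Sim.dev, hu, hd, show min 0 3 = 0 from rfl, pow_zero, Nat.div_one]; rfl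
    have e3 : S.dev (C.withCoins ω).x 1 = ω / 2 ^ S.A.coins.eval C.κ /
        2 ^ S.A.deviceCoins.eval C.κ % 2 ^ S.A.deviceCoins.eval C.κ := by
      rw [Sim.dev, hu, hd, show min 1 3 = 1 from rfl, pow_one]; rfl
    have e4 : S.dev (C.withCoins ω).x 2 = ω / 2 ^ S.A.coins.eval C.κ /
        2 ^ S.A.deviceCoins.eval C.κ / 2 ^ S.A.deviceCoins.eval C.κ %
        2 ^ S.A.deviceCoins.eval C.κ := by
      rw [Sim.dev, hu, hd, show min 2 3 = 2 from rfl, pow_two, ← Nat.div_div_eq_div_mul]; rfl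
    have e5 : (fun i : Fin 10 => (C.withCoins ω).d i) = fun i : Fin 10 =>
        ((S.tape (C.withCoins ω).x % C.B.p ^ 10 / C.B.p ^ (i : ℕ) : ℕ) : ZMod C.B.p) := by
      funext i
      rw [cast_mod_pow_div _ _ _ _ i.2, d, Sim.dig, ho, min_eq_left i.2.le]
      exact ZMod.natCast_mod _ _
    have e6 : (fun i : Fin (C.N + 1) => (C.withCoins ω).b i) = fun i : Fin (C.N + 1) =>
        ((S.tape (C.withCoins ω).x / C.B.p ^ 10 % C.B.p ^ (C.N + 1) / C.B.p ^ (i : ℕ) : ℕ) :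
          ZMod C.B.p) := by
      funext i
      rw [cast_mod_pow_div _ _ _ _ i.2, b, Sim.bb, ho, hn, min_eq_left (Nat.lt_succ_iff.1 i.2)]
      exact ZMod.natCast_mod _ _
    have e7 : S.tape' (C.withCoins ω).x =
        S.tape (C.withCoins ω).x / C.B.p ^ 10 / C.B.p ^ (C.N + 1) := by
      rw [Sim.tape', ho, hn]
    rw [← ht, ← e1, ← e2, ← e3, ← e4, ← e7, ← e5, ← e6]
    rfl
  rw [funext hH]
  have e : 2 ^ C.coinLen X = 2 ^ S.A.coins.eval C.κ * (2 ^ S.A.deviceCoins.eval C.κ *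
      (2 ^ S.A.deviceCoins.eval C.κ * (2 ^ S.A.deviceCoins.eval C.κ * 2 ^ X))) := by
    rw [coinLen, pow_add, pow_add, pow_add, pow_add]
  rw [e, avgR_mul₄ _ _ _ F]
  have e' : C.B.p ^ C.tapeLen = C.B.p ^ 10 * (C.B.p ^ (C.N + 1) *
    C.B.p ^ (3 * S.A.queries.eval C.κ)) := by rw [tapeLen, pow_add, pow_add]
  rw [e']
  have : Nonempty (Fin (2 ^ S.A.deviceCoins.eval C.κ)) := ⟨⟨0, by positivity⟩⟩
  refine abs_avgR_sub_le (by positivity) fun ρ => ?_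
  rw [avgR_eq]
  refine abs_avg_sub_le fun w₀ => ?_
  rw [avgR_eq]
  refine abs_avg_sub_le fun w₁ => ?_
  rw [avgR_eq]
  refine abs_avg_sub_le fun w₂ => ?_
  have h := abs_avgR_tape_le (2 ^ X) (C.B.p ^ 10) (C.B.p ^ (C.N + 1))
    (C.B.p ^ (3 * S.A.queries.eval C.κ)) (by positivity) (by positivity) (by positivity)
    (by positivity) (H ρ w₀ w₁ w₂) (fun _ _ _ => outVal_nonneg _ _ _ _ _ _ _ _ _)
    (fun _ _ _ => outVal_le_one _ _ _ _ _ _ _ _ _) (fun u v w => by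
      simp only [H, outVal, simEnd_mod])
  convert h using 3
  rw [← avgR_digits]
  congr 1
  funext u
  rw [← avgR_digits]
  congr 1
  funext v
  rw [avgR_eq]

end Ctx

/-! ### The advantage as an average squared gap -/

section Typed

variable {B : BilinearGroup} {N : ℕ} (A : DishonestUser) (κ : ℕ) (hN : 1 ≤ N) {g : B.G}
  (α : (ZMod B.p)ˣ) (k : ℕ) (sh : ZMod B.p → ZMod B.p)

section Tests

variable (pk : PublicKey B N) (ID : ZMod B.p) (v : Data) (K : Key B N)

theorem avg_pw {H : Type} [CommGroup H] [Fintype H] (hc : Fintype.card H = B.p) {y : H} (hy : y ≠ 1)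
    (f : H → ℝ) : (avg fun z : ZMod B.p => f (pw y z)) = avg f := avg_bij (pw_bijective hc hy) f

theorem avg_honestTest (hg : g ≠ 1) : (avg fun x : ZMod B.p × ZMod B.p ×
    Fin (2 ^ A.deviceCoins.eval κ) => ind (HonestTest A pk ID v K x.1 (pw (B.e g g) x.2.1) x.2.2)) =
      avg (honestAt A pk ID v K κ) := by
  simp only [avg_prod]
  congr 1
  funext s
  exact avg_pw B.card_GT (B.e_self_ne_one hg) fun m => avg fun w : Fin (2 ^ A.deviceCoins.eval κ) =>
    ind (HonestTest A pk ID v K s m w)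

theorem avg_probeTest (hg : g ≠ 1) : (avg fun x : ZMod B.p × ZMod B.p × ZMod B.p ×
    Fin (2 ^ A.deviceCoins.eval κ) => ind (ProbeTest A pk ID v K x.1 (pw (B.e g g) x.2.1)
      (pw (B.e g g) x.2.2.1) x.2.2.2)) = avg (probeAt A pk ID v K κ) := by
  simp only [avg_prod]
  congr 1
  funext s
  rw [probeAt, ← avg_pw B.card_GT (B.e_self_ne_one hg)]
  congr 1
  funext z
  exact avg_pw B.card_GT (B.e_self_ne_one hg) fun m => avg fun w : Fin (2 ^ A.deviceCoins.eval κ) =>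
    ind (ProbeTest A pk ID v K s (pw (B.e g g) z) m w)

variable {pk ID} {δ γ : ZMod B.p}

/-- With `h = g ^ s` the second component is right because the receiver element is `g ^ δ`. The
third is right because `α ^ (N + 2) + α * γ` is the product of the exponents of `g₁` and `g₂`. Thus
the challenge becomes an honest ciphertext whose exponent `s` is unknown to the reduction. -/
theorem avg_chalTest_real (hg : g ≠ 1) (hpg : pk.g = g) (hpg₁ : pk.g₁ = pw g (α : ZMod B.p))
    (hpg₂ : pk.g₂ = pw g ((α : ZMod B.p) ^ (N + 1) + γ)) (hr : receiverElt pk {ID} = pw g δ) :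
    (avg fun x : B.G × B.GT × ZMod B.p × Fin (2 ^ A.deviceCoins.eval κ) =>
      ind (ChalTest A pk ID v K x.1 (B.e g x.1 ^ ((α : ZMod B.p) ^ (N + 1 + 1)).val) δ γ
        (pw (B.e g g) x.2.2.1) x.2.2.2)) = avg (honestAt A pk ID v K κ) := by
  have : Nonempty (Fin (2 ^ A.deviceCoins.eval κ)) := ⟨⟨0, by positivity⟩⟩
  simp only [avg_prod, avg_const]
  rw [← avg_pw B.card_G hg]
  congr 1
  funext s
  rw [honestAt, ← avg_pw B.card_GT (B.e_self_ne_one hg)]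
  congr 1
  funext z
  congr 1
  funext w
  have e1 : pw (pw g s) δ = pw (pw g δ) s := by
    rw [← pw_mul B.card_G, ← pw_mul B.card_G, mul_comm]
  have e2 : B.e g (pw g s) ^ ((α : ZMod B.p) ^ (N + 1 + 1)).val * pw (B.e pk.g₁ (pw g s)) γ =
      pw (B.e pk.g₁ pk.g₂) s := by
    change pw _ _ * _ = _
    rw [hpg₁, hpg₂, B.e_pw_right, B.e_pw, B.e_pw, ← pw_mul B.card_GT, ← pw_mul B.card_GT,
      ← pw_mul B.card_GT, ← pw_add B.card_GT]
    congr 1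
    ring
  rw [ChalTest, HonestTest, e1, e2, hpg, hr]

/-- Multiplication by the correction factor permutes `GT`, so for uniform `T` the third component is
uniform and independent of `s`, as in tracing. -/
theorem avg_chalTest_rand (hg : g ≠ 1) (hpg : pk.g = g) (hr : receiverElt pk {ID} = pw g δ) :
    (avg fun x : B.G × B.GT × ZMod B.p × Fin (2 ^ A.deviceCoins.eval κ) =>
      ind (ChalTest A pk ID v K x.1 x.2.1 δ γ (pw (B.e g g) x.2.2.1) x.2.2.2)) =
        avg (probeAt A pk ID v K κ) := by
  simp only [avg_prod]
  rw [← avg_pw B.card_G hg]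
  congr 1
  funext s
  rw [probeAt, ← avg_bij (Equiv.mulRight (pw (B.e pk.g₁ (pw g s)) γ)).bijective fun C₃ =>
    avg fun m => avg fun w : Fin (2 ^ A.deviceCoins.eval κ) => ind (ProbeTest A pk ID v K s C₃ m w)]
  congr 1
  funext U
  rw [← avg_pw B.card_GT (B.e_self_ne_one hg)]
  congr 1
  funext z
  congr 1
  funext w
  have e1 : pw (pw g s) δ = pw (pw g δ) s := by
    rw [← pw_mul B.card_G, ← pw_mul B.card_G, mul_comm]
  rw [ChalTest, ProbeTest, e1, hpg, hr]
  rfl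

end Tests

theorem receiverElt_simPk (a ID γ θ ts δ : ZMod B.p) (ah : Fin (N + 1) → ZMod B.p) :
    receiverElt (simPk hN g a ID γ θ ts δ ah) {ID} = pw g δ := by
  rw [receiverElt_singleton hN]
  simp only [simPk, ← pw_mul B.card_G, ← pw_add B.card_G]
  congr 1
  ring

/-- The random choices of the reduction and of the experiment, as the choices of the simulation and
of three tests of the device. -/
def regroup {G GT U Z V M W : Type} :
    ((U × (Z × Z × Z × Z) × V × M) × (Z × Z × W) × (Z × Z × Z × W) × (G × GT × Z × W)) ≃
      G × GT × U × W × W × W × (Fin 10 → Z) × V × M where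
  toFun x := (x.2.2.2.1, x.2.2.2.2.1, x.1.1, x.2.1.2.2, x.2.2.1.2.2.2, x.2.2.2.2.2.2,
    ![x.2.1.1, x.2.1.2.1, x.2.2.1.1, x.2.2.1.2.1, x.2.2.1.2.2.1, x.2.2.2.2.2.1,
      x.1.2.1.1, x.1.2.1.2.1, x.1.2.1.2.2.1, x.1.2.1.2.2.2], x.1.2.2.1, x.1.2.2.2)
  invFun y := ((y.2.2.1, (y.2.2.2.2.2.2.1 6, y.2.2.2.2.2.2.1 7, y.2.2.2.2.2.2.1 8,
    y.2.2.2.2.2.2.1 9), y.2.2.2.2.2.2.2.1, y.2.2.2.2.2.2.2.2),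
    (y.2.2.2.2.2.2.1 0, y.2.2.2.2.2.2.1 1, y.2.2.2.1),
    (y.2.2.2.2.2.2.1 2, y.2.2.2.2.2.2.1 3, y.2.2.2.2.2.2.1 4, y.2.2.2.2.1),
    (y.1, y.2.1, y.2.2.2.2.2.2.1 5, y.2.2.2.2.2.1))
  left_inv _ := rfl
  right_inv y := by
    obtain ⟨h, U, r, w₀, w₁, w₂, d, b, t⟩ := y
    simp only [Prod.mk.injEq, true_and, and_true]
    funext i
    fin_cases i <;> rfl

/-- The probability that the reduction answers `1`, for given `g` and `α`. -/
noncomputable def outAvg (g : B.G) (T : B.G → B.GT → B.GT) : ℝ :=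
  avg fun h => avg fun U => avg fun ρ : Fin (2 ^ A.coins.eval κ) =>
    avg fun w₀ : Fin (2 ^ A.deviceCoins.eval κ) => avg fun w₁ : Fin (2 ^ A.deviceCoins.eval κ) =>
    avg fun w₂ : Fin (2 ^ A.deviceCoins.eval κ) => avg fun d => avg fun b =>
    avg fun τ : Fin (B.p ^ (3 * A.queries.eval κ)) =>
      outVal A κ hN g α k sh h (T h U) ρ w₀ w₁ w₂ d b τ

/-- The value of a function of the final state of the simulation. -/
noncomputable def endAvg (g : B.G) (φ : PublicKey B N → ZMod B.p → ZMod B.p → Data → Key B N → ℝ) : ℝ :=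
  avg fun x : Fin (2 ^ A.coins.eval κ) × (ZMod B.p × ZMod B.p × ZMod B.p × ZMod B.p) ×
      (Fin (N + 1) → ZMod B.p) × Fin (B.p ^ (3 * A.queries.eval κ)) =>
    let pk := simPk hN g α (target A B κ N x.1) x.2.1.1 x.2.1.2.1 x.2.1.2.2.1 x.2.1.2.2.2
      (expo (α : ZMod B.p) x.2.2.1)
    flagged (onKey A (userInput B κ N x.1) pk (target A B κ N x.1)
      (φ pk (target A B κ N x.1) x.2.1.2.2.1)) (simEnd A κ α k sh x.1 pk x.2.1.2.2.1 x.2.2.2)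

/-- After `regroup` the choices that determine the final view are on the outside and the three tests
use disjoint choices, so `avg_verd` applies. The digits 6 to 9 enter the public key and belong to
the outside, although the challenge test uses `γ` and `δ` again. -/
theorem outAvg_eq (hg : g ≠ 1) (T : B.G → B.GT → B.GT)
    (c : PublicKey B N → ZMod B.p → Data → Key B N → ℝ)
    (hc : ∀ ID γ θ ts δ ah v K,
      (avg fun x : B.G × B.GT × ZMod B.p × Fin (2 ^ A.deviceCoins.eval κ) =>
      ind (ChalTest A (simPk hN g α ID γ θ ts δ ah) ID v K x.1 (T x.1 x.2.1) δ γ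
        (pw (B.e g g) x.2.2.1) x.2.2.2)) = c (simPk hN g α ID γ θ ts δ ah) ID v K) :
    outAvg A κ hN α k sh g T = endAvg A κ hN α k sh g fun pk ID _ v K =>
      avg (honestAt A pk ID v K κ) * (1 - avg (probeAt A pk ID v K κ)) * c pk ID v K +
      (1 - avg (honestAt A pk ID v K κ)) * avg (probeAt A pk ID v K κ) * (1 - c pk ID v K) := by
  have : Nonempty (Fin (2 ^ A.deviceCoins.eval κ)) := ⟨⟨0, by positivity⟩⟩
  have e : outAvg A κ hN α k sh g T = avg fun y : B.G × B.GT × Fin (2 ^ A.coins.eval κ) ×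
      Fin (2 ^ A.deviceCoins.eval κ) × Fin (2 ^ A.deviceCoins.eval κ) ×
      Fin (2 ^ A.deviceCoins.eval κ) × (Fin 10 → ZMod B.p) × (Fin (N + 1) → ZMod B.p) ×
      Fin (B.p ^ (3 * A.queries.eval κ)) => outVal A κ hN g α k sh y.1 (T y.1 y.2.1) y.2.2.1
        y.2.2.2.1 y.2.2.2.2.1 y.2.2.2.2.2.1 y.2.2.2.2.2.2.1 y.2.2.2.2.2.2.2.1
        y.2.2.2.2.2.2.2.2 := by
    simp only [avg_prod]
    rfl
  rw [e, ← avg_bij regroup.bijective, avg_prod, endAvg]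
  congr 1
  funext o
  rw [avg_prod]
  simp only [avg_prod (α := ZMod B.p × ZMod B.p × ZMod B.p × Fin (2 ^ A.deviceCoins.eval κ))
    (β := B.G × B.GT × ZMod B.p × Fin (2 ^ A.deviceCoins.eval κ))]
  let pk := simPk hN g α (target A B κ N o.1) o.2.1.1 o.2.1.2.1 o.2.1.2.2.1 o.2.1.2.2.2
      (expo (α : ZMod B.p) o.2.2.1)
  let φ (x : ZMod B.p × ZMod B.p × Fin (2 ^ A.deviceCoins.eval κ))
      (y : ZMod B.p × ZMod B.p × ZMod B.p × Fin (2 ^ A.deviceCoins.eval κ))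
      (z : B.G × B.GT × ZMod B.p × Fin (2 ^ A.deviceCoins.eval κ)) (v : Data) (K : Key B N) : ℝ :=
    ind (Verd (HonestTest A pk (target A B κ N o.1) v K x.1 (pw (B.e g g) x.2.1) x.2.2)
      (ProbeTest A pk (target A B κ N o.1) v K y.1 (pw (B.e g g) y.2.1) (pw (B.e g g) y.2.2.1) y.2.2.2)
      (ChalTest A pk (target A B κ N o.1) v K z.1 (T z.1 z.2.1) o.2.1.2.2.2 o.2.1.1
        (pw (B.e g g) z.2.2.1) z.2.2.2))
  change (avg fun x => avg fun y => avg fun z => flagged (onKey A (userInput B κ N o.1) pk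
    (target A B κ N o.1) (φ x y z)) (simEnd A κ α k sh o.1 pk o.2.1.2.2.1 o.2.2.2)) = _
  simp only [avg_flagged_onKey]
  congr 2
  funext v K
  simp only [φ]
  rw [avg_verd, avg_honestTest A κ pk _ v K hg, avg_probeTest A κ pk _ v K hg, hc]

/-- The two experiments differ only in the success probability of the third test, which is that of
the first or of the second one. Each final view contributes a square or nothing, so there is no
cancellation between views. -/
theorem outAvg_sub (hg : g ≠ 1) :
    (outAvg A κ hN α k sh g fun h _ => B.e g h ^ ((α : ZMod B.p) ^ (N + 1 + 1)).val) -
      (outAvg A κ hN α k sh g fun _ U => U) =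
    endAvg A κ hN α k sh g fun pk ID _ v K => gap A pk ID v K κ := by
  have h1 := outAvg_eq A κ hN α k sh hg
    (fun h _ => B.e g h ^ ((α : ZMod B.p) ^ (N + 1 + 1)).val)
    (fun pk ID v K => avg (honestAt A pk ID v K κ))
    fun ID γ θ ts δ ah v K => avg_chalTest_real A κ α v K hg rfl rfl rfl
      (receiverElt_simPk hN _ ID γ θ ts δ ah)
  have h2 := outAvg_eq A κ hN α k sh hg (fun _ U => U)
    (fun pk ID v K => avg (probeAt A pk ID v K κ))
    fun ID γ θ ts δ ah v K => avg_chalTest_rand A κ v K hg rfl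
      (receiverElt_simPk hN _ ID γ θ ts δ ah)
  rw [h1, h2, endAvg, endAvg, endAvg, ← avg_sub]
  congr 1
  funext o
  rw [flagged_onKey_sub]
  congr 2
  funext v K
  rw [gap]
  ring

/-- The simulation with a uniformly random public key. -/
theorem endAvg_eq (hg : g ≠ 1) (φ : PublicKey B N → ZMod B.p → ZMod B.p → Data → Key B N → ℝ) :
    endAvg A κ hN α k sh g φ = avg fun ρ : Fin (2 ^ A.coins.eval κ) => avg fun ts =>
      avg fun a : Fin (N + 1) → ZMod B.p => avg fun z => avg fun g₂ => avg fun g₃ =>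
        simVal A (userInput B κ N ρ) ⟨g, pw g (α : ZMod B.p), g₂, g₃, z, fun i => pw g (a i)⟩ α k sh
          (target A B κ N ρ) (onKey A (userInput B κ N ρ) ⟨g, pw g (α : ZMod B.p), g₂, g₃, z, fun i => pw g (a i)⟩
            (target A B κ N ρ) (φ ⟨g, pw g (α : ZMod B.p), g₂, g₃, z, fun i => pw g (a i)⟩ (target A B κ N ρ) ts))
          ts (A.queries.eval κ) (false, [], []) := by
  rw [endAvg]
  simp only [avg_prod]
  congr 1
  funext ρ
  have e1 (γ θ ts δ : ZMod B.p) (b : Fin (N + 1) → ZMod B.p) :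
      (avg fun τ : Fin (B.p ^ (3 * A.queries.eval κ)) => flagged (onKey A (userInput B κ N ρ)
        (simPk hN g α (target A B κ N ρ) γ θ ts δ (expo (α : ZMod B.p) b)) (target A B κ N ρ)
        (φ (simPk hN g α (target A B κ N ρ) γ θ ts δ (expo (α : ZMod B.p) b)) (target A B κ N ρ) ts))
        (simEnd A κ α k sh ρ (simPk hN g α (target A B κ N ρ) γ θ ts δ (expo (α : ZMod B.p) b)) ts τ)) =
      simVal A (userInput B κ N ρ) (simPk hN g α (target A B κ N ρ) γ θ ts δ (expo (α : ZMod B.p) b))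
        α k sh (target A B κ N ρ) (onKey A (userInput B κ N ρ)
        (simPk hN g α (target A B κ N ρ) γ θ ts δ (expo (α : ZMod B.p) b)) (target A B κ N ρ)
        (φ (simPk hN g α (target A B κ N ρ) γ θ ts δ (expo (α : ZMod B.p) b)) (target A B κ N ρ) ts))
        ts (A.queries.eval κ) (false, [], []) := by
    rw [← simVal_tape, avgR_eq]
    rfl
  simp only [e1]
  generalize target A B κ N ρ = ID
  let J (ts : ZMod B.p) (a : Fin (N + 1) → ZMod B.p) (z g₂ g₃ : B.G) : ℝ :=
    simVal A (userInput B κ N ρ) ⟨g, pw g (α : ZMod B.p), g₂, g₃, z, fun i => pw g (a i)⟩ α k sh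
      ID (onKey A (userInput B κ N ρ) ⟨g, pw g (α : ZMod B.p), g₂, g₃, z, fun i => pw g (a i)⟩
        ID (φ ⟨g, pw g (α : ZMod B.p), g₂, g₃, z, fun i => pw g (a i)⟩ ID ts))
      ts (A.queries.eval κ) (false, [], [])
  let E (b : Fin (N + 1) → ZMod B.p) := expo (α : ZMod B.p) b
  change (avg fun γ => avg fun θ => avg fun ts => avg fun δ => avg fun b =>
    J ts (E b) (pw g (δ + ID * E b 0 - E b ⟨1, by omega⟩)) (pw g ((α : ZMod B.p) ^ (N + 1) + γ))
      (pw g (θ - ts * ((α : ZMod B.p) ^ (N + 1) + γ)))) = avg fun ts => avg fun a => avg fun z =>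
        avg fun g₂ => avg fun g₃ => J ts a z g₂ g₃
  have hE : Function.Bijective E :=
    (Equiv.addRight fun i : Fin (N + 1) => (α : ZMod B.p) ^ (N + 1 - (i : ℕ))).bijective
  have hpw (f : B.G → ℝ) (c : ZMod B.p) : (avg fun z => f (pw g (z + c))) = avg f := by
    rw [avg_shift fun z => f (pw g z)]
    exact avg_pw B.card_G hg f
  let V (γ θ ts δ : ZMod B.p) (b : Fin (N + 1) → ZMod B.p) : ℝ :=
    J ts (E b) (pw g (δ + (ID * E b 0 - E b ⟨1, by omega⟩))) (pw g (γ + (α : ZMod B.p) ^ (N + 1)))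
      (pw g (θ + -(ts * (γ + (α : ZMod B.p) ^ (N + 1)))))
  -- The averages are reordered so that the shift of each variable depends only on variables further
  -- out: `δ` randomises `z` given the `aᵢ`, `γ` randomises `g₂`, and `θ` randomises `g₃` given `ts`
  -- and `γ`. This shows that the public key is independent of `ts`.
  let e : (ZMod B.p × (Fin (N + 1) → ZMod B.p) × ZMod B.p × ZMod B.p × ZMod B.p) ≃
      ZMod B.p × ZMod B.p × ZMod B.p × ZMod B.p × (Fin (N + 1) → ZMod B.p) :=
    { toFun := fun x => (x.2.2.2.1, x.2.2.2.2, x.1, x.2.2.1, x.2.1)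
      invFun := fun y => (y.2.2.1, y.2.2.2.2, y.2.2.2.1, y.1, y.2.1)
      left_inv := fun _ => rfl
      right_inv := fun _ => rfl }
  have h1 := avg_bij e.bijective fun y => V y.1 y.2.1 y.2.2.1 y.2.2.2.1 y.2.2.2.2
  simp only [avg_prod] at h1
  simp only [add_comm ((α : ZMod B.p) ^ (N + 1)), add_sub_assoc]
  simp only [sub_eq_add_neg (_ : ZMod B.p) (_ * (_ + _))]
  refine h1.symm.trans ?_
  congr 1
  funext ts
  refine (avg_bij hE fun a => avg fun δ => avg fun γ => avg fun θ =>
    J ts a (pw g (δ + (ID * a 0 - a ⟨1, by omega⟩))) (pw g (γ + (α : ZMod B.p) ^ (N + 1)))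
      (pw g (θ + -(ts * (γ + (α : ZMod B.p) ^ (N + 1)))))).trans ?_
  congr 1
  funext a
  refine (hpw (fun z => avg fun γ => avg fun θ => J ts a z (pw g (γ + (α : ZMod B.p) ^ (N + 1)))
      (pw g (θ + -(ts * (γ + (α : ZMod B.p) ^ (N + 1)))))) _).trans ?_
  congr 1
  funext z
  have h2 (γ : ZMod B.p) := hpw (fun g₃ => J ts a z (pw g (γ + (α : ZMod B.p) ^ (N + 1))) g₃)
    (-(ts * (γ + (α : ZMod B.p) ^ (N + 1))))
  simp only [h2]
  exact hpw (fun g₂ => avg fun g₃ => J ts a z g₂ g₃) _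

end Typed

/-! ### The reduction as a distinguisher -/

noncomputable instance (B : BilinearGroup) : Fintype {g : B.G // g ≠ 1} := Fintype.ofFinite _

namespace Sim

variable (S : Sim) (X : ℕ[X])

/-- The reduction as a distinguisher, with `X` coins for the sampling of exponents. -/
noncomputable def reduction : Distinguisher where
  prog := S.exists_prog.choose
  coins := S.A.coins + (S.A.deviceCoins + (S.A.deviceCoins + (S.A.deviceCoins + X)))

theorem reduction_polyTime : (S.reduction X).prog.PolyTime := S.exists_prog.choose_spec.1

theorem reduction_run (x : Data) : (S.reduction X).prog.run x = .num (S.out x) :=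
  S.exists_prog.choose_spec.2 x

variable {i : S.𝒢.Idx} {κ N : ℕ} (hN : 1 ≤ N) (hNq : N ≤ S.Nq.eval κ)
  (hi : i ∈ (S.𝒢.gen κ).support)

/-- A challenge in given groups. -/
def challenge (g : {g : (S.𝒢.grp i).G // g ≠ 1}) (α : (ZMod (S.𝒢.grp i).p)ˣ) (h : (S.𝒢.grp i).G)
    (T : (S.𝒢.grp i).GT) : Ctx S := ⟨i, κ, N, hN, hNq, hi, g.1, g.2, α, h, T, 0⟩

/-- The element `T` of a challenge. -/
def chalT {B : BilinearGroup} (N : ℕ) (real : Bool) (g : B.G) (α : (ZMod B.p)ˣ) (h : B.G)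
    (U : B.GT) : B.GT :=
  if real then B.e g h ^ ((α : ZMod B.p) ^ (N + 1 + 1)).val else U

theorem Pr_dbdheExp (real : Bool) : Pr (dbdheExp (S.𝒢.grp i) κ (N + 1) (S.reduction X) real) =
    avg fun g : {g : (S.𝒢.grp i).G // g ≠ 1} => avg fun α => avg fun h => avg fun U =>
      avgR (2 ^ (S.challenge hN hNq hi g α h (chalT N real g.1 α h U)).coinLen (X.eval κ)) fun ω =>
        ind (S.out ((S.challenge hN hNq hi g α h (chalT N real g.1 α h U)).withCoins ω).x = 1) := by
  unfold dbdheExp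
  refine (Pr_bind_unif _).trans ?_
  congr 1
  funext g
  refine (Pr_bind_unif _).trans ?_
  congr 1
  funext α
  refine (Pr_bind_unif _).trans ?_
  congr 1
  funext h
  refine (Pr_bind_unif _).trans ?_
  congr 1
  funext U
  refine (Pr_bind_coins _ _).trans ?_
  have e : (S.reduction X).coins.eval κ =
      (S.challenge hN hNq hi g α h (chalT N real g.1 α h U)).coinLen (X.eval κ) := by
    simp only [reduction, eval_add]
    rfl
  rw [e]
  congr 1
  funext ω
  refine (Pr_pure_beq _ _).trans ?_
  rw [reduction_run]
  rfl

/-- The advantage of the reduction, for a fixed generator and a fixed exponent. -/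
theorem avg_real_sub_avg_rand (hK : S.Kq.eval κ < (S.𝒢.grp i).p) :
    (avg fun g : {g : (S.𝒢.grp i).G // g ≠ 1} => avg fun α => endAvg S.A κ hN α (S.Kq.eval κ)
      (S.challenge hN hNq hi g α 1 1).Q g.1 fun pk ID _ v K => gap S.A pk ID v K κ) -
        2 * (((S.𝒢.grp i).p ^ (10 + (N + 1 + 3 * S.A.queries.eval κ)) : ℕ) / (2 ^ X.eval κ : ℕ)) ≤
    Pr (dbdheExp (S.𝒢.grp i) κ (N + 1) (S.reduction X) true) -
      Pr (dbdheExp (S.𝒢.grp i) κ (N + 1) (S.reduction X) false) := by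
  -- `Q` depends on the challenge only through `N` and `α`, so the placeholders `1` for `h` and `T`
  -- are harmless.
  have key (real : Bool) : |Pr (dbdheExp (S.𝒢.grp i) κ (N + 1) (S.reduction X) real) -
      avg fun g : {g : (S.𝒢.grp i).G // g ≠ 1} => avg fun α => outAvg S.A κ hN α (S.Kq.eval κ)
        (S.challenge hN hNq hi g α 1 1).Q g.1 (chalT N real g.1 α)| ≤
      ((S.𝒢.grp i).p ^ (10 + (N + 1 + 3 * S.A.queries.eval κ)) : ℕ) / (2 ^ X.eval κ : ℕ) := by
    rw [S.Pr_dbdheExp X hN hNq hi]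
    refine abs_avg_sub_le fun g => abs_avg_sub_le fun α => abs_avg_sub_le fun h =>
      abs_avg_sub_le fun U => ?_
    have h1 := (S.challenge hN hNq hi g α h (chalT N real g.1 α h U)).avgR_out hK (X.eval κ)
    rw [avgR_eq (2 ^ S.A.coins.eval _)] at h1
    exact h1
  have h1 := (abs_le.1 (key true)).1
  have h2 := (abs_le.1 (key false)).2
  have h3 : (avg fun g : {g : (S.𝒢.grp i).G // g ≠ 1} => avg fun α => endAvg S.A κ hN α
      (S.Kq.eval κ) (S.challenge hN hNq hi g α 1 1).Q g.1 fun pk ID _ v K => gap S.A pk ID v K κ) =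
      (avg fun g : {g : (S.𝒢.grp i).G // g ≠ 1} => avg fun α => outAvg S.A κ hN α (S.Kq.eval κ)
        (S.challenge hN hNq hi g α 1 1).Q g.1 (chalT N true g.1 α)) -
      (avg fun g : {g : (S.𝒢.grp i).G // g ≠ 1} => avg fun α => outAvg S.A κ hN α (S.Kq.eval κ)
        (S.challenge hN hNq hi g α 1 1).Q g.1 (chalT N false g.1 α)) := by
    rw [← avg_sub]
    congr 1
    funext g
    rw [← avg_sub]
    congr 1
    funext α
    exact (outAvg_sub S.A κ hN α _ _ g.2).symm
  rw [h3]
  linarith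

end Sim

/-! ### The winning probability in terms of the gap -/

section Typed

variable {B : BilinearGroup} {N : ℕ} {A : DishonestUser} {κ : ℕ} {pk : PublicKey B N}
  {ID : ZMod B.p} {K : Key B N} {v : Data}

/-- In exponents to the base `g`, the decryption identity is `-s` times the sum of the first
validity relation and the one for `T₀`. Hence every valid key, however it was produced, decrypts
honest ciphertexts correctly, and a test ciphertext made from the user's key with honest `C₃` is
itself honest. -/
theorem decrypt_valid (hN : 1 ≤ N) (hg : pk.g ≠ 1) (hV : K.Valid pk ID) (s : ZMod B.p) :
    decrypt K ID {ID} ⟨1, pw pk.g s, pw (receiverElt pk {ID}) s, pw (B.e pk.g₁ pk.g₂) s⟩ =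
      (pw (B.e pk.g₁ pk.g₃) s)⁻¹ := by
  have hs := (pw_bijective B.card_G hg).2
  obtain ⟨a, ha⟩ := hs pk.g₁
  obtain ⟨x₂, h₂⟩ := hs pk.g₂
  obtain ⟨x₃, h₃⟩ := hs pk.g₃
  obtain ⟨ζ, hz⟩ := hs pk.z
  obtain ⟨a₀, ha₀⟩ := hs (pk.h 0)
  obtain ⟨a₁, ha₁⟩ := hs (pk.h ⟨1, by omega⟩)
  obtain ⟨k₁, hk₁⟩ := hs K.K₁
  obtain ⟨k₂, hk₂⟩ := hs K.K₂
  obtain ⟨t₀, ht₀⟩ := hs (K.T ⟨0, hN⟩)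
  have hE := pw_injective B.card_GT (B.e_self_ne_one hg)
  obtain ⟨h1, h2⟩ := hV
  have h2 := h2 ⟨0, hN⟩
  change _ = pw _ _ * _ * _ at h1
  change B.e _ _ = B.e _ (pk.h ⟨1, by omega⟩ * pw (pk.h 0) _) at h2
  rw [← hk₁, ← ha, ← h₂, ← h₃, ← hz, ← hk₂, B.e_pw_left, B.e_pw, B.e_pw, B.e_pw,
    ← pw_mul B.card_GT, ← pw_add B.card_GT, ← pw_add B.card_GT] at h1
  rw [← ht₀, ← hk₂, ← ha₀, ← ha₁, ← pw_mul B.card_G, ← pw_add B.card_G, B.e_pw_right, B.e_pw] at h2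
  have h1 := hE h1
  have h2 := hE h2
  rw [decrypt_singleton hN, receiverElt_singleton hN, ← hk₁, ← ha, ← h₂, ← h₃, ← hz, ← hk₂, ← ha₀,
    ← ha₁, ← ht₀]
  simp only [← pw_mul B.card_G, ← pw_mul B.card_GT, ← pw_add B.card_G, B.e_pw, ← pw_neg B.card_GT,
    ← pw_add B.card_GT]
  congr 1
  linear_combination -s * h1 - s * h2

/-- By validity the honest `C₀` is the one computed from the user's key. The exponent ranges over
units here but over all residues in the reduction; `sq_sub_le` accounts for the difference. -/
theorem Pr_openExp (hN : 1 ≤ N) (hg : pk.g ≠ 1) (hV : K.Valid pk ID) :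
    Pr (openExp pk {ID} (A.toDevice κ v ID)) =
      avg fun s : (ZMod B.p)ˣ => honestAt A pk ID v K κ s := by
  unfold openExp
  refine (Pr_bind_unif _).trans ?_
  unfold honestAt
  rw [avg_comm]
  congr 1
  funext m
  rw [encrypt]
  change Pr (PMF.bind (PMF.bind _ _) _) = _
  rw [PMF.bind_bind, Pr_bind_unif]
  congr 1
  funext s
  change Pr (PMF.bind (PMF.pure _) _) = _
  rw [PMF.pure_bind]
  change Pr (PMF.bind (PMF.map _ _) _) = _
  rw [Pr_bind_map_coins, avgR_eq]
  congr 1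
  funext w
  refine (Pr_pure_beq _ _).trans ?_
  rw [HonestTest, Opens, trialC, decrypt_valid hN hg hV, inv_inv]
  rfl

theorem Pr_probe : Pr (probe pk K ID {ID} (A.toDevice κ v ID)) =
      avg fun s : (ZMod B.p)ˣ => probeAt A pk ID v K κ s := by
  unfold probe
  refine (Pr_bind_unif _).trans ?_
  congr 1
  funext s
  refine (Pr_bind_unif _).trans ?_
  unfold probeAt
  congr 1
  funext C₃
  refine (Pr_bind_unif _).trans ?_
  congr 1
  funext m
  change Pr (PMF.bind (PMF.map _ _) _) = _
  rw [Pr_bind_map_coins, avgR_eq]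
  congr 1
  funext w
  exact Pr_pure_beq _ _

theorem honestAt_nonneg (s : ZMod B.p) : 0 ≤ honestAt A pk ID v K κ s :=
  avg_nonneg fun _ => avg_nonneg fun _ => ind_nonneg _

theorem honestAt_le_one (s : ZMod B.p) : honestAt A pk ID v K κ s ≤ 1 :=
  avg_le_one fun _ => avg_le_one fun _ => ind_le_one _

theorem probeAt_nonneg (s : ZMod B.p) : 0 ≤ probeAt A pk ID v K κ s :=
  avg_nonneg fun _ => avg_nonneg fun _ => avg_nonneg fun _ => ind_nonneg _

theorem probeAt_le_one (s : ZMod B.p) : probeAt A pk ID v K κ s ≤ 1 :=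
  avg_le_one fun _ => avg_le_one fun _ => avg_le_one fun _ => ind_le_one _

theorem gap_nonneg : 0 ≤ gap A pk ID v K κ := sq_nonneg _

theorem gap_le_one : gap A pk ID v K κ ≤ 1 := by
  rw [gap, sq_le_one_iff_abs_le_one, abs_le]
  constructor <;> linarith [avg_nonneg (honestAt_nonneg (A := A) (pk := pk) (ID := ID) (v := v) (K := K)
    (κ := κ)), avg_le_one (honestAt_le_one (A := A) (pk := pk) (ID := ID) (v := v) (K := K) (κ := κ)),
    avg_nonneg (probeAt_nonneg (A := A) (pk := pk) (ID := ID) (v := v) (K := K) (κ := κ)),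
    avg_le_one (probeAt_le_one (A := A) (pk := pk) (ID := ID) (v := v) (K := K) (κ := κ))]

/-- A useful device that is not traced treats the two kinds of ciphertexts differently. -/
theorem one_sub_pow_le {r x ε q : ℝ} {κ : ℕ} (hq : 0 ≤ q) (hε : 1 ≤ q * ε) (hr : ε ≤ r)
    (hx0 : 0 ≤ x) (hx1 : x ≤ 1) :
    (1 - x) ^ ⌈16 * (κ : ℝ) / ε⌉₊ ≤ Real.exp (-8 * κ) + 4 * q ^ 2 * (r - x) ^ 2 := by
  have hε0 : 0 < ε := by
    by_contra h
    nlinarith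
  -- If `x ≤ ε / 2`, then `r - x ≥ ε / 2`, so `2 * q * (r - x) ≥ 1` and the square alone exceeds the
  -- trivial bound. Otherwise the number of repetitions times `x` is at least `(16 * κ / ε) * (ε /
  -- 2) = 8 * κ`.
  rcases le_or_gt x (ε / 2) with h | h
  · have h1 : 1 ≤ 2 * q * (r - x) := by nlinarith
    have h2 : 1 ≤ (2 * q * (r - x)) ^ 2 := by nlinarith
    have h3 : (1 - x) ^ ⌈16 * (κ : ℝ) / ε⌉₊ ≤ 1 := pow_le_one₀ (by linarith) (by linarith)
    have h4 := Real.exp_pos (-8 * κ)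
    nlinarith
  · have h1 : (1 - x) ^ ⌈16 * (κ : ℝ) / ε⌉₊ ≤ Real.exp (-x) ^ ⌈16 * (κ : ℝ) / ε⌉₊ :=
      pow_le_pow_left₀ (by linarith) (Real.one_sub_le_exp_neg x) _
    rw [← Real.exp_nat_mul] at h1
    have h2 : Real.exp (⌈16 * (κ : ℝ) / ε⌉₊ * -x) ≤ Real.exp (-8 * κ) := by
      rw [Real.exp_le_exp]
      have h3 := Nat.le_ceil (16 * (κ : ℝ) / ε)
      rw [div_le_iff₀ hε0] at h3
      have h5 : (0 : ℝ) ≤ ⌈16 * (κ : ℝ) / ε⌉₊ := Nat.cast_nonneg _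
      nlinarith
    have h3 : 0 ≤ 4 * q ^ 2 * (r - x) ^ 2 := by positivity
    linarith

/-- Each average moves by at most `1 / p` when the exponent `0` is admitted. In the difference of
the two squares one factor is thus at most `2 / p`, the other at most `2`. -/
theorem sq_sub_le {p : ℕ} [Fact p.Prime] (f g : ZMod p → ℝ) (hf0 : ∀ a, 0 ≤ f a)
    (hf1 : ∀ a, f a ≤ 1) (hg0 : ∀ a, 0 ≤ g a) (hg1 : ∀ a, g a ≤ 1) :
    ((avg fun u : (ZMod p)ˣ => f u) - avg fun u : (ZMod p)ˣ => g u) ^ 2 ≤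
      (avg f - avg g) ^ 2 + 4 / p := by
  have h1 := abs_le.1 (abs_avg_units_sub_le f hf0 hf1)
  have h2 := abs_le.1 (abs_avg_units_sub_le g hg0 hg1)
  have h3 : 0 ≤ avg fun u : (ZMod p)ˣ => f u := avg_nonneg fun u => hf0 _
  have h4 : (avg fun u : (ZMod p)ˣ => f u) ≤ 1 := avg_le_one fun u => hf1 _
  have h5 : 0 ≤ avg fun u : (ZMod p)ˣ => g u := avg_nonneg fun u => hg0 _
  have h6 : (avg fun u : (ZMod p)ˣ => g u) ≤ 1 := avg_le_one fun u => hg1 _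
  have h7 := avg_nonneg hf0
  have h8 := avg_le_one hf1
  have h9 := avg_nonneg hg0
  have h10 := avg_le_one hg1
  rw [show (4 : ℝ) / p = 4 * (1 / p) by ring]
  generalize (1 : ℝ) / p = e at *
  generalize (avg fun u : (ZMod p)ˣ => f u) = a at *
  generalize (avg fun u : (ZMod p)ˣ => g u) = b at *
  generalize avg f = c at *
  generalize avg g = d at *
  have h11 : |(a - b) - (c - d)| ≤ 2 * e := abs_le.2 ⟨by linarith, by linarith⟩
  have h12 : |(a - b) + (c - d)| ≤ 2 := abs_le.2 ⟨by linarith, by linarith⟩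
  have h13 : ((a - b) - (c - d)) * ((a - b) + (c - d)) ≤ 2 * e * 2 := by
    refine (le_abs_self _).trans ?_
    rw [abs_mul]
    exact mul_le_mul h11 h12 (abs_nonneg _) ((abs_nonneg _).trans h11)
  nlinarith

theorem realVal_mono {F F' : List Data × List (ZMod B.p) → ℝ} {c d : ℝ} {init : Data}
    {α : (ZMod B.p)ˣ} (h : ∀ st, F st ≤ c * F' st + d) (n : ℕ) (st : List Data × List (ZMod B.p)) :
    realVal A init pk α F n st ≤ c * realVal A init pk α F' n st + d := by
  induction n generalizing st with
  | zero => exact h st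
  | succ n ih =>
    rw [realVal, realVal, ← avg_const_mul, ← avg_add_const]
    refine avg_mono fun x => ?_
    split_ifs
    · rw [← avg_const_mul, ← avg_add_const]
      refine avg_mono fun r => ?_
      rw [← avg_const_mul, ← avg_add_const]
      exact avg_mono fun t => ih _
    · exact ih _

open Classical in
/-- The end of the game. -/
noncomputable def verdict (B : BilinearGroup) (κ N : ℕ) (ε : ℝ) (A : DishonestUser) (init : Data)
    (pk : PublicKey B N) (ID : ZMod B.p) (st : List Data × List (ZMod B.p)) : PMF Bool :=
  match Key.read B N (A.output.run (view init pk st.1)) with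
  | none => PMF.pure false
  | some K =>
      if K.Valid pk ID ∧ Useful pk {ID} (A.toDevice κ (view init pk st.1) ID) ε then
        (trace κ ε pk K ID {ID} (A.toDevice κ (view init pk st.1) ID)).bind fun
          | .pkg => PMF.pure true
          | .user => PMF.pure false
      else PMF.pure false

/-- For a valid key and a useful device this is `one_sub_pow_le`; in all other cases the left side
is `0` and the gap is nonnegative. Usefulness thus disappears from the right side, which has to be
estimated by a reduction unable to test it. -/
theorem Pr_verdict_le {ε q : ℝ} {init : Data} (hN : 1 ≤ N) (hg : pk.g ≠ 1) (hq : 0 ≤ q)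
    (hε : 1 ≤ q * ε) (st : List Data × List (ZMod B.p)) : Pr (verdict B κ N ε A init pk ID st) ≤
      4 * q ^ 2 * onKey A init pk ID (fun v K => gap A pk ID v K κ) st +
        (Real.exp (-8 * κ) + 16 * q ^ 2 / B.p) := by
  have hc : 0 ≤ Real.exp (-8 * κ) + 16 * q ^ 2 / B.p := by positivity
  have h0 : 0 ≤ 4 * q ^ 2 * onKey A init pk ID (fun v K => gap A pk ID v K κ) st :=
    mul_nonneg (by positivity) (onKey_nonneg (fun _ _ => gap_nonneg) _)
  have hf : Pr (PMF.pure false) = 0 := (Pr_pure false).trans (if_neg (by simp))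
  rw [verdict]
  split
  · rw [hf]
    linarith
  · rename_i K hK
    split_ifs with h
    · have e : onKey A init pk ID (fun v K => gap A pk ID v K κ) st =
          gap A pk ID (view init pk st.1) K κ := by
        rw [onKey, hK]
        exact if_pos h.1
      rw [e]
      have h1 := Pr_counter (probe pk K ID {ID} (A.toDevice κ (view init pk st.1) ID))
        ⌈16 * (κ : ℝ) / ε⌉₊ Verdict.pkg Verdict.user (fun
          | .pkg => PMF.pure true
          | .user => PMF.pure false) ((Pr_pure true).trans (if_pos rfl)) hf
      have h2 : trace κ ε pk K ID {ID} (A.toDevice κ (view init pk st.1) ID) =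
          (counter (probe pk K ID {ID} (A.toDevice κ (view init pk st.1) ID))
            ⌈16 * (κ : ℝ) / ε⌉₊).bind fun n => PMF.pure (if n = 0 then .pkg else .user) := rfl
      rw [h2]
      refine h1.le.trans ?_
      have hu := h.2
      rw [Useful, Pr_openExp hN hg h.1] at hu
      rw [Pr_probe]
      refine (one_sub_pow_le hq hε hu (avg_nonneg fun s => probeAt_nonneg _)
        (avg_le_one fun s => probeAt_le_one _)).trans ?_
      have h3 := sq_sub_le (honestAt A pk ID (view init pk st.1) K κ)
        (probeAt A pk ID (view init pk st.1) K κ) honestAt_nonneg honestAt_le_one probeAt_nonneg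
        probeAt_le_one
      rw [← gap] at h3
      have h4 := mul_le_mul_of_nonneg_left h3 (by positivity : 0 ≤ 4 * q ^ 2)
      have e2 : 4 * q ^ 2 * (4 / (B.p : ℝ)) = 16 * q ^ 2 / B.p := by ring
      rw [mul_add, e2] at h4
      linarith
    · rw [hf]
      linarith

theorem Pr_newKeyGame (ε : ℝ) : Pr (newKeyGame B κ N ε A) =
    avg fun ρ : Fin (2 ^ A.coins.eval κ) => avg fun g : {g : B.G // g ≠ 1} =>
      avg fun z => avg fun a : Fin (N + 1) → ZMod B.p => avg fun α : (ZMod B.p)ˣ =>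
      avg fun g₂ => avg fun g₃ => realVal A (userInput B κ N ρ)
        ⟨g.1, pw g.1 (α : ZMod B.p), g₂, g₃, z, fun i => pw g.1 (a i)⟩ α
        (fun st => Pr (verdict B κ N ε A (userInput B κ N ρ)
          ⟨g.1, pw g.1 (α : ZMod B.p), g₂, g₃, z, fun i => pw g.1 (a i)⟩ (target A B κ N ρ) st))
        (A.queries.eval κ) ([], []) := by
  unfold newKeyGame setup
  refine (Pr_bind_coins _ _).trans ?_
  rw [avgR_eq]
  congr 1
  funext ρ
  change Pr (PMF.bind (PMF.bind _ _) _) = _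
  rw [PMF.bind_bind]
  refine (Pr_bind_unif _).trans ?_
  congr 1
  funext g
  change Pr (PMF.bind (PMF.bind _ _) _) = _
  rw [PMF.bind_bind]
  refine (Pr_bind_unif _).trans ?_
  congr 1
  funext z
  change Pr (PMF.bind (PMF.bind _ _) _) = _
  rw [PMF.bind_bind]
  refine (Pr_bind_unif _).trans ?_
  congr 1
  funext a
  change Pr (PMF.bind (PMF.bind _ _) _) = _
  rw [PMF.bind_bind]
  refine (Pr_bind_unif _).trans ?_
  congr 1
  funext α
  change Pr (PMF.bind (PMF.bind _ _) _) = _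
  rw [PMF.bind_bind]
  refine (Pr_bind_unif _).trans ?_
  congr 1
  funext g₂
  change Pr (PMF.bind (PMF.bind _ _) _) = _
  rw [PMF.bind_bind]
  refine (Pr_bind_unif _).trans ?_
  congr 1
  funext g₃
  change Pr (PMF.bind (PMF.pure _) _) = _
  rw [PMF.pure_bind]
  refine (Pr_sessions _ _ _ _ _ _).trans ?_
  congr 1

end Typed

end AIBBE

/-! ### Losses and asymptotics -/

namespace AIBBE

open Polynomial Filter Topology

namespace Sim

variable (S : Sim) (X : ℕ[X])

/-- The loss of the reduction. -/
noncomputable def loss (κ N p : ℕ) (q : ℝ) : ℝ :=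
  4 * q ^ 2 * (2 * ((p ^ (10 + (N + 1 + 3 * S.A.queries.eval κ)) : ℕ) / (2 ^ X.eval κ : ℕ)) +
    S.A.queries.eval κ * (1 / (S.Kq.eval κ + 1) + 2 / p)) + (Real.exp (-8 * κ) + 16 * q ^ 2 / p)

theorem Pr_newKeyGame_le {i : S.𝒢.Idx} {κ N : ℕ} (hN : 1 ≤ N) (hNq : N ≤ S.Nq.eval κ)
    (hi : i ∈ (S.𝒢.gen κ).support) (hK : S.Kq.eval κ < (S.𝒢.grp i).p) {ε q : ℝ} (hq : 0 ≤ q)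
    (hε : 1 ≤ q * ε) : Pr (newKeyGame (S.𝒢.grp i) κ N ε S.A) ≤
      4 * q ^ 2 * (Pr (dbdheExp (S.𝒢.grp i) κ (N + 1) (S.reduction X) true) -
        Pr (dbdheExp (S.𝒢.grp i) κ (N + 1) (S.reduction X) false)) +
      S.loss X κ N (S.𝒢.grp i).p q := by
  have hadv := S.avg_real_sub_avg_rand X hN hNq hi hK
  have : Nonempty (Fin (2 ^ S.A.coins.eval κ)) := ⟨⟨0, by positivity⟩⟩
  let B := S.𝒢.grp i
  let pk (g : {g : B.G // g ≠ 1}) (α : (ZMod B.p)ˣ) (g₂ g₃ z : B.G) (a : Fin (N + 1) → ZMod B.p) :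
      PublicKey B N := ⟨g.1, pw g.1 (α : ZMod B.p), g₂, g₃, z, fun i => pw g.1 (a i)⟩
  let V (ρ : Fin (2 ^ S.A.coins.eval κ)) (g : {g : B.G // g ≠ 1}) (z : B.G)
      (a : Fin (N + 1) → ZMod B.p) (α : (ZMod B.p)ˣ) (g₂ g₃ : B.G) (ts : ZMod B.p) : ℝ :=
    simVal S.A (userInput B κ N ρ) (pk g α g₂ g₃ z a) α (S.Kq.eval κ)
      (S.challenge hN hNq hi g α 1 1).Q (target S.A B κ N ρ)
      (onKey S.A (userInput B κ N ρ) (pk g α g₂ g₃ z a) (target S.A B κ N ρ)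
        fun v K => gap S.A (pk g α g₂ g₃ z a) (target S.A B κ N ρ) v K κ) ts
      (S.A.queries.eval κ) (false, [], [])
  have h1 : Pr (newKeyGame B κ N ε S.A) ≤ 4 * q ^ 2 * ((avg fun ρ => avg fun g => avg fun z =>
      avg fun a => avg fun α => avg fun g₂ => avg fun g₃ => avg fun ts => V ρ g z a α g₂ g₃ ts) +
      S.A.queries.eval κ * (1 / (S.Kq.eval κ + 1) + 2 / B.p)) +
      (Real.exp (-8 * κ) + 16 * q ^ 2 / B.p) := by
    rw [Pr_newKeyGame]
    simp only [← avg_add_const, ← avg_const_mul]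
    refine avg_mono fun ρ => avg_mono fun g => avg_mono fun z => avg_mono fun a =>
      avg_mono fun α => avg_mono fun g₂ => avg_mono fun g₃ => ?_
    refine (realVal_mono (fun st => Pr_verdict_le hN g.2 hq hε st) _ _).trans ?_
    have h := realVal_le_avg_simVal S.A (userInput B κ N ρ) (pk g α g₂ g₃ z a) α (S.Kq.eval κ)
      (S.challenge hN hNq hi g α 1 1).Q (target S.A B κ N ρ)
      (F := onKey S.A (userInput B κ N ρ) (pk g α g₂ g₃ z a) (target S.A B κ N ρ)
        fun v K => gap S.A (pk g α g₂ g₃ z a) (target S.A B κ N ρ) v K κ)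
      (onKey_nonneg fun _ _ => gap_nonneg) (onKey_le_one fun _ _ => gap_le_one)
      (S.A.queries.eval κ) ([], [])
    have h' := mul_le_mul_of_nonneg_left h (by positivity : 0 ≤ 4 * q ^ 2)
    simp only [avg_add_const, avg_const_mul]
    exact add_le_add h' le_rfl
  -- The game and the reduction draw the same independent choices in different orders.
  have h2 : (avg fun ρ => avg fun g => avg fun z =>
      avg fun a => avg fun α => avg fun g₂ => avg fun g₃ => avg fun ts => V ρ g z a α g₂ g₃ ts) =
      avg fun g => avg fun α => avg fun ρ => avg fun ts => avg fun a => avg fun z => avg fun g₂ =>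
        avg fun g₃ => V ρ g z a α g₂ g₃ ts := by
    let e : (Fin (2 ^ S.A.coins.eval κ) × {g : B.G // g ≠ 1} × B.G × (Fin (N + 1) → ZMod B.p) ×
        (ZMod B.p)ˣ × B.G × B.G × ZMod B.p) ≃ {g : B.G // g ≠ 1} × (ZMod B.p)ˣ ×
        Fin (2 ^ S.A.coins.eval κ) × ZMod B.p × (Fin (N + 1) → ZMod B.p) × B.G × B.G × B.G :=
      { toFun := fun x => (x.2.1, x.2.2.2.2.1, x.1, x.2.2.2.2.2.2.2, x.2.2.2.1, x.2.2.1,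
          x.2.2.2.2.2.1, x.2.2.2.2.2.2.1)
        invFun := fun y => (y.2.2.1, y.1, y.2.2.2.2.2.1, y.2.2.2.2.1, y.2.1, y.2.2.2.2.2.2.1,
          y.2.2.2.2.2.2.2, y.2.2.2.1)
        left_inv := fun _ => rfl
        right_inv := fun _ => rfl }
    have h := avg_bij e.bijective fun y => V y.2.2.1 y.1 y.2.2.2.2.2.1 y.2.2.2.2.1 y.2.1
      y.2.2.2.2.2.2.1 y.2.2.2.2.2.2.2 y.2.2.2.1
    simp only [avg_prod] at h
    exact h
  have h3 : (avg fun g : {g : B.G // g ≠ 1} => avg fun α => endAvg S.A κ hN α (S.Kq.eval κ)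
      (S.challenge hN hNq hi g α 1 1).Q g.1 fun pk ID _ v K => gap S.A pk ID v K κ) =
      avg fun g => avg fun α => avg fun ρ => avg fun ts => avg fun a => avg fun z => avg fun g₂ =>
        avg fun g₃ => V ρ g z a α g₂ g₃ ts := by
    congr 1
    funext g
    congr 1
    funext α
    exact endAvg_eq S.A κ hN α _ _ g.2 _
  rw [h3, ← h2] at hadv
  refine h1.trans ?_
  rw [loss]
  have h4 := mul_le_mul_of_nonneg_left hadv (by positivity : 0 ≤ 4 * q ^ 2)
  linarith

end Sim

/-- A bound that is affine in the signed difference survives averaging over the choice of groups.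
With absolute values inside it could not be compared with the advantage, where the absolute value is
taken after averaging. -/
theorem Pr_bind_le {ι : Type} (μ : PMF ι) (k k₁ k₂ : ι → PMF Bool) (c E : ℝ)
    (h : ∀ i ∈ μ.support, Pr (k i) ≤ c * (Pr (k₁ i) - Pr (k₂ i)) + E) :
    Pr (μ.bind k) ≤ c * (Pr (μ.bind k₁) - Pr (μ.bind k₂)) + E := by
  have hs (k : ι → PMF Bool) : HasSum (fun i => (μ i).toReal * Pr (k i)) (Pr (μ.bind k)) := by
    rw [Pr_bind]
    refine (Summable.of_nonneg_of_le (fun i => mul_nonneg ENNReal.toReal_nonneg (Pr_nonneg _))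
      (fun i => ?_) (summable_toReal μ)).hasSum
    exact mul_le_of_le_one_right ENNReal.toReal_nonneg (Pr_le_one _)
  have h1 : HasSum (fun i => (μ i).toReal) 1 := by
    rw [← tsum_toReal μ]
    exact (summable_toReal μ).hasSum
  have h2 := ((((hs k₁).sub (hs k₂)).mul_left c).add (h1.mul_right E))
  rw [one_mul] at h2
  refine hasSum_le (fun i => ?_) (hs k) h2
  by_cases hi : i ∈ μ.support
  · have := mul_le_mul_of_nonneg_left (h i hi) (ENNReal.toReal_nonneg (a := μ i))
    linarith
  · have : μ i = 0 := by rwa [PMF.mem_support_iff, not_not] at hi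
    simp [this]

/-- Encodings are distinct numbers of bounded length. The bound on the order determines how many
coins suffice for nearly uniform exponents. -/
theorem order_le (𝒢 : GroupGenerator) {κ : ℕ} {i : 𝒢.Idx} (hi : i ∈ (𝒢.gen κ).support) :
    (𝒢.grp i).p ≤ 2 ^ 𝒢.sizeBound.eval κ := by
  rw [← (𝒢.grp i).card_G, ← Fintype.card_fin (2 ^ 𝒢.sizeBound.eval κ)]
  refine Fintype.card_le_of_injective (fun x => ⟨(𝒢.grp i).encG x, ?_⟩) fun x y h =>
    (𝒢.grp i).encG_injective (Fin.mk.inj h)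
  have h1 := 𝒢.encG_size κ i hi x
  simp only [BilinearGroup.dG, Data.size] at h1
  rw [← Nat.size_le]
  omega

theorem negligible_poly_mul {f : ℕ → ℝ} (hf : Negligible f) (q : ℕ[X]) :
    Negligible fun κ => (q.eval κ : ℕ) * f κ := by
  have h := hf.polynomial_mul (q.map (Nat.castRingHom ℝ))
  rw [Negligible]
  simpa using h

theorem negligible_half_pow : Negligible fun κ => (1 / 2 : ℝ) ^ κ := fun n =>
  tendsto_pow_const_mul_const_pow_of_abs_lt_one n (by norm_num [abs_of_pos])

theorem eventually_lt_two_pow (q : ℕ[X]) : ∀ᶠ κ in atTop, q.eval κ < 2 ^ κ := by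
  have h := negligible_poly_mul negligible_half_pow q 0
  simp only [pow_zero, one_mul] at h
  filter_upwards [h.eventually_lt_const one_pos] with κ hκ
  rw [one_div, inv_pow, ← div_eq_mul_inv, div_lt_one (by positivity)] at hκ
  exact_mod_cast hκ

namespace Sim

variable (S : Sim)

/-- The number of coins for the sampling of exponents. -/
noncomputable def sampleCoins : ℕ[X] :=
  S.𝒢.sizeBound * (10 + (S.Nq + 1 + 3 * S.A.queries)) + Polynomial.X

/-- All terms but that of failed extraction are at most multiples of `2 ^ (-κ)`: those with the
order because `p > 2 ^ κ`, and the sampling error because `sampleCoins` exceeds the length of the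
sampled tuple by `κ` bits. In the coefficient, `24 = 8 + 16` collects sampling and the units among
the test exponents; the term with `queries` comes from the units `r` and `t₁` in key generation. -/
theorem loss_le {i : S.𝒢.Idx} {κ N : ℕ} (hNq : N ≤ S.Nq.eval κ)
    (hi : i ∈ (S.𝒢.gen κ).support) (q : ℝ) : S.loss S.sampleCoins κ N (S.𝒢.grp i).p q ≤
      4 * q ^ 2 * S.A.queries.eval κ / (S.Kq.eval κ + 1) +
        (24 * q ^ 2 + 8 * q ^ 2 * S.A.queries.eval κ + 1) * (1 / 2) ^ κ := by
  have hp : (1 : ℝ) / (S.𝒢.grp i).p ≤ (1 / 2) ^ κ := by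
    rw [one_div_pow]
    refine one_div_le_one_div_of_le (by positivity) ?_
    exact_mod_cast (S.𝒢.order_gt κ i hi).le
  have ht : (((S.𝒢.grp i).p ^ (10 + (N + 1 + 3 * S.A.queries.eval κ)) : ℕ) : ℝ) /
      (2 ^ S.sampleCoins.eval κ : ℕ) ≤ (1 / 2) ^ κ := by
    have h1 : (S.𝒢.grp i).p ^ (10 + (N + 1 + 3 * S.A.queries.eval κ)) * 2 ^ κ ≤
        2 ^ S.sampleCoins.eval κ := by
      have e : S.sampleCoins.eval κ = S.𝒢.sizeBound.eval κ *
          (10 + (S.Nq.eval κ + 1 + 3 * S.A.queries.eval κ)) + κ := by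
        simp [sampleCoins]
      rw [e, pow_add 2 _ κ, pow_mul]
      refine Nat.mul_le_mul_right _ ?_
      refine (Nat.pow_le_pow_left (order_le S.𝒢 hi) _).trans ?_
      exact Nat.pow_le_pow_right (by positivity) (by omega)
    rw [one_div_pow, div_le_div_iff₀ (by positivity) (by positivity), one_mul]
    exact_mod_cast h1
  have hexp : Real.exp (-8 * κ) ≤ (1 / 2) ^ κ := by
    have h1 : Real.exp (-8) ≤ 1 / 2 := by
      rw [Real.exp_neg, inv_eq_one_div]
      refine one_div_le_one_div_of_le (by norm_num) ?_
      linarith [Real.add_one_le_exp 8]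
    have e : -8 * (κ : ℝ) = κ * (-8) := by ring
    rw [e, Real.exp_nat_mul]
    exact pow_le_pow_left₀ (Real.exp_pos _).le h1 _
  have hQ : (0 : ℝ) ≤ S.A.queries.eval κ := Nat.cast_nonneg _
  rw [loss]
  have e : (2 : ℝ) / (S.𝒢.grp i).p = 2 * (1 / (S.𝒢.grp i).p) := by ring
  have e' : 16 * q ^ 2 / ((S.𝒢.grp i).p : ℝ) = 16 * q ^ 2 * (1 / (S.𝒢.grp i).p) := by ring
  rw [e, e']
  generalize (1 : ℝ) / (S.𝒢.grp i).p = y at *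
  generalize (((S.𝒢.grp i).p ^ (10 + (N + 1 + 3 * S.A.queries.eval κ)) : ℕ) : ℝ) /
      (2 ^ S.sampleCoins.eval κ : ℕ) = t at *
  generalize (1 / 2 : ℝ) ^ κ = w at *
  have h1 := mul_le_mul_of_nonneg_left ht (by positivity : 0 ≤ 8 * q ^ 2)
  have h2 := mul_le_mul_of_nonneg_left hp (by positivity : 0 ≤ 8 * q ^ 2 * S.A.queries.eval κ)
  have h3 := mul_le_mul_of_nonneg_left hp (by positivity : 0 ≤ 16 * q ^ 2)
  have e3 : 4 * q ^ 2 * ((S.A.queries.eval κ : ℕ) : ℝ) / (S.Kq.eval κ + 1) =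
      4 * q ^ 2 * (S.A.queries.eval κ * (1 / (S.Kq.eval κ + 1))) := by ring
  rw [e3]
  linarith

end Sim

end AIBBE

theorem mainTheorem10 (𝒢 : AIBBE.GroupGenerator) (N : ℕ → ℕ) (hN : ∀ κ, 1 ≤ N κ)
    (hNpoly : AIBBE.PolyBounded N) (hDBDHE : AIBBE.DBDHE 𝒢 (fun κ => N κ + 1))
    (ε : ℕ → ℝ) (hε : AIBBE.Noticeable ε) (A : AIBBE.DishonestUser) (hA : A.IsPPT) :
    AIBBE.Negligible (AIBBE.newKeyAdv 𝒢 N ε A) := by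
  obtain ⟨Nq, hNq⟩ := hNpoly
  obtain ⟨q, hq⟩ := hε
  intro n
  -- The depth of rewinding depends on the power `κ ^ n` to be beaten: it makes the loss from failed
  -- extraction smaller than `κ ^ (-(n + 1))`.
  let S : AIBBE.Sim := ⟨𝒢, A, hA, Nq, 4 * q ^ 2 * A.queries * Polynomial.X ^ (n + 1)⟩
  have hD := hDBDHE (S.reduction S.sampleCoins) (S.reduction_polyTime _)
  have h1 := AIBBE.negligible_poly_mul hD (4 * q ^ 2) n
  have h2 := AIBBE.negligible_poly_mul AIBBE.negligible_half_pow
    (24 * q ^ 2 + 8 * q ^ 2 * A.queries + 1) n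
  have h3 := (h1.add h2).add tendsto_one_div_atTop_nhds_zero_nat
  simp only [add_zero] at h3
  refine tendsto_of_tendsto_of_tendsto_of_le_of_le' tendsto_const_nhds h3
    (Filter.Eventually.of_forall fun κ => mul_nonneg (by positivity) (AIBBE.Pr_nonneg _)) ?_
  -- Extraction divides by distances up to `Kq`, which are nonzero modulo the order once `Kq` is
  -- below `2 ^ κ < p`.
  filter_upwards [AIBBE.eventually_lt_two_pow S.Kq, Filter.eventually_gt_atTop 0] with κ hK hκ
  have h4 : AIBBE.newKeyAdv 𝒢 N ε A κ ≤ 4 * ((q.eval κ : ℕ) : ℝ) ^ 2 *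
      AIBBE.dbdheAdv 𝒢 (fun κ => N κ + 1) (S.reduction S.sampleCoins) κ +
      (4 * ((q.eval κ : ℕ) : ℝ) ^ 2 * A.queries.eval κ / (S.Kq.eval κ + 1) +
        (24 * ((q.eval κ : ℕ) : ℝ) ^ 2 + 8 * ((q.eval κ : ℕ) : ℝ) ^ 2 * A.queries.eval κ + 1) *
          (1 / 2) ^ κ) := by
    refine (AIBBE.Pr_bind_le _ _ (fun i => AIBBE.dbdheExp (𝒢.grp i) κ (N κ + 1)
      (S.reduction S.sampleCoins) true) (fun i => AIBBE.dbdheExp (𝒢.grp i) κ (N κ + 1)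
      (S.reduction S.sampleCoins) false) (4 * ((q.eval κ : ℕ) : ℝ) ^ 2) _ fun i hi =>
      (S.Pr_newKeyGame_le S.sampleCoins (hN κ) (hNq κ) hi (hK.trans (𝒢.order_gt κ i hi))
        (Nat.cast_nonneg _) (hq κ)).trans
        (add_le_add_right (S.loss_le (hNq κ) hi _) _)).trans ?_
    gcongr
    exact le_abs_self _
  have h5 : (κ : ℝ) ^ n * (4 * ((q.eval κ : ℕ) : ℝ) ^ 2 * A.queries.eval κ / (S.Kq.eval κ + 1)) ≤
      1 / κ := by
    have e : ((S.Kq.eval κ : ℕ) : ℝ) = 4 * ((q.eval κ : ℕ) : ℝ) ^ 2 * A.queries.eval κ * κ ^ (n + 1) := by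
      simp [S]
    have hκ' : (0 : ℝ) < κ := by exact_mod_cast hκ
    rw [e, ← mul_div_assoc, div_le_div_iff₀ (by positivity) hκ', one_mul]
    refine le_trans (le_of_eq ?_) (le_add_of_nonneg_right zero_le_one)
    ring
  have h6 := mul_le_mul_of_nonneg_left h4 (by positivity : (0 : ℝ) ≤ (κ : ℝ) ^ n)
  have e1 : (((4 * q ^ 2 : Polynomial ℕ).eval κ : ℕ) : ℝ) = 4 * ((q.eval κ : ℕ) : ℝ) ^ 2 := by simp
  have e2 : (((24 * q ^ 2 + 8 * q ^ 2 * A.queries + 1 : Polynomial ℕ).eval κ : ℕ) : ℝ) =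
      24 * ((q.eval κ : ℕ) : ℝ) ^ 2 + 8 * ((q.eval κ : ℕ) : ℝ) ^ 2 * A.queries.eval κ + 1 := by simp
  simp only [e1, e2]
  linarith
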